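/- **Theorem 1.5.** Let $X$ be a complex manifold of dimension $n$ and let $E\to X$ be a holomorphic vector bundle of rank $r$. A *singular hermitian metric* on $E$ is a measurable map $h$ from $X$ to the (finite, possibly degenerate) non-negative hermitian forms on the fibres of $E$; it is *negatively curved in the sense of Griffiths* if $\|u\|_h^2$ is plurisubharmonic on $U$ for every open $U\subseteq X$ and every holomorphic section $u$ of $E$ over $U$. Let $h$ be a singular hermitian metric on $E$ that is negatively curved in the sense of Griffiths, and suppose that $\det h>\varepsilon$ for some $\varepsilon>0$, locally and in holomorphic frames: every point of $X$ has a neighbourhood $U$ with a holomorphic frame of $E|_U$ and an $\varepsilon>0$ such that the determinant of the matrix of $h$ in this frame is $>\varepsilon$ on $U$. Take any holomorphic chart of $X$, with image $\Omega\subseteq\mathbb C^n$ and coordinates $z_1,\dots,z_n$, and any holomorphic frame of $E$ over the domain of the chart, and regard $h$ as an $r\times r$-matrix valued function on $\Omega$, with $\|v\|_h^2=v^*hv$. Then the following hold. 1. The distributional derivative $\partial h$ has locally integrable coefficients, $h$ is invertible almost everywhere, and the matrix of $(1,0)$-forms $\theta^h:=h^{-1}\partial h=\sum_j\theta_j\,dz_j$,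 which is thereby well defined almost everywhere, has coefficients in $L^2_{loc}(\Omega)$. 2. The matrix of currents $\Theta^h:=\bar\partial\theta^h=\sum_{j,k}\Theta^h_{jk}\,dz_j\wedge d\bar z_k$ on $\Omega$ is well defined and has measure coefficients: the entries of every $\Theta^h_{jk}=-\partial\theta_j/\partial\bar z_k$ are complex Radon measures on $\Omega$. 3. Let $\{h_\nu\}$ be any sequence of smooth (positive definite) hermitian metrics on $E$ that are negatively curved in the sense of Griffiths and decrease pointwise to $h$. Let $\Theta^{h_\nu}=\bar\partial(h_\nu^{-1}\partial h_\nu)=\sum_{j,k}\Theta^{h_\nu}_{jk}\,dz_j\wedge d\bar z_k$, let $\xi=\sum_j\xi_j\,\partial/\partial z_j$ be any smooth vector field on $\Omega$, and put $\tilde\Theta^{h_\nu}:=\sum_{j,k}\Theta^{h_\nu}_{jk}\xi_j\bar\xi_k$ and $\tilde\Theta^{h}:=\sum_{j,k}\Theta^{h}_{jk}\xi_j\bar\xi_k$. Then $\tilde\Theta^{h_\nu}$ converges to $\tilde\Theta^h$ weakly as currents with measure coefficients: for every continuous function $\varphi$ with compact support in $\Omega$, the integrals $\int_\Omega\varphi\,\tilde\Theta^{h_\nu}\,d\lambda$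 ($\lambda$ being Lebesgue measure) converge, entry by entry, to $\int_\Omega\varphi\,d\tilde\Theta^h$. -/

import Mathlib

open Set Filter Topology MeasureTheory Bundle
open scoped Manifold ContDiff ComplexConjugate

noncomputable section

namespace SingHerm

/-! ### Analysis on open subsets of `ℂⁿ` -/

/-- The Wirtinger derivative `∂f/∂z_j = (∂f/∂x_j - i ∂f/∂y_j) / 2`. -/
def dz {n : ℕ} (j : Fin n) (f : (Fin n → ℂ) → ℂ) (z : Fin n → ℂ) : ℂ :=
  (1 / 2) * (fderiv ℝ f z (Pi.single j 1) - Complex.I * fderiv ℝ f z (Pi.single j Complex.I))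

/-- The Wirtinger derivative `∂f/∂z̄_j = (∂f/∂x_j + i ∂f/∂y_j) / 2`. -/
def dzbar {n : ℕ} (j : Fin n) (f : (Fin n → ℂ) → ℂ) (z : Fin n → ℂ) : ℂ :=
  (1 / 2) * (fderiv ℝ f z (Pi.single j 1) + Complex.I * fderiv ℝ f z (Pi.single j Complex.I))

/-- `φ ∈ C_c(Ω)`: continuous with compact support contained in `Ω`. -/
structure IsCc {n : ℕ} (Ω : Set (Fin n → ℂ)) (φ : (Fin n → ℂ) → ℂ) : Prop where
  continuous : Continuous φ
  hasCompactSupport : HasCompactSupport φ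
  tsupport_subset : tsupport φ ⊆ Ω

/-- `φ ∈ C_c^∞(Ω)`: a (complex valued) test function on `Ω`. -/
structure IsTest {n : ℕ} (Ω : Set (Fin n → ℂ)) (φ : (Fin n → ℂ) → ℂ) : Prop where
  contDiff : ContDiff ℝ ∞ φ
  hasCompactSupport : HasCompactSupport φ
  tsupport_subset : tsupport φ ⊆ Ω

/-- `f ∈ L²_loc(Ω)`. -/
def MemL2Loc {n : ℕ} (Ω : Set (Fin n → ℂ)) (f : (Fin n → ℂ) → ℂ) : Prop :=
  ∀ K ⊆ Ω, IsCompact K → MemLp f 2 (volume.restrict K)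

/-- On `Ω` the locally integrable function `g` is the derivative `∂f/∂z_j` of the locally integrable
function `f` in the sense of distributions. -/
structure HasWeakDz {n : ℕ} (Ω : Set (Fin n → ℂ)) (j : Fin n) (f g : (Fin n → ℂ) → ℂ) :
    Prop where
  locallyIntegrable_fun : LocallyIntegrableOn f Ω volume
  locallyIntegrable_deriv : LocallyIntegrableOn g Ω volume
  integral_eq : ∀ φ : (Fin n → ℂ) → ℂ, IsTest Ω φ →
    ∫ z, f z * dz j φ z = - ∫ z, g z * φ z

/-- A complex Radon measure on the open set `Ω`: a linear functional on `C_c(Ω)` that on functions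
supported in a fixed compact subset of `Ω` is bounded by the supremum norm.
(The values of `T` outside `C_c(Ω)` carry no information.) -/
structure IsRadonMeasure {n : ℕ} (Ω : Set (Fin n → ℂ)) (T : ((Fin n → ℂ) → ℂ) → ℂ) : Prop where
  map_add : ∀ φ ψ, IsCc Ω φ → IsCc Ω ψ → T (fun z => φ z + ψ z) = T φ + T ψ
  map_smul : ∀ (c : ℂ) (φ), IsCc Ω φ → T (fun z => c * φ z) = c * T φ
  bound : ∀ K ⊆ Ω, IsCompact K → ∃ C : ℝ, ∀ φ, IsCc Ω φ → tsupport φ ⊆ K →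
    ∀ M : ℝ, (∀ z, ‖φ z‖ ≤ M) → ‖T φ‖ ≤ C * M

/-- Plurisubharmonicity of a finite valued function on an open subset `Ω` of `ℂⁿ`: upper
semicontinuity, and the sub-mean value inequality on every closed complex disc in `Ω`. -/
structure IsPshOn {n : ℕ} (Ω : Set (Fin n → ℂ)) (f : (Fin n → ℂ) → ℝ) : Prop where
  upperSemicontinuousOn : UpperSemicontinuousOn f Ω
  submean : ∀ a b : Fin n → ℂ, (∀ ζ : ℂ, ‖ζ‖ ≤ 1 → a + ζ • b ∈ Ω) →
    CircleIntegrable (fun ζ : ℂ => f (a + ζ • b)) 0 1 ∧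
      f a ≤ Real.circleAverage (fun ζ : ℂ => f (a + ζ • b)) 0 1

/-! ### Connection and curvature matrices of a matrix valued function on `Ω ⊆ ℂⁿ` -/

/-- For a smooth `H`, the coefficient `θ_j` of `θ = H⁻¹ ∂H = ∑ θ_j dz_j`. -/
def connCoeff {n r : ℕ} (H : (Fin n → ℂ) → Matrix (Fin r) (Fin r) ℂ) (j : Fin n)
    (z : Fin n → ℂ) : Matrix (Fin r) (Fin r) ℂ :=
  (H z)⁻¹ * Matrix.of fun a b => dz j (fun w => H w a b) z

/-- For a smooth `H`, the coefficient `Θ_{jk} = -∂θ_j/∂z̄_k` of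
`Θ = ∂̄(H⁻¹ ∂H) = ∑ Θ_{jk} dz_j ∧ dz̄_k`. -/
def curvCoeff {n r : ℕ} (H : (Fin n → ℂ) → Matrix (Fin r) (Fin r) ℂ) (j k : Fin n)
    (z : Fin n → ℂ) : Matrix (Fin r) (Fin r) ℂ :=
  Matrix.of fun a b => - dzbar k (fun w => connCoeff H j w a b) z

/-- `θ = ∑ θ_j dz_j` is a version of `H⁻¹ ∂H` on `Ω`, where `∂H` is taken in the sense of
distributions (and is a form with locally integrable coefficients `P_j`), and `H` is invertible
almost everywhere. -/
def IsConnForm {n r : ℕ} (Ω : Set (Fin n → ℂ)) (H : (Fin n → ℂ) → Matrix (Fin r) (Fin r) ℂ)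
    (θ : Fin n → (Fin n → ℂ) → Matrix (Fin r) (Fin r) ℂ) : Prop :=
  (∀ᵐ z ∂(volume.restrict Ω), IsUnit (H z)) ∧
  ∃ P : Fin n → (Fin n → ℂ) → Matrix (Fin r) (Fin r) ℂ,
    (∀ j a b, HasWeakDz Ω j (fun z => H z a b) (fun z => P j z a b)) ∧
    ∀ j, ∀ᵐ z ∂(volume.restrict Ω), θ j z = (H z)⁻¹ * P j z

/-- `Θ = ∑ Θ_{jk} dz_j ∧ dz̄_k` equals `∂̄θ` on `Ω` in the sense of currents, i.e.
`Θ_{jk} = -∂θ_j/∂z̄_k` entrywise in the sense of distributions. -/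
def IsDbarOf {n r : ℕ} (Ω : Set (Fin n → ℂ))
    (θ : Fin n → (Fin n → ℂ) → Matrix (Fin r) (Fin r) ℂ)
    (Θ : Fin n → Fin n → Fin r → Fin r → ((Fin n → ℂ) → ℂ) → ℂ) : Prop :=
  ∀ j k a b, ∀ φ : (Fin n → ℂ) → ℂ, IsTest Ω φ → Θ j k a b φ = ∫ z, θ j z a b * dzbar k φ z

/-- For a smooth `H`, the matrix valued function `Θ̃ = ∑ Θ_{jk} ξ_j ξ̄_k`, the value of the curvature
on the vector field `ξ = ∑ ξ_j ∂/∂z_j`. -/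
def curvAt {n r : ℕ} (H : (Fin n → ℂ) → Matrix (Fin r) (Fin r) ℂ)
    (ξ : (Fin n → ℂ) → (Fin n → ℂ)) (z : Fin n → ℂ) : Matrix (Fin r) (Fin r) ℂ :=
  ∑ j, ∑ k, (ξ z j * conj (ξ z k)) • curvCoeff H j k z

/-- The pairing of the `(a, b)` entry of `Θ̃ = ∑ Θ_{jk} ξ_j ξ̄_k` with `φ`, for a curvature with
measure coefficients. -/
def currentAt {n r : ℕ} (Θ : Fin n → Fin n → Fin r → Fin r → ((Fin n → ℂ) → ℂ) → ℂ)
    (ξ : (Fin n → ℂ) → (Fin n → ℂ)) (a b : Fin r) (φ : (Fin n → ℂ) → ℂ) : ℂ :=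
  ∑ j, ∑ k, Θ j k a b (fun z => φ z * (ξ z j * conj (ξ z k)))

/-! ### Singular hermitian metrics on a holomorphic vector bundle `E → X` -/

section Bundle

variable {n r : ℕ} {X : Type*} [TopologicalSpace X] [ChartedSpace (Fin n → ℂ) X]

/-- Plurisubharmonicity on an open subset `U` of a complex manifold, in all holomorphic charts. -/
def IsMPshOn (U : Set X) (f : X → ℝ) : Prop :=
  ∀ e ∈ IsManifold.maximalAtlas 𝓘(ℂ, Fin n → ℂ) ω X,
    IsPshOn (e.target ∩ e.symm ⁻¹' U) (fun z => f (e.symm z))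

variable {E : X → Type*} [∀ x, AddCommGroup (E x)] [∀ x, Module ℂ (E x)]

/-- The matrix `(form (s_a) (s_b))_{ab}` of a sesquilinear form on the fibres with respect to
sections `s_1, …, s_r`, as a function of the point. -/
def gram (form : ∀ x, E x →ₗ⋆[ℂ] E x →ₗ[ℂ] ℂ) (s : Fin r → ∀ x, E x) (x : X) :
    Matrix (Fin r) (Fin r) ℂ :=
  Matrix.of fun a b => form x (s a x) (s b x)

variable [∀ x, TopologicalSpace (E x)] [TopologicalSpace (TotalSpace (Fin r → ℂ) E)]
  [FiberBundle (Fin r → ℂ) E]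

/-- `u` is a holomorphic section of `E` over `U`. -/
def IsHolSection (r : ℕ) {E : X → Type*} [∀ x, TopologicalSpace (E x)]
    [TopologicalSpace (TotalSpace (Fin r → ℂ) E)] [FiberBundle (Fin r → ℂ) E]
    (U : Set X) (u : ∀ x, E x) : Prop :=
  ContMDiffOn 𝓘(ℂ, Fin n → ℂ) (𝓘(ℂ, Fin n → ℂ).prod 𝓘(ℂ, Fin r → ℂ)) ω
    (fun x => TotalSpace.mk' (Fin r → ℂ) x (u x)) U

/-- `s` is a holomorphic frame of `E` over `U`. -/
abbrev IsHolFrame (U : Set X) (s : Fin r → ∀ x, E x) : Prop :=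
  IsLocalFrameOn 𝓘(ℂ, Fin n → ℂ) (Fin r → ℂ) ω s U

variable (n r E) in
/-- A singular hermitian metric: a measurable map from the base to the nonnegative hermitian forms on
the fibres. The form is conjugate linear in its first and linear in its second argument.
Measurability (with respect to Lebesgue measurable sets) means measurability of the matrix entries
in holomorphic charts and frames. -/
structure SingularMetric where
  form : ∀ x, E x →ₗ⋆[ℂ] E x →ₗ[ℂ] ℂ
  hermitian : ∀ x (v w : E x), form x w v = conj (form x v w)
  nonneg : ∀ x (v : E x), 0 ≤ (form x v v).re
  measurable : ∀ e ∈ IsManifold.maximalAtlas 𝓘(ℂ, Fin n → ℂ) ω X,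
    ∀ s : Fin r → ∀ x, E x, IsHolFrame (n := n) e.source s → ∀ a b,
      AEMeasurable (fun z => gram form s (e.symm z) a b) (volume.restrict e.target)

namespace SingularMetric

/-- `‖v‖²_h` for `v` in the fibre over `x`. -/
def normSq (h : SingularMetric n r E) (x : X) (v : E x) : ℝ := (h.form x v v).re

/-- The matrix of `h` in the chart `e` and the frame `s`, as a function on `e.target ⊆ ℂⁿ`;
`‖∑ v_a s_a‖²_h = v^* H v`. -/
def mat (h : SingularMetric n r E) (e : OpenPartialHomeomorph X (Fin n → ℂ))
    (s : Fin r → ∀ x, E x) (z : Fin n → ℂ) : Matrix (Fin r) (Fin r) ℂ :=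
  gram h.form s (e.symm z)

/-- `h` is negatively curved in the sense of Griffiths: `‖u‖²_h` is plurisubharmonic for every
(locally defined) holomorphic section `u`. -/
def IsGriffithsNegative (h : SingularMetric n r E) : Prop :=
  ∀ U : Set X, IsOpen U → ∀ u : ∀ x, E x, IsHolSection (n := n) r U u →
    IsMPshOn (n := n) U (fun x => h.normSq x (u x))

/-- `h` is a smooth hermitian metric in the usual sense: it is positive definite, and its matrix in
holomorphic charts and frames is smooth. -/
def IsSmooth (h : SingularMetric n r E) : Prop :=
  (∀ x (v : E x), v ≠ 0 → 0 < h.normSq x v) ∧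
  ∀ e ∈ IsManifold.maximalAtlas 𝓘(ℂ, Fin n → ℂ) ω X,
    ∀ s : Fin r → ∀ x, E x, IsHolFrame (n := n) e.source s → ∀ a b,
      ContDiffOn ℝ ∞ (fun z => h.mat e s z a b) e.target

/-- `det h > ε` for some `ε > 0`, near every point and in some holomorphic frame there (whether such
an `ε` exists near a point does not depend on the frame). -/
def IsDetBoundedBelow (h : SingularMetric n r E) : Prop :=
  ∀ x : X, ∃ U : Set X, IsOpen U ∧ x ∈ U ∧ ∃ s : Fin r → ∀ x, E x, IsHolFrame (n := n) U s ∧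
    ∃ ε : ℝ, 0 < ε ∧ ∀ y ∈ U, ε < (gram h.form s y).det.re

/-- The metrics `hν m` decrease pointwise to `h`. -/
def DecreasesTo (hν : ℕ → SingularMetric n r E) (h : SingularMetric n r E) : Prop :=
  ∀ x (v : E x), Antitone (fun m => (hν m).normSq x v) ∧
    Tendsto (fun m => (hν m).normSq x v) atTop (𝓝 (h.normSq x v))

end SingularMetric

end Bundle

end SingHerm

end

noncomputable section

namespace SingHerm

/-! ### Directional Wirtinger derivatives -/

section Wirtinger

variable {n : ℕ}

/-! Everything takes place in a chart and frame, where the metric is a matrix function `H` on an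
open set of `ℂⁿ`. Griffiths negativity is tested only on sections `v + L(z) w` with `L` a linear
form. Constant sections already give upper semicontinuity of the quadratic forms, hence
measurability and local upper bounds `‖H_ab‖ ≤ M`. Together with the lower bound for the determinant
these give `H ≥ c > 0` on compact sets, by compactness of the set of admissible matrices and unit
vectors (`exists_coercive_of_det`).

The heart is pointwise linear algebra for a smooth negatively curved `H`. Choosing an affine section
with value `v` and derivative `w` in the direction `ξ`, subharmonicity of its squared norm says that
the block form with entries `L = ∂_ξ ∂̄_ξ H`, `D = ∂_ξ H` and `H` is non-negative
(`AffPsh.griffithsAt`). Two estimates follow: testing with `w = -t D e_b` gives `‖D_ab‖² ≤ (rM + 1)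
tr L` (`sq_norm_le_trace`). The curvature in the direction `ξ` is `-H⁻¹ (L - D* H⁻¹ D)`, and the
Schur complement satisfies `0 ≤ L - D* H⁻¹ D ≤ L`, so its entries are at most `(r / c) tr L`
(`norm_inv_mul_schur_le`); mixed directions follow by polarization. The mass of `tr L ≥ 0` on a
compact set is bounded by `M`: multiply by a cutoff function and move both derivatives onto it.
Hence all smooth negatively curved metrics with the same `c` and `M` share an `L²` bound for `∂H`
and an `L¹` bound for the curvature.

Now let such metrics `H_ν` tend to `H` almost everywhere with uniform bounds (`GoodSeq`). Then `∂H_ν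
→ ∂H` weakly in `L²`, while `H_ν⁻¹ → H⁻¹` boundedly almost everywhere; a product of weak and strong
convergence passes to the limit, so `H_ν⁻¹ ∂H_ν → θ`, and therefore also the curvatures converge, in
the sense of distributions (`GoodSeq.tendsto_connM`, `GoodSeq.tendsto_curvM`). The uniform `L¹`
bound makes the limit `∂̄θ` a distribution of order zero, that is, a measure
(`IsOrderZero.exists_radon`), and improves convergence on test functions to convergence on `C_c`
(`tendsto_radon`).

This is applied to two kinds of sequences. Convolutions of `H` with mollifiers stay negatively
curved, because the affine sections are stable under translation; they produce `θ` and the measures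
`Θ` (`LocMetric.exists_goodSeq`). A decreasing sequence `h_ν` satisfies `h ≤ h_ν ≤ h_0`, so it has
uniform bounds as well (`exists_goodSeq_mat`), and its curvatures converge to the same `Θ`. -/

/-- `½ (∂_ξ f + c ∂_{iξ} f)`; for `c = -i` this is the Wirtinger derivative of `f` in the direction
`ξ`, for `c = i` the conjugate one. -/
def wirt (c : ℂ) (ξ : Fin n → ℂ) (f : (Fin n → ℂ) → ℂ) (z : Fin n → ℂ) : ℂ :=
  (1 / 2) * (fderiv ℝ f z ξ + c * fderiv ℝ f z (Complex.I • ξ))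

/-- The Wirtinger derivative `∂f/∂ξ`. -/
abbrev del (ξ : Fin n → ℂ) (f : (Fin n → ℂ) → ℂ) (z : Fin n → ℂ) : ℂ := wirt (-Complex.I) ξ f z

/-- The Wirtinger derivative `∂f/∂ξ̄`. -/
abbrev delbar (ξ : Fin n → ℂ) (f : (Fin n → ℂ) → ℂ) (z : Fin n → ℂ) : ℂ := wirt Complex.I ξ f z

lemma I_smul_single (j : Fin n) :
    Complex.I • (Pi.single j 1 : Fin n → ℂ) = Pi.single j Complex.I := by
  ext k
  by_cases h : k = j
  · subst h; simp
  · simp [h]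

lemma dz_eq_del (j : Fin n) : dz j = del (Pi.single j 1) := by
  funext f z
  simp only [dz, del, wirt, I_smul_single]
  ring

lemma dzbar_eq_delbar (j : Fin n) : dzbar j = delbar (Pi.single j 1) := by
  funext f z
  simp only [dzbar, delbar, wirt, I_smul_single]

variable {c : ℂ} {ξ η : Fin n → ℂ} {f g : (Fin n → ℂ) → ℂ} {z : Fin n → ℂ}

lemma wirt_congr (h : f =ᶠ[𝓝 z] g) : wirt c ξ f z = wirt c ξ g z := by
  simp only [wirt, h.fderiv_eq]

lemma wirt_const (a : ℂ) : wirt c ξ (fun _ => a) z = 0 := by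
  simp [wirt]

lemma wirt_add (hf : DifferentiableAt ℝ f z) (hg : DifferentiableAt ℝ g z) :
    wirt c ξ (fun w => f w + g w) z = wirt c ξ f z + wirt c ξ g z := by
  simp only [wirt, fderiv_fun_add hf hg, add_apply]
  ring

lemma wirt_sum {ι : Type*} {s : Finset ι} {F : ι → (Fin n → ℂ) → ℂ}
    (hF : ∀ i ∈ s, DifferentiableAt ℝ (F i) z) :
    wirt c ξ (fun w => ∑ i ∈ s, F i w) z = ∑ i ∈ s, wirt c ξ (F i) z := by
  simp only [wirt, fderiv_fun_sum hF, _root_.sum_apply, Finset.mul_sum,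
    ← Finset.sum_add_distrib]

lemma wirt_mul (hf : DifferentiableAt ℝ f z) (hg : DifferentiableAt ℝ g z) :
    wirt c ξ (fun w => f w * g w) z = wirt c ξ f z * g z + f z * wirt c ξ g z := by
  simp only [wirt, fderiv_fun_mul hf hg, add_apply, smul_apply, smul_eq_mul]
  ring

lemma wirt_const_mul (a : ℂ) (hf : DifferentiableAt ℝ f z) :
    wirt c ξ (fun w => a * f w) z = a * wirt c ξ f z := by
  rw [wirt_mul (differentiableAt_const a) hf, wirt_const, zero_mul, zero_add]

lemma wirt_conj : wirt c ξ (fun w => conj (f w)) z = conj (wirt (conj c) ξ f z) := by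
  have : fderiv ℝ (fun w => conj (f w)) z = Complex.conjCLE.toContinuousLinearMap.comp
      (fderiv ℝ f z) := by
    exact Complex.conjCLE.comp_fderiv
  simp only [wirt, this, ContinuousLinearMap.comp_apply, map_mul, map_add, map_div₀, map_one,
    map_ofNat, Complex.conj_conj]
  rfl

lemma wirt_add_dir : wirt c (ξ + η) f z = wirt c ξ f z + wirt c η f z := by
  simp only [wirt, smul_add, map_add]
  ring

lemma smul_eq_re_im (a : ℂ) (ξ : Fin n → ℂ) :
    a • ξ = a.re • ξ + a.im • (Complex.I • ξ) := by
  ext k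
  simp only [Pi.smul_apply, Pi.add_apply, smul_eq_mul, Complex.real_smul]
  conv_lhs => rw [← Complex.re_add_im a]
  ring

/-- The condition `c ^ 2 = -1` covers `c = ∓i` at once; the factor is then `a`, respectively its
conjugate. -/
lemma wirt_smul_dir (hc : c ^ 2 = -1) (a : ℂ) :
    wirt c (a • ξ) f z = (a.re - c * a.im) * wirt c ξ f z := by
  have h1 := smul_eq_re_im a ξ
  have h2 : Complex.I • a • ξ = a.re • (Complex.I • ξ) - a.im • ξ := by
    rw [smul_eq_re_im a ξ]
    ext k
    simp only [Pi.smul_apply, Pi.add_apply, Pi.sub_apply, smul_eq_mul, Complex.real_smul]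
    linear_combination (a.im * ξ k) * Complex.I_sq
  simp only [wirt]
  rw [h2, h1]
  simp only [map_add, map_sub, map_smul, Complex.real_smul]
  linear_combination (1 / 2 * a.im * (fderiv ℝ f z (Complex.I • ξ))) * hc

lemma del_smul_dir (a : ℂ) : del (a • ξ) f z = a * del ξ f z := by
  rw [del, wirt_smul_dir (by simp)]
  congr 1
  conv_rhs => rw [← Complex.re_add_im a]
  ring

lemma delbar_smul_dir (a : ℂ) : delbar (a • ξ) f z = conj a * delbar ξ f z := by
  rw [delbar, wirt_smul_dir (by simp)]
  congr 1
  conv_rhs => rw [← Complex.re_add_im a]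
  simp only [map_add, map_mul, Complex.conj_ofReal, Complex.conj_I]
  ring

lemma wirt_holomorphic (L : (Fin n → ℂ) →L[ℂ] ℂ) (a : ℂ) :
    wirt c ξ (fun w => a + L w) z = (1 / 2) * (1 + c * Complex.I) * L ξ := by
  have : HasFDerivAt (fun w => a + L w) (L.restrictScalars ℝ) z :=
    ((L.restrictScalars ℝ).hasFDerivAt).const_add a
  simp only [wirt, this.fderiv, ContinuousLinearMap.coe_restrictScalars', map_smul, smul_eq_mul]
  ring

lemma del_holomorphic (L : (Fin n → ℂ) →L[ℂ] ℂ) (a : ℂ) :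
    del ξ (fun w => a + L w) z = L ξ := by
  rw [del, wirt_holomorphic]
  linear_combination -(1/2) * L ξ * Complex.I_sq

lemma delbar_holomorphic (L : (Fin n → ℂ) →L[ℂ] ℂ) (a : ℂ) :
    delbar ξ (fun w => a + L w) z = 0 := by
  rw [delbar, wirt_holomorphic]
  linear_combination (1/2) * L ξ * Complex.I_sq

variable {U : Set (Fin n → ℂ)}

lemma ContDiffOn.wirt (hU : IsOpen U) (hf : ContDiffOn ℝ ∞ f U) :
    ContDiffOn ℝ ∞ (wirt c ξ f) U := by
  have h : ContDiffOn ℝ ∞ (fderiv ℝ f) U := hf.fderiv_of_isOpen hU (by simp)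
  exact contDiffOn_const.mul ((h.clm_apply contDiffOn_const).add
    (contDiffOn_const.mul (h.clm_apply contDiffOn_const)))

lemma ContDiff.wirt (hf : ContDiff ℝ ∞ f) : ContDiff ℝ ∞ (wirt c ξ f) := by
  rw [← contDiffOn_univ] at hf ⊢
  exact ContDiffOn.wirt isOpen_univ hf

lemma tsupport_wirt_subset : tsupport (wirt c ξ f) ⊆ tsupport f := by
  refine closure_minimal (fun z hz => ?_) (isClosed_tsupport f)
  by_contra h
  refine hz ?_
  exact (wirt_congr (notMem_tsupport_iff_eventuallyEq.1 h)).trans (wirt_const 0)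

lemma HasCompactSupport.wirt (hf : HasCompactSupport f) : HasCompactSupport (wirt c ξ f) :=
  hf.of_isClosed_subset (isClosed_tsupport _) tsupport_wirt_subset

lemma IsTest.wirt (hf : IsTest U f) : IsTest U (wirt c ξ f) :=
  ⟨ContDiff.wirt hf.contDiff, HasCompactSupport.wirt hf.hasCompactSupport,
    tsupport_wirt_subset.trans hf.tsupport_subset⟩

lemma fderiv_wirt (hf : ContDiffAt ℝ 2 f z) (d : ℂ) (v : Fin n → ℂ) :
    fderiv ℝ (wirt d η f) z v = (1 / 2) * (fderiv ℝ (fderiv ℝ f) z v η +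
      d * fderiv ℝ (fderiv ℝ f) z v (Complex.I • η)) := by
  have h : DifferentiableAt ℝ (fderiv ℝ f) z :=
    (hf.fderiv_right (m := 1) (by norm_num)).differentiableAt (by norm_num)
  have h1 (u : Fin n → ℂ) : HasFDerivAt (fun w => fderiv ℝ f w u)
      ((fderiv ℝ (fderiv ℝ f) z).flip u) z := by
    have := h.hasFDerivAt.clm_apply (hasFDerivAt_const u z)
    simpa using this
  have h2 := ((h1 η).fun_add ((h1 (Complex.I • η)).const_mul d)).const_mul (1 / 2)
  change fderiv ℝ (fun w => (1 / 2) * (fderiv ℝ f w η + d * fderiv ℝ f w (Complex.I • η))) z v = _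
  rw [h2.fderiv]
  simp only [smul_apply, add_apply, ContinuousLinearMap.flip_apply, smul_eq_mul]

lemma wirt_comm (hf : ContDiffAt ℝ 2 f z) (d : ℂ) :
    wirt c ξ (wirt d η f) z = wirt d η (wirt c ξ f) z := by
  have hs := hf.isSymmSndFDerivAt (by simp)
  rw [wirt, wirt, fderiv_wirt hf, fderiv_wirt hf, fderiv_wirt hf, fderiv_wirt hf]
  rw [hs.eq η, hs.eq η, hs.eq (Complex.I • η), hs.eq (Complex.I • η)]
  ring

/-- The mixed second derivatives cancel by symmetry, which leaves a quarter of the Laplacian along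
the complex line spanned by `ξ`. -/
lemma del_delbar_eq (hf : ContDiffAt ℝ 2 f z) :
    del ξ (delbar ξ f) z = (1 / 4) * (fderiv ℝ (fderiv ℝ f) z ξ ξ +
      fderiv ℝ (fderiv ℝ f) z (Complex.I • ξ) (Complex.I • ξ)) := by
  have hs := hf.isSymmSndFDerivAt (by simp)
  rw [del, wirt, fderiv_wirt hf, fderiv_wirt hf, hs.eq (Complex.I • ξ) ξ]
  linear_combination (-(1 / 4) * fderiv ℝ (fderiv ℝ f) z (Complex.I • ξ) (Complex.I • ξ)) *
    Complex.I_sq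

/-! ### Integration by parts -/

lemma continuous_mul_of_tsupport (hU : IsOpen U) (hf : ContinuousOn f U) (hg : Continuous g)
    (hgU : tsupport g ⊆ U) : Continuous (fun z => f z * g z) := by
  rw [continuous_iff_continuousAt]
  intro z
  by_cases hz : z ∈ tsupport g
  · exact (hf.continuousAt (hU.mem_nhds (hgU hz))).mul hg.continuousAt
  · have : (fun z => f z * g z) =ᶠ[𝓝 z] fun _ => 0 := by
      filter_upwards [notMem_tsupport_iff_eventuallyEq.1 hz] with w hw
      simp [hw]
    exact continuousAt_const.congr this.symm

lemma integrable_mul_of_tsupport (hU : IsOpen U) (hf : ContinuousOn f U) (hg : Continuous g)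
    (hc : HasCompactSupport g) (hgU : tsupport g ⊆ U) :
    Integrable (fun z => f z * g z) :=
  (continuous_mul_of_tsupport hU hf hg hgU).integrable_of_hasCompactSupport hc.mul_left

/-- Integration by parts in the two real directions `ξ` and `iξ`. Smoothness of `f` on `U` suffices,
since all integrands vanish off the support of `g`. -/
lemma integral_mul_wirt (hU : IsOpen U) (hf : ContDiffOn ℝ ∞ f U) (hg : IsTest U g) :
    ∫ z, f z * wirt c ξ g z = - ∫ z, wirt c ξ f z * g z := by
  have hfd (v : Fin n → ℂ) : ContinuousOn (fun z => fderiv ℝ f z v) U :=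
    (((hf.fderiv_of_isOpen (m := ∞) hU (by simp)).clm_apply contDiffOn_const)).continuousOn
  have hgd (v : Fin n → ℂ) : Continuous (fun z => fderiv ℝ g z v) :=
    (hg.contDiff.continuous_fderiv (by simp)).clm_apply continuous_const
  have hgs (v : Fin n → ℂ) : tsupport (fun z => fderiv ℝ g z v) ⊆ tsupport g :=
    tsupport_fderiv_apply_subset ℝ v
  have i1 (v : Fin n → ℂ) : Integrable (fun z => fderiv ℝ f z v * g z) :=
    integrable_mul_of_tsupport hU (hfd v) hg.contDiff.continuous hg.hasCompactSupport
      hg.tsupport_subset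
  have i2 (v : Fin n → ℂ) : Integrable (fun z => f z * fderiv ℝ g z v) :=
    integrable_mul_of_tsupport hU hf.continuousOn (hgd v)
      (hg.hasCompactSupport.of_isClosed_subset (isClosed_tsupport _) (hgs v))
      ((hgs v).trans hg.tsupport_subset)
  have i3 : Integrable (fun z => f z * g z) :=
    integrable_mul_of_tsupport hU hf.continuousOn hg.contDiff.continuous hg.hasCompactSupport
      hg.tsupport_subset
  have key (v : Fin n → ℂ) := integral_mul_fderiv_eq_neg_fderiv_mul_of_integrable
    (μ := (volume : Measure (Fin n → ℂ))) (i1 v) (i2 v) i3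
    (fun x hx => (hf.contDiffAt (hU.mem_nhds (hg.tsupport_subset hx))).differentiableAt (by simp))
    (fun x _ => hg.contDiff.differentiable (by simp) x)
  have e1 : ∀ z, f z * wirt c ξ g z =
      (1 / 2) * (f z * fderiv ℝ g z ξ + c * (f z * fderiv ℝ g z (Complex.I • ξ))) := by
    intro z; simp only [wirt]; ring
  have e2 : ∀ z, wirt c ξ f z * g z =
      (1 / 2) * (fderiv ℝ f z ξ * g z + c * (fderiv ℝ f z (Complex.I • ξ) * g z)) := by
    intro z; simp only [wirt]; ring
  simp_rw [e1, e2]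
  rw [integral_const_mul, integral_const_mul, integral_add (i2 _) ((i2 _).const_mul _),
    integral_add (i1 _) ((i1 _).const_mul _), integral_const_mul, integral_const_mul, key, key]
  ring

end Wirtinger

/-! ### The Laplacian of functions with the sub-mean value property -/

section Laplacian

open Real (circleAverage)

variable {n : ℕ}

/-- Second order Taylor expansion at a point. -/
lemma taylor_second_order {E F : Type*} [NormedAddCommGroup E] [NormedSpace ℝ E]
    [NormedAddCommGroup F] [NormedSpace ℝ F] {f : E → F} {z : E} (hf : ContDiffAt ℝ 2 f z)
    (hs : IsSymmSndFDerivAt ℝ f z) {ε : ℝ} (hε : 0 < ε) :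
    ∀ᶠ v in 𝓝 (0 : E), ‖f (z + v) - f z - fderiv ℝ f z v -
      (1 / 2 : ℝ) • fderiv ℝ (fderiv ℝ f) z v v‖ ≤ ε * ‖v‖ ^ 2 := by
  set B := fderiv ℝ (fderiv ℝ f) z with hB
  have hd : HasFDerivAt (fderiv ℝ f) B z :=
    ((hf.fderiv_right (m := 1) (by norm_num)).differentiableAt (by norm_num)).hasFDerivAt
  have h1 : ∀ᶠ v in 𝓝 (0 : E), ‖fderiv ℝ f (z + v) - fderiv ℝ f z - B v‖ ≤ ε * ‖v‖ := by
    have := (hasFDerivAt_iff_isLittleO_nhds_zero.1 hd).bound hε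
    simpa using this
  have h2 : ∀ᶠ v in 𝓝 (0 : E), DifferentiableAt ℝ f (z + v) := by
    have h : ∀ᶠ w in 𝓝 z, DifferentiableAt ℝ f w := by
      filter_upwards [hf.eventually (by simp)] with w hw
      exact hw.differentiableAt (by norm_num)
    have ht : Tendsto (fun v : E => z + v) (𝓝 0) (𝓝 z) := by
      have : Continuous (fun v : E => z + v) := by fun_prop
      simpa using this.tendsto 0
    exact ht.eventually h
  obtain ⟨δ, hδ, hball⟩ := Metric.eventually_nhds_iff_ball.1 (h1.and h2)
  filter_upwards [Metric.ball_mem_nhds (0 : E) hδ] with v hv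
  have hvδ : ‖v‖ < δ := by simpa using hv
  set R : E → F := fun w => f (z + w) - f z - fderiv ℝ f z w - (1 / 2 : ℝ) • B w w with hR
  have hRd : ∀ w ∈ Metric.closedBall (0 : E) ‖v‖,
      HasFDerivWithinAt R (fderiv ℝ f (z + w) - fderiv ℝ f z - B w)
        (Metric.closedBall (0 : E) ‖v‖) w := by
    intro w hw
    have hw' : w ∈ Metric.ball (0 : E) δ := Metric.closedBall_subset_ball hvδ hw
    have hfd : HasFDerivAt (fun w => f (z + w)) (fderiv ℝ f (z + w)) w := by
      have := (hball w hw').2.hasFDerivAt.comp w ((hasFDerivAt_id w).const_add z)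
      rwa [ContinuousLinearMap.comp_id] at this
    have hBd : HasFDerivAt (fun w => B w w) (B w + B.flip w) w := by
      have := (B.hasFDerivAt (x := w)).clm_apply (hasFDerivAt_id w)
      exact this
    have hq : (1 / 2 : ℝ) • (B w + B.flip w) = B w := by
      have : B.flip w = B w := by
        ext u
        simpa [hB] using hs.eq u w
      rw [this, ← two_smul ℝ (B w), smul_smul]
      norm_num
    have := ((hfd.sub_const (f z)).sub (fderiv ℝ f z).hasFDerivAt).sub
      (hBd.const_smul (1 / 2 : ℝ))
    rw [hq] at this
    exact this.hasFDerivWithinAt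
  have hbound : ∀ w ∈ Metric.closedBall (0 : E) ‖v‖,
      ‖fderiv ℝ f (z + w) - fderiv ℝ f z - B w‖ ≤ ε * ‖v‖ := by
    intro w hw
    have hw' : w ∈ Metric.ball (0 : E) δ := Metric.closedBall_subset_ball hvδ hw
    refine (hball w hw').1.trans ?_
    have : ‖w‖ ≤ ‖v‖ := by simpa using hw
    gcongr
  have := (convex_closedBall (0 : E) ‖v‖).norm_image_sub_le_of_norm_hasFDerivWithin_le hRd hbound
    (Metric.mem_closedBall_self (norm_nonneg v)) (by simp : v ∈ _)
  have hR0 : R 0 = 0 := by simp [hR]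
  rw [hR0, sub_zero, sub_zero] at this
  calc ‖R v‖ ≤ ε * ‖v‖ * ‖v‖ := this
    _ = ε * ‖v‖ ^ 2 := by ring

/-- Mean value property of holomorphic functions; a real linear map commutes with averaging. It
removes the first order term and the part of the second order term that depends on `ζ²`. -/
lemma circleAverage_linear_comp (l : ℂ →L[ℝ] ℝ) {p : ℂ → ℂ} (hp : Differentiable ℂ p) (ρ : ℝ) :
    circleAverage (fun ζ => l (p ζ)) 0 ρ = l (p 0) := by
  have h1 := l.circleAverage_comp_comm (f := p) (c := 0) (R := ρ)
    hp.continuous.continuousOn.circleIntegrable'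
  have h2 : circleAverage p 0 ρ = p 0 := by
    exact DiffContOnCl.circleAverage hp.diffContOnCl
  rw [h2] at h1
  exact h1

/-- If the real part of `f` satisfies the sub-mean value inequality on small discs in the direction
`ξ` around `z`, then its Laplacian in this direction is nonnegative. -/
lemma del_delbar_re_nonneg {f : (Fin n → ℂ) → ℂ} {z ξ : Fin n → ℂ} (hf : ContDiffAt ℝ 2 f z)
    (hsub : ∀ᶠ ρ in 𝓝[>] (0 : ℝ),
      (f z).re ≤ circleAverage (fun ζ : ℂ => (f (z + ζ • ξ)).re) 0 ρ) :
    0 ≤ (del ξ (delbar ξ f) z).re := by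
  by_contra! hneg
  rw [del_delbar_eq hf] at hneg
  set B := fderiv ℝ (fderiv ℝ f) z with hB
  set b := (B ξ ξ).re + (B (Complex.I • ξ) (Complex.I • ξ)).re with hb
  have hbneg : b < 0 := by
    have : ((1 / 4 : ℂ) * (B ξ ξ + B (Complex.I • ξ) (Complex.I • ξ))).re = (1 / 4) * b := by
      have : (1 / 4 : ℂ) = ((1 / 4 : ℝ) : ℂ) := by norm_num
      rw [this, Complex.re_ofReal_mul, Complex.add_re]
    rw [this] at hneg
    linarith
  have hs : IsSymmSndFDerivAt ℝ f z := hf.isSymmSndFDerivAt (by simp)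
  set N := ‖ξ‖ ^ 2 + 1 with hN
  have hNpos : 0 < N := by positivity
  -- The quadratic term contributes `b ρ² / 4 < 0` to the circle average. With this `ε` the Taylor
  -- error is at most `-b ρ² / 8`, so `b ρ² / 8 < 0` remains and contradicts the sub-mean value
  -- inequality.
  have hε : 0 < -b / (8 * N) := by
    apply div_pos <;> linarith
  have hcont : ∀ᶠ w in 𝓝 z, ContinuousAt f w := by
    filter_upwards [hf.eventually (by simp)] with w hw using hw.continuousAt
  have hline : Tendsto (fun ζ : ℂ => ζ • ξ) (𝓝 0) (𝓝 0) := by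
    have : Continuous (fun ζ : ℂ => ζ • ξ) := by fun_prop
    simpa using this.tendsto 0
  have hline' : Tendsto (fun ζ : ℂ => z + ζ • ξ) (𝓝 0) (𝓝 z) := by
    have : Continuous (fun ζ : ℂ => z + ζ • ξ) := by fun_prop
    simpa using this.tendsto 0
  have hev := (hline.eventually (taylor_second_order hf hs hε)).and (hline'.eventually hcont)
  obtain ⟨δ, hδ, hball⟩ := Metric.eventually_nhds_iff_ball.1 hev
  obtain ⟨ρ, hρ, hρδ⟩ := (hsub.and (Ioo_mem_nhdsGT hδ)).exists
  have hmem : ∀ ζ ∈ Metric.sphere (0 : ℂ) |ρ|, ζ ∈ Metric.ball (0 : ℂ) δ := by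
    intro ζ hζ
    rw [mem_sphere_zero_iff_norm, abs_of_pos hρδ.1] at hζ
    rw [mem_ball_zero_iff, hζ]
    exact hρδ.2
  -- the quadratic form on the complex line
  let m : ℂ →L[ℝ] (Fin n → ℂ) := ((1 : ℂ →L[ℂ] ℂ).smulRight ξ).restrictScalars ℝ
  have hm (ζ : ℂ) : m ζ = ζ • ξ := rfl
  let l₁ : ℂ →L[ℝ] ℝ := Complex.reCLM.comp ((fderiv ℝ f z).comp m)
  let l₂ : ℂ →L[ℝ] ℝ := ((1 / 4) * ((B ξ ξ).re - (B (Complex.I • ξ) (Complex.I • ξ)).re)) •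
    Complex.reCLM + ((1 / 2) * (B ξ (Complex.I • ξ)).re) • Complex.imCLM
  -- A real quadratic form on a complex line is a real linear function of `ζ²`, which averages to
  -- zero over circles, plus a multiple of `|ζ|²` given by its trace.
  have hquad (ζ : ℂ) : (1 / 2) * (B (ζ • ξ) (ζ • ξ)).re = l₂ (ζ ^ 2) + (1 / 4) * b * ‖ζ‖ ^ 2 := by
    have hsym : B (Complex.I • ξ) ξ = B ξ (Complex.I • ξ) := hs.eq _ _
    rw [smul_eq_re_im ζ ξ]
    simp only [map_add, map_smul, add_apply, smul_apply, Complex.add_re, Complex.real_smul, hsym,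
      l₂, hb,
      Complex.reCLM_apply, Complex.imCLM_apply, pow_two, Complex.mul_re, Complex.mul_im,
      Complex.ofReal_re, Complex.ofReal_im,
      smul_eq_mul, mul_add]
    have hn2 : ‖ζ‖ * ‖ζ‖ = ζ.re * ζ.re + ζ.im * ζ.im := by
      rw [← Complex.normSq_apply, Complex.normSq_eq_norm_sq, sq]
    linear_combination (-(1 / 4) * ((B ξ ξ).re + (B (Complex.I • ξ) (Complex.I • ξ)).re)) * hn2
  have hupper : ∀ ζ ∈ Metric.sphere (0 : ℂ) |ρ|, (f (z + ζ • ξ)).re ≤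
      ((f z).re + (1 / 8) * b * ρ ^ 2) + l₁ ζ + l₂ (ζ ^ 2) := by
    intro ζ hζ
    have ht := (hball ζ (hmem ζ hζ)).1
    have hn : ‖ζ‖ = ρ := by
      rw [mem_sphere_zero_iff_norm, abs_of_pos hρδ.1] at hζ
      exact hζ
    have hre := (Complex.re_le_norm _).trans ht
    simp only [Complex.sub_re, Complex.real_smul, Complex.re_ofReal_mul] at hre
    rw [hquad ζ, norm_smul, hn] at hre
    have hl : ((fderiv ℝ f z) (ζ • ξ)).re = l₁ ζ := rfl
    rw [hl] at hre
    have hlast : -b / (8 * N) * (ρ * ‖ξ‖) ^ 2 ≤ -b / 8 * ρ ^ 2 := by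
      have h1 : -b / (8 * N) * (ρ * ‖ξ‖) ^ 2 = (-b / 8 * ρ ^ 2) * (‖ξ‖ ^ 2 / N) := by
        field_simp
      rw [h1]
      refine mul_le_of_le_one_right ?_ ?_
      · have := hbneg.le
        have : 0 ≤ -b := by linarith
        positivity
      · rw [div_le_one hNpos]
        linarith
    nlinarith
  have hi₁ : CircleIntegrable (fun ζ : ℂ => (f (z + ζ • ξ)).re) 0 ρ := by
    refine ContinuousOn.circleIntegrable' ?_
    intro ζ hζ
    have := (hball ζ (hmem ζ hζ)).2
    exact (Complex.continuous_re.continuousAt.comp (this.comp (f := fun ζ : ℂ => z + ζ • ξ)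
      (by fun_prop))).continuousWithinAt
  have hc₁ : Continuous (fun ζ : ℂ => l₁ ζ) := l₁.continuous
  have hc₂ : Continuous (fun ζ : ℂ => l₂ (ζ ^ 2)) := l₂.continuous.comp (by fun_prop)
  have hc₀ : Continuous (fun ζ : ℂ => ((f z).re + (1 / 8) * b * ρ ^ 2) + l₁ ζ) :=
    continuous_const.add hc₁
  have hle := Real.circleAverage_mono
    (f₂ := fun ζ : ℂ => ((f z).re + (1 / 8) * b * ρ ^ 2) + l₁ ζ + l₂ (ζ ^ 2)) hi₁
    ((hc₀.add hc₂).continuousOn.circleIntegrable') hupper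
  have e : circleAverage (fun ζ : ℂ => ((f z).re + (1 / 8) * b * ρ ^ 2) + l₁ ζ + l₂ (ζ ^ 2)) 0 ρ =
      (f z).re + (1 / 8) * b * ρ ^ 2 := by
    rw [Real.circleAverage_fun_add hc₀.continuousOn.circleIntegrable'
      hc₂.continuousOn.circleIntegrable', Real.circleAverage_fun_add
      continuousOn_const.circleIntegrable' hc₁.continuousOn.circleIntegrable',
      Real.circleAverage_const, circleAverage_linear_comp l₁ (p := fun ζ => ζ) differentiable_id,
      circleAverage_linear_comp l₂ (p := fun ζ => ζ ^ 2) (by fun_prop)]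
    simp
  rw [e] at hle
  have : (1 / 8) * b * ρ ^ 2 < 0 := by
    have := hρδ.1
    have : 0 < ρ ^ 2 := by positivity
    nlinarith
  linarith

end Laplacian

/-! ### Hermitian matrices -/

section LinearAlgebra

open Matrix

variable {r : ℕ} {A : Matrix (Fin r) (Fin r) ℂ}

/-- The sesquilinear form `v^* A w`. -/
def sesq (A : Matrix (Fin r) (Fin r) ℂ) (v w : Fin r → ℂ) : ℂ :=
  ∑ a, ∑ b, conj (v a) * A a b * w b

/-- `v^* A w = ⟨v, A w⟩`. -/
lemma sesq_eq_sum_mulVec (A : Matrix (Fin r) (Fin r) ℂ) (v w : Fin r → ℂ) :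
    sesq A v w = ∑ a, conj (v a) * (A *ᵥ w) a := by
  simp only [sesq, mulVec, dotProduct, Finset.mul_sum, mul_assoc]

lemma sesq_add_left (v v' w : Fin r → ℂ) : sesq A (v + v') w = sesq A v w + sesq A v' w := by
  simp only [sesq, Pi.add_apply, map_add, add_mul, Finset.sum_add_distrib]

lemma sesq_add_right (v w w' : Fin r → ℂ) : sesq A v (w + w') = sesq A v w + sesq A v w' := by
  simp only [sesq, Pi.add_apply, mul_add, Finset.sum_add_distrib]

lemma sesq_smul_left (t : ℂ) (v w : Fin r → ℂ) : sesq A (t • v) w = conj t * sesq A v w := by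
  simp only [sesq, Pi.smul_apply, smul_eq_mul, map_mul, Finset.mul_sum, mul_assoc]

lemma sesq_smul_right (t : ℂ) (v w : Fin r → ℂ) : sesq A v (t • w) = t * sesq A v w := by
  simp only [sesq, Pi.smul_apply, smul_eq_mul, Finset.mul_sum]
  refine Finset.sum_congr rfl fun a _ => Finset.sum_congr rfl fun b _ => ?_
  ring

lemma sesq_single (a b : Fin r) : sesq A (Pi.single a 1) (Pi.single b 1) = A a b := by
  rw [sesq_eq_sum_mulVec, Finset.sum_eq_single a]
  · simp
  · intro c _ hc
    simp [hc]
  · simp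

lemma sesq_sub_mat (A B : Matrix (Fin r) (Fin r) ℂ) (v w : Fin r → ℂ) :
    sesq (A - B) v w = sesq A v w - sesq B v w := by
  simp only [sesq, Matrix.sub_apply, mul_sub, sub_mul, Finset.sum_sub_distrib]

lemma sesq_mul_mat (A B : Matrix (Fin r) (Fin r) ℂ) (v w : Fin r → ℂ) :
    sesq (A * B) v w = sesq A v (B *ᵥ w) := by
  simp only [sesq_eq_sum_mulVec, mulVec_mulVec]

lemma sesq_conjTranspose (A : Matrix (Fin r) (Fin r) ℂ) (v w : Fin r → ℂ) :
    sesq Aᴴ v w = conj (sesq A w v) := by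
  simp only [sesq, map_sum, map_mul, Complex.conj_conj, conjTranspose_apply]
  rw [Finset.sum_comm]
  refine Finset.sum_congr rfl fun a _ => Finset.sum_congr rfl fun b _ => ?_
  simp only [RCLike.star_def]
  ring

lemma sesq_conjTranspose_mul (A B : Matrix (Fin r) (Fin r) ℂ) (v w : Fin r → ℂ) :
    sesq (Aᴴ * B) v w = sesq B (A *ᵥ v) w := by
  rw [← conjTranspose_conjTranspose (Aᴴ * B), sesq_conjTranspose, conjTranspose_mul,
    conjTranspose_conjTranspose, sesq_mul_mat, ← sesq_conjTranspose, conjTranspose_conjTranspose]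

/-- `∑ |v_a|²`. -/
def normSqVec (v : Fin r → ℂ) : ℝ := ∑ a, ‖v a‖ ^ 2

lemma normSqVec_nonneg (v : Fin r → ℂ) : 0 ≤ normSqVec v :=
  Finset.sum_nonneg fun _ _ => by positivity

lemma sq_norm_le_normSqVec (v : Fin r → ℂ) (a : Fin r) : ‖v a‖ ^ 2 ≤ normSqVec v :=
  Finset.single_le_sum (f := fun a => ‖v a‖ ^ 2) (fun _ _ => by positivity) (Finset.mem_univ a)

lemma norm_sesq_le {M : ℝ} (hM : ∀ a b, ‖A a b‖ ≤ M) (v : Fin r → ℂ) :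
    ‖sesq A v v‖ ≤ r * M * normSqVec v := by
  have h1 : ‖sesq A v v‖ ≤ ∑ a, ∑ b, ‖v a‖ * M * ‖v b‖ := by
    refine (norm_sum_le _ _).trans (Finset.sum_le_sum fun a _ => (norm_sum_le _ _).trans
      (Finset.sum_le_sum fun b _ => ?_))
    rw [norm_mul, norm_mul, RCLike.norm_conj]
    have := hM a b
    gcongr
  rcases Nat.eq_zero_or_pos r with hr | hr
  · subst hr
    simpa [normSqVec] using h1
  have hM0 : 0 ≤ M := (norm_nonneg _).trans (hM ⟨0, hr⟩ ⟨0, hr⟩)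
  have h2 : ∑ a, ∑ b, ‖v a‖ * M * ‖v b‖ = M * (∑ a, ‖v a‖) ^ 2 := by
    rw [sq, Finset.sum_mul_sum, Finset.mul_sum]
    refine Finset.sum_congr rfl fun a _ => ?_
    rw [Finset.mul_sum]
    exact Finset.sum_congr rfl fun b _ => by ring
  have h3 : (∑ a, ‖v a‖) ^ 2 ≤ r * normSqVec v := by
    have := sq_sum_le_card_mul_sum_sq (s := Finset.univ) (f := fun a => ‖v a‖)
    simpa [normSqVec] using this
  calc ‖sesq A v v‖ ≤ M * (∑ a, ‖v a‖) ^ 2 := h1.trans h2.le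
    _ ≤ M * (r * normSqVec v) := by gcongr
    _ = r * M * normSqVec v := by ring

/-- The entries of a nonnegative hermitian matrix are controlled by its diagonal. -/
lemma norm_apply_le_diag (hA : A.IsHermitian) (hpos : ∀ v, 0 ≤ (sesq A v v).re) (a b : Fin r) :
    ‖A a b‖ ≤ ((A a a).re + (A b b).re) / 2 := by
  have hab : A b a = conj (A a b) := (hA.apply b a).symm
  have hda : 0 ≤ (A a a).re := by simpa [sesq_single] using hpos (Pi.single a 1)
  have hdb : 0 ≤ (A b b).re := by simpa [sesq_single] using hpos (Pi.single b 1)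
  by_cases h0 : A a b = 0
  · rw [h0, norm_zero]
    linarith
  have hn : (0 : ℝ) < ‖A a b‖ := norm_pos_iff.2 h0
  -- The unimodular `s` with `s A_ab = -|A_ab|`: on the vector `e_a + s e_b` the form equals `A_aa +
  -- A_bb - 2 |A_ab|`.
  set s : ℂ := -(conj (A a b) / ‖A a b‖) with hs
  have h1 : A a b * conj (A a b) = (‖A a b‖ : ℂ) ^ 2 := by
    rw [Complex.mul_conj, Complex.normSq_eq_norm_sq]; push_cast; ring
  have hnc : (‖A a b‖ : ℂ) ≠ 0 := by exact_mod_cast hn.ne'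
  have hsA : s * A a b = -(‖A a b‖ : ℂ) := by
    rw [hs]
    field_simp
    linear_combination -h1
  have hss : conj s * s = 1 := by
    rw [hs]
    simp only [map_neg, map_div₀, Complex.conj_conj, Complex.conj_ofReal]
    field_simp
    linear_combination h1
  have hsA' : conj s * A b a = -(‖A a b‖ : ℂ) := by
    rw [hab, ← map_mul, hsA]
    simp
  have := hpos (Pi.single a 1 + s • Pi.single b 1)
  rw [sesq_add_left, sesq_add_right, sesq_add_right, sesq_smul_left, sesq_smul_left,
    sesq_smul_right, sesq_smul_right, sesq_single, sesq_single, sesq_single, sesq_single,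
    hsA, hsA', ← mul_assoc, hss, one_mul] at this
  simp only [Complex.add_re, Complex.neg_re, Complex.ofReal_re] at this
  linarith

lemma norm_apply_le_trace (hA : A.IsHermitian) (hpos : ∀ v, 0 ≤ (sesq A v v).re) (a b : Fin r) :
    ‖A a b‖ ≤ A.trace.re := by
  have hd (a : Fin r) : 0 ≤ (A a a).re := by simpa [sesq_single] using hpos (Pi.single a 1)
  have ht : A.trace.re = ∑ a, (A a a).re := by simp [Matrix.trace]
  have h (a : Fin r) : (A a a).re ≤ A.trace.re := by
    rw [ht]
    exact Finset.single_le_sum (f := fun a => (A a a).re) (fun a _ => hd a) (Finset.mem_univ a)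
  linarith [norm_apply_le_diag hA hpos a b, h a, h b]

/-- `A ≥ c`. -/
def Coercive (c : ℝ) (A : Matrix (Fin r) (Fin r) ℂ) : Prop :=
  ∀ v, c * normSqVec v ≤ (sesq A v v).re

lemma normSqVec_eq_zero {v : Fin r → ℂ} (h : normSqVec v ≤ 0) : v = 0 := by
  ext a
  have := (sq_norm_le_normSqVec v a).trans h
  have h2 : ‖v a‖ = 0 := by nlinarith [norm_nonneg (v a)]
  simpa using h2

lemma Coercive.isUnit {c : ℝ} (hc : 0 < c) (hA : Coercive c A) : IsUnit A := by
  rw [Matrix.isUnit_iff_isUnit_det, isUnit_iff_ne_zero]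
  intro hdet
  obtain ⟨v, hv0, hv⟩ := Matrix.exists_mulVec_eq_zero_iff.2 hdet
  have := hA v
  rw [sesq_eq_sum_mulVec, hv] at this
  simp only [Pi.zero_apply, mul_zero, Finset.sum_const_zero, Complex.zero_re] at this
  exact hv0 (normSqVec_eq_zero (by nlinarith [normSqVec_nonneg v]))

lemma Coercive.isUnit_det {c : ℝ} (hc : 0 < c) (hA : Coercive c A) : IsUnit A.det :=
  (Matrix.isUnit_iff_isUnit_det A).1 (hA.isUnit hc)

/-- `A ≥ c` implies `|(A⁻¹)_{ab}| ≤ 1/c`. -/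
lemma Coercive.norm_inv_apply_le {c : ℝ} (hc : 0 < c) (hA : Coercive c A) (a b : Fin r) :
    ‖A⁻¹ a b‖ ≤ c⁻¹ := by
  set u : Fin r → ℂ := A⁻¹ *ᵥ Pi.single b 1 with hu
  have hua (a : Fin r) : u a = A⁻¹ a b := by simp [hu]
  have hAu : A *ᵥ u = Pi.single b 1 := by
    rw [hu, mulVec_mulVec, mul_nonsing_inv A (hA.isUnit_det hc), one_mulVec]
  have h1 := hA u
  -- For `u = A⁻¹ e_b`, coercivity now reads `c |u|² ≤ |u_b|`. This first bounds `u_b` by `1 / c`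
  -- and then every entry.
  have h2 : sesq A u u = conj (u b) := by
    rw [sesq_eq_sum_mulVec, hAu, Finset.sum_eq_single b] <;> simp +contextual
  rw [h2] at h1
  have h3 : (conj (u b)).re ≤ ‖u b‖ := by
    have := Complex.re_le_norm (conj (u b))
    rwa [RCLike.norm_conj] at this
  have hb : c * ‖u b‖ ≤ 1 := by
    have h4 : c * ‖u b‖ ^ 2 ≤ ‖u b‖ := by
      have := sq_norm_le_normSqVec u b
      nlinarith
    rcases (norm_nonneg (u b)).eq_or_lt with h | h
    · rw [← h]; simp
    · by_contra! hcon
      nlinarith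
  have ha : (c * ‖u a‖) ^ 2 ≤ 1 := by
    have := sq_norm_le_normSqVec u a
    have h5 : c * ‖u a‖ ^ 2 ≤ ‖u b‖ := by nlinarith
    calc (c * ‖u a‖) ^ 2 = c * (c * ‖u a‖ ^ 2) := by ring
      _ ≤ c * ‖u b‖ := by gcongr
      _ ≤ 1 := hb
  rw [← hua, ← one_div, le_div_iff₀ hc, mul_comm]
  have := abs_le_of_sq_le_sq (a := c * ‖u a‖) (b := 1) (by simpa using ha) zero_le_one
  exact (le_abs_self _).trans this

lemma Coercive.mono {c : ℝ} {A B : Matrix (Fin r) (Fin r) ℂ} (hA : Coercive c A)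
    (h : ∀ v, (sesq A v v).re ≤ (sesq B v v).re) : Coercive c B :=
  fun v => (hA v).trans (h v)

/-- The Schur complement of a nonnegative block matrix is nonnegative. -/
lemma schur_nonneg {c : ℝ} (hc : 0 < c) {H L D : Matrix (Fin r) (Fin r) ℂ}
    (hH : H.IsHermitian) (hcH : Coercive c H)
    (hG : ∀ v w, 0 ≤ (sesq L v v).re + 2 * (sesq D w v).re + (sesq H w w).re) (v : Fin r → ℂ) :
    0 ≤ (sesq (L - Dᴴ * H⁻¹ * D) v v).re := by
  -- For fixed `v` the block form is minimal at `-w = -H⁻¹ D v`, and the minimum is the Schur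
  -- complement.
  set w : Fin r → ℂ := (H⁻¹ * D) *ᵥ v with hw
  have hHw : H *ᵥ w = D *ᵥ v := by
    rw [hw, mulVec_mulVec, ← mul_assoc, mul_nonsing_inv H (hcH.isUnit_det hc), one_mul]
  have h1 := hG v (-w)
  have e1 : sesq D (-w) v = -sesq D w v := by
    simpa using sesq_smul_left (A := D) (-1) w v
  have e2 : sesq H (-w) (-w) = sesq H w w := by
    have := sesq_smul_left (A := H) (-1) w (-w)
    have h' := sesq_smul_right (A := H) (-1) w w
    simp only [neg_smul, one_smul] at this h'
    rw [this, h']; simp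
  have e3 : sesq H w w = sesq D w v := by
    rw [sesq_eq_sum_mulVec, hHw, ← sesq_eq_sum_mulVec]
  have e4 : sesq (Dᴴ * H⁻¹ * D) v v = sesq H w w := by
    have : (Dᴴ * H⁻¹ * D) = (H⁻¹ * D)ᴴ * D := by
      rw [conjTranspose_mul, conjTranspose_nonsing_inv, hH.eq]
    rw [this, sesq_conjTranspose_mul, ← hw, e3]
  rw [sesq_sub_mat, Complex.sub_re, e4, e3]
  rw [e1, e2, e3, Complex.neg_re] at h1
  linarith

/-- The form equals that of `H` at the vector `H⁻¹ D v`. Consequently subtracting this matrix from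
`L` can only decrease the trace. -/
lemma schur_correction_nonneg {c : ℝ} (hc : 0 < c) {H D : Matrix (Fin r) (Fin r) ℂ}
    (hH : H.IsHermitian) (hcH : Coercive c H) (v : Fin r → ℂ) :
    0 ≤ (sesq (Dᴴ * H⁻¹ * D) v v).re := by
  set w : Fin r → ℂ := (H⁻¹ * D) *ᵥ v with hw
  have hHw : H *ᵥ w = D *ᵥ v := by
    rw [hw, mulVec_mulVec, ← mul_assoc, mul_nonsing_inv H (hcH.isUnit_det hc), one_mul]
  have e3 : sesq H w w = sesq D w v := by
    rw [sesq_eq_sum_mulVec, hHw, ← sesq_eq_sum_mulVec]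
  have : (Dᴴ * H⁻¹ * D) = (H⁻¹ * D)ᴴ * D := by
    rw [conjTranspose_mul, conjTranspose_nonsing_inv, hH.eq]
  rw [this, sesq_conjTranspose_mul, ← hw, ← e3]
  have := hcH w
  have := normSqVec_nonneg w
  nlinarith

/-- The bound for the curvature by the trace of the Hessian. -/
lemma norm_inv_mul_schur_le {c : ℝ} (hc : 0 < c) {H L D : Matrix (Fin r) (Fin r) ℂ}
    (hH : H.IsHermitian) (hL : L.IsHermitian) (hcH : Coercive c H)
    (hG : ∀ v w, 0 ≤ (sesq L v v).re + 2 * (sesq D w v).re + (sesq H w w).re) (a b : Fin r) :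
    ‖(H⁻¹ * (L - Dᴴ * H⁻¹ * D)) a b‖ ≤ r * c⁻¹ * L.trace.re := by
  set S := Dᴴ * H⁻¹ * D with hS
  have hSh : S.IsHermitian := by
    rw [Matrix.IsHermitian, hS, conjTranspose_mul, conjTranspose_mul, conjTranspose_conjTranspose,
      conjTranspose_nonsing_inv, hH.eq, mul_assoc]
  have hGh : (L - S).IsHermitian := hL.sub hSh
  have hGpos := schur_nonneg hc hH hcH hG
  have htr : (L - S).trace.re ≤ L.trace.re := by
    rw [trace_sub, Complex.sub_re]
    have : 0 ≤ S.trace.re := by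
      simp only [Matrix.trace, Complex.re_sum, Matrix.diag_apply]
      refine Finset.sum_nonneg fun a _ => ?_
      have := schur_correction_nonneg hc (D := D) hH hcH (Pi.single a 1)
      rwa [sesq_single] at this
    linarith
  rw [Matrix.mul_apply]
  calc ‖∑ j, H⁻¹ a j * (L - S) j b‖ ≤ ∑ j : Fin r, c⁻¹ * L.trace.re := by
        refine (norm_sum_le _ _).trans (Finset.sum_le_sum fun j _ => ?_)
        rw [norm_mul]
        exact mul_le_mul (hcH.norm_inv_apply_le hc a j)
          ((norm_apply_le_trace hGh hGpos j b).trans htr) (norm_nonneg _) (by positivity)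
    _ = r * c⁻¹ * L.trace.re := by simp [mul_assoc]

/-- The bound for the first derivative by the trace of the Hessian. -/
lemma sq_norm_le_trace {M : ℝ} {H L D : Matrix (Fin r) (Fin r) ℂ}
    (hM : ∀ a b, ‖H a b‖ ≤ M)
    (hG : ∀ v w, 0 ≤ (sesq L v v).re + 2 * (sesq D w v).re + (sesq H w w).re) (a b : Fin r) :
    ‖D a b‖ ^ 2 ≤ (r * M + 1) * L.trace.re := by
  have hM0 : 0 ≤ M := (norm_nonneg _).trans (hM a b)
  have hd (a : Fin r) : 0 ≤ (L a a).re := by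
    have := hG (Pi.single a 1) 0
    have h0 (B : Matrix (Fin r) (Fin r) ℂ) (w : Fin r → ℂ) : sesq B 0 w = 0 := by simp [sesq]
    rw [sesq_single, h0, h0] at this
    simpa using this
  have ht : (L b b).re ≤ L.trace.re := by
    simp only [Matrix.trace, Complex.re_sum, Matrix.diag_apply]
    exact Finset.single_le_sum (f := fun a => (L a a).re) (fun a _ => hd a) (Finset.mem_univ b)
  set u : Fin r → ℂ := D *ᵥ Pi.single b 1 with hu
  have hua : u a = D a b := by simp [hu]
  -- With `w = -t D e_b` the cross term is `-2t |u|²` and the last term is at most `t² r M |u|² ≤ t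
  -- |u|²`, so a gain of `t |u|²` survives. The `+ 1` keeps the denominator positive when `r M = 0`.
  set t : ℝ := (r * M + 1)⁻¹ with ht'
  have hpos : (0 : ℝ) < r * M + 1 := by positivity
  have h1 := hG (Pi.single b 1) (-(t : ℂ) • u)
  have e1 : sesq D (-(t : ℂ) • u) (Pi.single b 1) = -(t * normSqVec u : ℝ) := by
    rw [sesq_smul_left, sesq_eq_sum_mulVec, ← hu]
    have : ∑ a, conj (u a) * u a = (normSqVec u : ℂ) := by
      rw [normSqVec]
      push_cast
      exact Finset.sum_congr rfl fun a _ => Complex.conj_mul' (u a)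
    rw [this]
    simp
  have e2 : sesq H (-(t : ℂ) • u) (-(t : ℂ) • u) = (t ^ 2 : ℝ) * sesq H u u := by
    rw [sesq_smul_left, sesq_smul_right]
    simp
    ring
  rw [e1, e2, sesq_single, Complex.re_ofReal_mul, Complex.neg_re, Complex.ofReal_re] at h1
  have h3 : (sesq H u u).re ≤ r * M * normSqVec u :=
    (Complex.re_le_norm _).trans (norm_sesq_le hM u)
  have htp : 0 < t := by positivity
  have h4 : t ^ 2 * (sesq H u u).re ≤ t * normSqVec u := by
    calc t ^ 2 * (sesq H u u).re ≤ t ^ 2 * (r * M * normSqVec u) := by gcongr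
      _ = t * normSqVec u * (t * (r * M)) := by ring
      _ ≤ t * normSqVec u * 1 := by
          have := normSqVec_nonneg u
          gcongr
          rw [ht', inv_mul_le_iff₀ hpos]
          linarith
      _ = t * normSqVec u := mul_one _
  have h5 : t * normSqVec u ≤ L.trace.re := by linarith
  have h6 : normSqVec u ≤ (r * M + 1) * L.trace.re := by
    rwa [ht', inv_mul_le_iff₀ hpos] at h5
  rw [← hua]
  exact (sq_norm_le_normSqVec u a).trans h6

end LinearAlgebra

/-! ### Griffiths negativity of smooth matrix valued functions -/

section Griffiths

open Matrix
open Real (circleAverage)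

variable {n r : ℕ} {U : Set (Fin n → ℂ)} {H : (Fin n → ℂ) → Matrix (Fin r) (Fin r) ℂ}
  {z ξ η : Fin n → ℂ}

lemma two_le_infty : (2 : WithTop ℕ∞) ≤ ∞ :=
  WithTop.coe_le_coe.2 (le_top : (2 : ℕ∞) ≤ ⊤)

/-- The affine section with value `v + L(z) w` at `z`. -/
def affSec (v w : Fin r → ℂ) (L : (Fin n → ℂ) →L[ℂ] ℂ) (z : Fin n → ℂ) : Fin r → ℂ :=
  fun a => v a + L z * w a

/-- `‖u‖²_H` satisfies the sub-mean value inequality on the discs in `U`, for affine sections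
`u`. -/
def AffPsh (U : Set (Fin n → ℂ)) (H : (Fin n → ℂ) → Matrix (Fin r) (Fin r) ℂ) : Prop :=
  ∀ (v w : Fin r → ℂ) (L : (Fin n → ℂ) →L[ℂ] ℂ) (a b : Fin n → ℂ),
    (∀ ζ : ℂ, ‖ζ‖ ≤ 1 → a + ζ • b ∈ U) →
      (sesq (H a) (affSec v w L a) (affSec v w L a)).re ≤
        circleAverage (fun ζ : ℂ => (sesq (H (a + ζ • b)) (affSec v w L (a + ζ • b))
          (affSec v w L (a + ζ • b))).re) 0 1

/-- Smoothness of all entries. -/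
def MSmoothOn (U : Set (Fin n → ℂ)) (H : (Fin n → ℂ) → Matrix (Fin r) (Fin r) ℂ) : Prop :=
  ∀ a b, ContDiffOn ℝ ∞ (fun z => H z a b) U

/-- Entrywise Wirtinger derivatives. -/
def mwirt (c : ℂ) (ξ : Fin n → ℂ) (H : (Fin n → ℂ) → Matrix (Fin r) (Fin r) ℂ)
    (z : Fin n → ℂ) : Matrix (Fin r) (Fin r) ℂ :=
  Matrix.of fun a b => wirt c ξ (fun w => H w a b) z

abbrev mdel (ξ : Fin n → ℂ) (H : (Fin n → ℂ) → Matrix (Fin r) (Fin r) ℂ) (z : Fin n → ℂ) :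
    Matrix (Fin r) (Fin r) ℂ := mwirt (-Complex.I) ξ H z

abbrev mdelbar (ξ : Fin n → ℂ) (H : (Fin n → ℂ) → Matrix (Fin r) (Fin r) ℂ) (z : Fin n → ℂ) :
    Matrix (Fin r) (Fin r) ℂ := mwirt Complex.I ξ H z

/-- The complex Hessian of `H` in the direction `ξ`. -/
abbrev hess (ξ : Fin n → ℂ) (H : (Fin n → ℂ) → Matrix (Fin r) (Fin r) ℂ) (z : Fin n → ℂ) :
    Matrix (Fin r) (Fin r) ℂ := mdel ξ (mdelbar ξ H) z

lemma MSmoothOn.mwirt (hU : IsOpen U) (hH : MSmoothOn U H) (c : ℂ) (ξ : Fin n → ℂ) :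
    MSmoothOn U (mwirt c ξ H) := fun a b => ContDiffOn.wirt hU (hH a b)

lemma MSmoothOn.mono {U' : Set (Fin n → ℂ)} (hH : MSmoothOn U H) (h : U' ⊆ U) : MSmoothOn U' H :=
  fun a b => (hH a b).mono h

lemma MSmoothOn.contDiffAt (hU : IsOpen U) (hH : MSmoothOn U H) (hz : z ∈ U) (a b : Fin r) :
    ContDiffAt ℝ ∞ (fun z => H z a b) z := (hH a b).contDiffAt (hU.mem_nhds hz)

lemma MSmoothOn.differentiableAt (hU : IsOpen U) (hH : MSmoothOn U H) (hz : z ∈ U) (a b : Fin r) :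
    DifferentiableAt ℝ (fun z => H z a b) z :=
  (hH.contDiffAt hU hz a b).differentiableAt (by simp)

lemma MSmoothOn.mul {G : (Fin n → ℂ) → Matrix (Fin r) (Fin r) ℂ} (hH : MSmoothOn U H)
    (hG : MSmoothOn U G) : MSmoothOn U (fun z => H z * G z) := by
  intro a b
  simp only [Matrix.mul_apply]
  exact ContDiffOn.sum fun j _ => (hH a j).mul (hG j b)

lemma contDiffOn_det (hH : MSmoothOn U H) : ContDiffOn ℝ ∞ (fun z => (H z).det) U := by
  simp only [Matrix.det_apply]
  refine ContDiffOn.sum fun σ _ => ?_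
  simp only [Units.smul_def, zsmul_eq_mul]
  exact contDiffOn_const.mul (contDiffOn_prod fun i _ => hH _ _)

lemma MSmoothOn.inv (hH : MSmoothOn U H) (hu : ∀ z ∈ U, IsUnit (H z)) :
    MSmoothOn U (fun z => (H z)⁻¹) := by
  intro a b
  have h1 : ContDiffOn ℝ ∞ (fun z => (H z).adjugate a b) U := by
    simp only [Matrix.adjugate_apply]
    refine contDiffOn_det fun i j => ?_
    by_cases h : i = b
    · subst h
      simp only [Matrix.updateRow_self]
      exact contDiffOn_const
    · simp only [Matrix.updateRow_ne h]
      exact hH i j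
  simp only [Matrix.inv_def, Ring.inverse_eq_inv', Matrix.smul_apply, smul_eq_mul]
  refine ContDiffOn.mul ((contDiffOn_det hH).inv fun z hz => ?_) h1
  exact ((Matrix.isUnit_iff_isUnit_det _).1 (hu z hz)).ne_zero

lemma mwirt_mul (hU : IsOpen U) {G : (Fin n → ℂ) → Matrix (Fin r) (Fin r) ℂ} (hH : MSmoothOn U H)
    (hG : MSmoothOn U G) (hz : z ∈ U) (c : ℂ) (ξ : Fin n → ℂ) :
    mwirt c ξ (fun z => H z * G z) z = mwirt c ξ H z * G z + H z * mwirt c ξ G z := by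
  ext a b
  simp only [mwirt, Matrix.of_apply, Matrix.mul_apply, Matrix.add_apply]
  rw [wirt_sum fun j _ => (hH.differentiableAt hU hz a j).fun_mul (hG.differentiableAt hU hz j b),
    ← Finset.sum_add_distrib]
  exact Finset.sum_congr rfl fun j _ =>
    wirt_mul (hH.differentiableAt hU hz a j) (hG.differentiableAt hU hz j b)

lemma mwirt_congr {G : (Fin n → ℂ) → Matrix (Fin r) (Fin r) ℂ} (h : H =ᶠ[𝓝 z] G) (c : ℂ) :
    mwirt c ξ H z = mwirt c ξ G z := by
  ext a b
  exact wirt_congr (h.fun_comp (fun A => A a b))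

lemma mwirt_isHermitian (hh : ∀ᶠ w in 𝓝 z, (H w).IsHermitian) (c : ℂ) :
    mwirt c ξ H z = (mwirt (conj c) ξ H z)ᴴ := by
  ext a b
  simp only [mwirt, Matrix.of_apply, Matrix.conjTranspose_apply]
  have : (fun w => H w a b) =ᶠ[𝓝 z] fun w => conj (H w b a) := by
    filter_upwards [hh] with w hw
    exact (hw.apply a b).symm
  rw [wirt_congr this, wirt_conj]
  rfl

lemma mdelbar_eq (hh : ∀ᶠ w in 𝓝 z, (H w).IsHermitian) : mdelbar ξ H z = (mdel ξ H z)ᴴ := by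
  rw [mdelbar, mwirt_isHermitian hh]; simp

lemma hess_comm (hU : IsOpen U) (hH : MSmoothOn U H) (hz : z ∈ U) :
    hess ξ H z = mdelbar ξ (mdel ξ H) z := by
  ext a b
  exact wirt_comm ((hH.contDiffAt hU hz a b).of_le two_le_infty) _

/-- Conjugation exchanges `∂` and `∂̄`, and these two derivatives commute. -/
lemma hess_isHermitian (hU : IsOpen U) (hH : MSmoothOn U H) (hh : ∀ w ∈ U, (H w).IsHermitian)
    (hz : z ∈ U) : (hess ξ H z).IsHermitian := by
  rw [Matrix.IsHermitian]
  ext a b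
  simp only [hess, mdel, mdelbar, mwirt, Matrix.of_apply, Matrix.conjTranspose_apply]
  have h1 : (fun w => wirt Complex.I ξ (fun w => H w b a) w) =ᶠ[𝓝 z]
      fun w => conj (wirt (-Complex.I) ξ (fun w => H w a b) w) := by
    filter_upwards [hU.mem_nhds hz] with w hw
    have : (fun w => H w b a) =ᶠ[𝓝 w] fun w => conj (H w a b) := by
      filter_upwards [hU.mem_nhds hw] with w' hw'
      exact ((hh w' hw').apply b a).symm
    rw [wirt_congr this, wirt_conj, Complex.conj_I]
  rw [wirt_congr h1, wirt_conj]
  simp only [map_neg, Complex.conj_I, neg_neg, RCLike.star_def, Complex.conj_conj]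
  exact (wirt_comm ((hH.contDiffAt hU hz a b).of_le two_le_infty) _).symm

/-- Griffiths negativity at a point: the Hessian inequality. -/
def GriffithsAt (H : (Fin n → ℂ) → Matrix (Fin r) (Fin r) ℂ) (z : Fin n → ℂ) : Prop :=
  ∀ (ξ : Fin n → ℂ) (v w : Fin r → ℂ),
    0 ≤ (sesq (hess ξ H z) v v).re + 2 * (sesq (mdel ξ H z) w v).re + (sesq (H z) w w).re

/-- The right factor is holomorphic and the left one antiholomorphic, so `∂̄` kills the former and
`∂` the latter; of the nine terms of the product rule only four survive. -/
lemma del_delbar_sandwich {f : (Fin n → ℂ) → ℂ} (hU : IsOpen U) (hf : ContDiffOn ℝ ∞ f U)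
    (hz : z ∈ U) (L : (Fin n → ℂ) →L[ℂ] ℂ) (s t s' t' : ℂ) :
    del ξ (delbar ξ (fun y => conj (s + L y * t) * f y * (s' + L y * t'))) z =
      conj (s + L z * t) * (s' + L z * t') * del ξ (delbar ξ f) z
      + conj (L ξ * t) * (s' + L z * t') * del ξ f z
      + conj (s + L z * t) * (L ξ * t') * delbar ξ f z
      + conj (L ξ * t) * (L ξ * t') * f z := by
  have hp (s t : ℂ) : (fun y => s + L y * t) = fun y => s + (t • L) y := by
    funext y; simp [mul_comm]
  have hpd (s t : ℂ) (y : Fin n → ℂ) : DifferentiableAt ℝ (fun y => s + L y * t) y := by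
    have : DifferentiableAt ℝ (fun y => L y) y := (L.restrictScalars ℝ).differentiableAt
    fun_prop
  have hpc (s t : ℂ) (y : Fin n → ℂ) : DifferentiableAt ℝ (fun y => conj (s + L y * t)) y :=
    Complex.conjCLE.differentiableAt.comp y (hpd s t y)
  have d1 (s t : ℂ) (y : Fin n → ℂ) : wirt (-Complex.I) ξ (fun y => s + L y * t) y = L ξ * t := by
    rw [hp]
    refine (del_holomorphic _ _).trans ?_
    simp [mul_comm]
  have d2 (s t : ℂ) (y : Fin n → ℂ) : wirt Complex.I ξ (fun y => s + L y * t) y = 0 := by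
    rw [hp]
    exact delbar_holomorphic _ _
  have d3 (s t : ℂ) (y : Fin n → ℂ) :
      wirt (-Complex.I) ξ (fun y => conj (s + L y * t)) y = 0 := by
    rw [wirt_conj, map_neg, Complex.conj_I, neg_neg, d2, map_zero]
  have d4 (s t : ℂ) (y : Fin n → ℂ) :
      wirt Complex.I ξ (fun y => conj (s + L y * t)) y = conj (L ξ * t) := by
    rw [wirt_conj, Complex.conj_I, d1]
  have hfd : ∀ y ∈ U, DifferentiableAt ℝ f y := fun y hy =>
    (hf.contDiffAt (hU.mem_nhds hy)).differentiableAt (by simp)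
  have hgd : DifferentiableAt ℝ (delbar ξ f) z :=
    ((ContDiffOn.wirt hU hf).contDiffAt (hU.mem_nhds hz)).differentiableAt (by simp)
  have h1 : (delbar ξ (fun y => conj (s + L y * t) * f y * (s' + L y * t'))) =ᶠ[𝓝 z]
      fun y => (conj (L ξ * t) * (f y * (s' + L y * t'))) +
        (conj (s + L y * t) * (delbar ξ f y * (s' + L y * t'))) := by
    filter_upwards [hU.mem_nhds hz] with y hy
    rw [delbar, wirt_mul ((hpc s t y).fun_mul (hfd y hy)) (hpd s' t' y),
      wirt_mul (hpc s t y) (hfd y hy),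
      d4, d2]
    ring
  have e1 : DifferentiableAt ℝ (fun y => f y * (s' + L y * t')) z := (hfd z hz).mul (hpd s' t' z)
  have e2 : DifferentiableAt ℝ (fun y => delbar ξ f y * (s' + L y * t')) z := hgd.mul (hpd s' t' z)
  rw [del, wirt_congr h1, wirt_add (e1.const_mul _) ((hpc s t z).fun_mul e2), wirt_const_mul _ e1,
    wirt_mul (hfd z hz) (hpd s' t' z), wirt_mul (hpc s t z) e2, wirt_mul hgd (hpd s' t' z),
    d1, d3]
  ring

/-- A smooth hermitian metric with the sub-mean value property is Griffiths negative. -/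
lemma AffPsh.griffithsAt (hU : IsOpen U) (hH : MSmoothOn U H) (hh : ∀ w ∈ U, (H w).IsHermitian)
    (hpsd : ∀ w ∈ U, ∀ v, 0 ≤ (sesq (H w) v v).re) (hpsh : AffPsh U H) (hz : z ∈ U) :
    GriffithsAt H z := by
  intro ξ v w
  -- In the direction zero no linear form takes the value one; there all derivatives vanish and the
  -- claim is the positivity of `H z`.
  by_cases hξ : ξ = 0
  · subst hξ
    have h1 (c : ℂ) (G : (Fin n → ℂ) → Matrix (Fin r) (Fin r) ℂ) : mwirt c 0 G z = 0 := by
      ext a b; simp [mwirt, wirt]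
    have h2 (v w : Fin r → ℂ) : sesq (0 : Matrix (Fin r) (Fin r) ℂ) v w = 0 := by simp [sesq]
    rw [hess, mdel, h1, mdel, h1, h2, h2]
    simpa using hpsd z hz w
  obtain ⟨L, hL⟩ : ∃ L : (Fin n → ℂ) →L[ℂ] ℂ, L ξ = 1 := by
    obtain ⟨j, hj⟩ := Function.ne_iff.1 hξ
    refine ⟨(ξ j)⁻¹ • ContinuousLinearMap.proj j, ?_⟩
    simpa using inv_mul_cancel₀ hj
  -- The shift makes the section `v' + L w` equal to `v` at `z`, and its derivative in the direction
  -- `ξ` is `w` because `L ξ = 1`.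
  set v' : Fin r → ℂ := fun a => v a - L z * w a with hv'
  have hva (a : Fin r) : v' a + L z * w a = v a := by simp [hv']
  set g : (Fin n → ℂ) → ℂ := fun y => sesq (H y) (affSec v' w L y) (affSec v' w L y) with hg
  have hLs : ContDiff ℝ ∞ (fun y => L y) := (L.restrictScalars ℝ).contDiff
  have hterm (a b : Fin r) : ContDiffOn ℝ ∞
      (fun y => conj (v' a + L y * w a) * H y a b * (v' b + L y * w b)) U := by
    have h1 : ContDiff ℝ ∞ (fun y => conj (v' a + L y * w a)) :=
      Complex.conjCLE.contDiff.comp (contDiff_const.add (hLs.mul contDiff_const))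
    have h2 : ContDiff ℝ ∞ (fun y => v' b + L y * w b) :=
      contDiff_const.add (hLs.mul contDiff_const)
    exact (h1.contDiffOn.mul (hH a b)).mul h2.contDiffOn
  have hgs : ContDiffOn ℝ ∞ g U :=
    ContDiffOn.sum fun a _ => ContDiffOn.sum fun b _ => hterm a b
  have hsub : ∀ᶠ ρ in 𝓝[>] (0 : ℝ),
      (g z).re ≤ circleAverage (fun ζ : ℂ => (g (z + ζ • ξ)).re) 0 ρ := by
    have hline' : Tendsto (fun ζ : ℂ => z + ζ • ξ) (𝓝 0) (𝓝 z) := by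
      have : Continuous (fun ζ : ℂ => z + ζ • ξ) := by fun_prop
      simpa using this.tendsto 0
    obtain ⟨δ, hδ, hball⟩ := Metric.eventually_nhds_iff_ball.1
      (hline'.eventually (hU.mem_nhds hz))
    filter_upwards [Ioo_mem_nhdsGT hδ] with ρ hρ
    -- The unit disc in the direction `ρ ξ` is the disc of radius `ρ` in the direction `ξ`.
    have := hpsh v' w L z ((ρ : ℂ) • ξ) (fun ζ hζ => by
      rw [smul_smul]
      refine hball _ ?_
      rw [mem_ball_zero_iff, norm_mul, Complex.norm_real, Real.norm_of_nonneg hρ.1.le]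
      nlinarith [hρ.1, hρ.2])
    rw [Real.circleAverage_eq_circleAverage_zero_one]
    refine this.trans (le_of_eq ?_)
    congr 1
    funext ζ
    simp only [hg, smul_smul, mul_comm ζ (ρ : ℂ), add_zero]
  have hpos := del_delbar_re_nonneg
    ((hgs.contDiffAt (hU.mem_nhds hz)).of_le two_le_infty) hsub
  have hdiff (F : Fin r → Fin r → (Fin n → ℂ) → ℂ) (hF : ∀ a b, ContDiffOn ℝ ∞ (F a b) U)
      (c : ℂ) (y : Fin n → ℂ) (hy : y ∈ U) : wirt c ξ (fun y => ∑ a, ∑ b, F a b y) y =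
        ∑ a, ∑ b, wirt c ξ (F a b) y := by
    have hd (a b : Fin r) : DifferentiableAt ℝ (F a b) y :=
      ((hF a b).contDiffAt (hU.mem_nhds hy)).differentiableAt (by simp)
    rw [wirt_sum fun a _ => DifferentiableAt.fun_sum fun b _ => hd a b]
    exact Finset.sum_congr rfl fun a _ => wirt_sum fun b _ => hd a b
  have hgexp : del ξ (delbar ξ g) z =
      sesq (hess ξ H z) v v + sesq (mdel ξ H z) w v + sesq (mdelbar ξ H z) v w
        + sesq (H z) w w := by
    have h1 : delbar ξ g =ᶠ[𝓝 z] fun y => ∑ a, ∑ b,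
        delbar ξ (fun y => conj (v' a + L y * w a) * H y a b * (v' b + L y * w b)) y := by
      filter_upwards [hU.mem_nhds hz] with y hy
      exact hdiff _ hterm _ y hy
    rw [del, wirt_congr h1, hdiff _ (fun a b => ContDiffOn.wirt hU (hterm a b)) _ z hz]
    simp only [sesq, ← Finset.sum_add_distrib]
    refine Finset.sum_congr rfl fun a _ => Finset.sum_congr rfl fun b _ => ?_
    have := del_delbar_sandwich (ξ := ξ) hU (hH a b) hz L (v' a) (w a) (v' b) (w b)
    rw [hL, hva, hva, one_mul, one_mul] at this
    refine this.trans ?_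
    simp only [hess, mdel, mdelbar, mwirt, Matrix.of_apply]
    ring_nf
  have hbar : sesq (mdelbar ξ H z) v w = conj (sesq (mdel ξ H z) w v) := by
    rw [mdelbar_eq (by filter_upwards [hU.mem_nhds hz] with y hy using hh y hy),
      sesq_conjTranspose]
  rw [hgexp, hbar] at hpos
  simp only [Complex.add_re, Complex.conj_re] at hpos
  linarith

end Griffiths

/-! ### Uniform bounds for smooth Griffiths negative metrics -/

section Bounds

open Matrix

variable {n r : ℕ} {U : Set (Fin n → ℂ)} {H : (Fin n → ℂ) → Matrix (Fin r) (Fin r) ℂ}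
  {z ξ η : Fin n → ℂ} {c M : ℝ}

/-- The coefficient of the connection form in the direction `ξ`. -/
def connM (H : (Fin n → ℂ) → Matrix (Fin r) (Fin r) ℂ) (ξ z : Fin n → ℂ) :
    Matrix (Fin r) (Fin r) ℂ := (H z)⁻¹ * mdel ξ H z

/-- The coefficient of the curvature form in the directions `ξ`, `η̄`. -/
def curvM (H : (Fin n → ℂ) → Matrix (Fin r) (Fin r) ℂ) (ξ η z : Fin n → ℂ) :
    Matrix (Fin r) (Fin r) ℂ := -mdelbar η (connM H ξ) z

lemma connCoeff_eq (H : (Fin n → ℂ) → Matrix (Fin r) (Fin r) ℂ) (j : Fin n) :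
    connCoeff H j = connM H (Pi.single j 1) := by
  funext z
  rw [connCoeff, connM, dz_eq_del]
  rfl

lemma curvCoeff_eq (H : (Fin n → ℂ) → Matrix (Fin r) (Fin r) ℂ) (j k : Fin n) (z : Fin n → ℂ) :
    curvCoeff H j k z = curvM H (Pi.single j 1) (Pi.single k 1) z := by
  ext a b
  rw [curvCoeff, connCoeff_eq, dzbar_eq_delbar]
  rfl

/-- Smooth Griffiths negative metrics on `U` with uniform bounds. -/
structure GoodMetric (U : Set (Fin n → ℂ)) (c M : ℝ)
    (H : (Fin n → ℂ) → Matrix (Fin r) (Fin r) ℂ) : Prop where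
  smooth : MSmoothOn U H
  hermitian : ∀ z ∈ U, (H z).IsHermitian
  coercive : ∀ z ∈ U, Coercive c (H z)
  bound : ∀ z ∈ U, ∀ a b, ‖H z a b‖ ≤ M
  griffiths : ∀ z ∈ U, GriffithsAt H z

/-! ### Pointwise bounds for the connection and the curvature of a smooth metric. -/

namespace GoodMetric

lemma inv_smooth (hc : 0 < c) (h : GoodMetric U c M H) : MSmoothOn U (fun z => (H z)⁻¹) :=
  h.smooth.inv fun z hz => (h.coercive z hz).isUnit hc

lemma connM_smooth (hU : IsOpen U) (hc : 0 < c) (h : GoodMetric U c M H) (ξ : Fin n → ℂ) :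
    MSmoothOn U (connM H ξ) := (h.inv_smooth hc).mul (h.smooth.mwirt hU _ _)

lemma curvM_smooth (hU : IsOpen U) (hc : 0 < c) (h : GoodMetric U c M H) (ξ η : Fin n → ℂ) :
    MSmoothOn U (curvM H ξ η) := fun a b => ((h.connM_smooth hU hc ξ).mwirt hU _ _ a b).neg

/-- Apply `∂̄` to `H θ = ∂H`: this gives `∂̄H θ + H ∂̄θ = ∂̄∂H`, where `∂̄H = (∂H)*` because `H` is
hermitian. Thus the curvature is `-H⁻¹` times a Schur complement. -/
lemma curvM_self (hU : IsOpen U) (hc : 0 < c) (h : GoodMetric U c M H) (hz : z ∈ U) :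
    curvM H ξ ξ z =
      -((H z)⁻¹ * (hess ξ H z - (mdel ξ H z)ᴴ * (H z)⁻¹ * mdel ξ H z)) := by
  have hu : IsUnit (H z).det := (h.coercive z hz).isUnit_det hc
  have h1 : (fun y => H y * connM H ξ y) =ᶠ[𝓝 z] mdel ξ H := by
    filter_upwards [hU.mem_nhds hz] with y hy
    rw [connM, ← mul_assoc, mul_nonsing_inv _ ((h.coercive y hy).isUnit_det hc), one_mul]
  have h2 := mwirt_mul hU h.smooth (h.connM_smooth hU hc ξ) hz Complex.I ξ
  have hb : mwirt Complex.I ξ H z = (mdel ξ H z)ᴴ := mdelbar_eq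
    (by filter_upwards [hU.mem_nhds hz] with y hy using h.hermitian y hy)
  rw [mwirt_congr h1 Complex.I, hb] at h2
  have h3 : H z * mdelbar ξ (connM H ξ) z =
      hess ξ H z - (mdel ξ H z)ᴴ * (H z)⁻¹ * mdel ξ H z := by
    rw [hess_comm hU h.smooth hz, show mdelbar ξ (mdel ξ H) z = _ from h2, mul_assoc, ← connM]
    abel
  rw [curvM, ← h3, ← mul_assoc, nonsing_inv_mul _ hu, one_mul]

lemma trace_hess_nonneg (h : GoodMetric U c M H) (hz : z ∈ U) (ξ : Fin n → ℂ) :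
    0 ≤ (hess ξ H z).trace.re := by
  simp only [Matrix.trace, Complex.re_sum, Matrix.diag_apply]
  refine Finset.sum_nonneg fun a _ => ?_
  have := h.griffiths z hz ξ (Pi.single a 1) 0
  have h0 (B : Matrix (Fin r) (Fin r) ℂ) (w : Fin r → ℂ) : sesq B 0 w = 0 := by simp [sesq]
  rw [sesq_single, h0, h0] at this
  simpa using this

lemma norm_curvM_self_le (hU : IsOpen U) (hc : 0 < c) (h : GoodMetric U c M H) (hz : z ∈ U)
    (ξ : Fin n → ℂ) (a b : Fin r) :
    ‖curvM H ξ ξ z a b‖ ≤ r * c⁻¹ * (hess ξ H z).trace.re := by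
  rw [h.curvM_self hU hc hz, Matrix.neg_apply, norm_neg]
  exact norm_inv_mul_schur_le hc (h.hermitian z hz)
    (hess_isHermitian hU h.smooth h.hermitian hz) (h.coercive z hz) (h.griffiths z hz ξ) a b

lemma sq_norm_mdel_le (h : GoodMetric U c M H) (hz : z ∈ U) (ξ : Fin n → ℂ) (a b : Fin r) :
    ‖mdel ξ H z a b‖ ^ 2 ≤ (r * M + 1) * (hess ξ H z).trace.re :=
  sq_norm_le_trace (h.bound z hz) (h.griffiths z hz ξ) a b

lemma connM_add (H : (Fin n → ℂ) → Matrix (Fin r) (Fin r) ℂ) (ξ η z : Fin n → ℂ) :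
    connM H (ξ + η) z = connM H ξ z + connM H η z := by
  rw [connM, connM, connM, ← mul_add]
  congr 1
  ext a b
  exact wirt_add_dir

lemma connM_smul (H : (Fin n → ℂ) → Matrix (Fin r) (Fin r) ℂ) (t : ℂ) (ξ z : Fin n → ℂ) :
    connM H (t • ξ) z = t • connM H ξ z := by
  rw [connM, connM, ← mul_smul_comm]
  congr 1
  ext a b
  exact del_smul_dir t

lemma curvM_add_smul_left (hU : IsOpen U) (hc : 0 < c) (h : GoodMetric U c M H) (hz : z ∈ U)
    (ξ ξ' η : Fin n → ℂ) (t : ℂ) :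
    curvM H (ξ + t • ξ') η z = curvM H ξ η z + t • curvM H ξ' η z := by
  ext a b
  have e : (fun y => connM H (ξ + t • ξ') y a b) =
      fun y => connM H ξ y a b + t * connM H ξ' y a b := by
    funext y; rw [connM_add, connM_smul]; rfl
  have d (ξ : Fin n → ℂ) := (h.connM_smooth hU hc ξ).differentiableAt hU hz a b
  simp only [curvM, mdelbar, mwirt, Matrix.neg_apply, Matrix.of_apply, Matrix.add_apply,
    Matrix.smul_apply, e, smul_eq_mul]
  rw [wirt_add (d ξ) ((d ξ').const_mul t), wirt_const_mul _ (d ξ')]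
  ring

lemma curvM_add_smul_right (H : (Fin n → ℂ) → Matrix (Fin r) (Fin r) ℂ) (ξ η η' z : Fin n → ℂ)
    (t : ℂ) : curvM H ξ (η + t • η') z = curvM H ξ η z + conj t • curvM H ξ η' z := by
  ext a b
  have := delbar_smul_dir (ξ := η') (f := fun y => connM H ξ y a b) (z := z) t
  simp only [curvM, mdelbar, mwirt, Matrix.neg_apply, Matrix.of_apply, Matrix.add_apply,
    Matrix.smul_apply, smul_eq_mul]
  rw [wirt_add_dir, show wirt Complex.I (t • η') (fun w => connM H ξ w a b) z = _ from this]
  ring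

/-- Polarization. -/
lemma curvM_polarization (hU : IsOpen U) (hc : 0 < c) (h : GoodMetric U c M H) (hz : z ∈ U)
    (ξ η : Fin n → ℂ) :
    (4 : ℂ) • curvM H ξ η z = curvM H (ξ + (1 : ℂ) • η) (ξ + (1 : ℂ) • η) z
      + Complex.I • curvM H (ξ + Complex.I • η) (ξ + Complex.I • η) z
      - curvM H (ξ + (-1 : ℂ) • η) (ξ + (-1 : ℂ) • η) z
      - Complex.I • curvM H (ξ + (-Complex.I) • η) (ξ + (-Complex.I) • η) z := by
  -- Multiply this expansion by `t` and sum over the fourth roots of unity: the terms carrying `1`,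
  -- `t` and `t t̄` cancel, and the coefficient of the `t̄` term becomes `4`.
  have key (t : ℂ) : curvM H (ξ + t • η) (ξ + t • η) z = curvM H ξ ξ z +
      conj t • curvM H ξ η z + t • curvM H η ξ z + (t * conj t) • curvM H η η z := by
    rw [h.curvM_add_smul_left hU hc hz, curvM_add_smul_right, curvM_add_smul_right, smul_add,
      smul_smul]
    abel
  rw [key, key, key, key]
  ext a b
  simp only [Matrix.smul_apply, Matrix.add_apply, Matrix.sub_apply, smul_eq_mul, map_neg, map_one,
    Complex.conj_I]
  linear_combination (2 * curvM H ξ η z a b - 2 * curvM H η ξ z a b) * Complex.I_sq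

/-- The sum of the traces of the Hessians in the directions used for polarization. -/
def polTrace (H : (Fin n → ℂ) → Matrix (Fin r) (Fin r) ℂ) (ξ η z : Fin n → ℂ) : ℝ :=
  (hess (ξ + (1 : ℂ) • η) H z).trace.re + (hess (ξ + Complex.I • η) H z).trace.re +
    (hess (ξ + (-1 : ℂ) • η) H z).trace.re + (hess (ξ + (-Complex.I) • η) H z).trace.re

/-- Only the coefficients with equal directions are Schur complements with a sign; polarization
expresses a mixed one by four of these. -/
lemma norm_curvM_le (hU : IsOpen U) (hc : 0 < c) (h : GoodMetric U c M H) (hz : z ∈ U)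
    (ξ η : Fin n → ℂ) (a b : Fin r) :
    ‖curvM H ξ η z a b‖ ≤ r * c⁻¹ * polTrace H ξ η z := by
  have hp := congrFun (congrFun (h.curvM_polarization hU hc hz ξ η) a) b
  simp only [Matrix.smul_apply, Matrix.add_apply, Matrix.sub_apply, smul_eq_mul] at hp
  have h4 : (4 : ℝ) * ‖curvM H ξ η z a b‖ ≤ r * c⁻¹ * polTrace H ξ η z := by
    have : (4 : ℝ) * ‖curvM H ξ η z a b‖ = ‖4 * curvM H ξ η z a b‖ := by simp
    rw [this, hp, polTrace]
    have b1 (t : ℂ) := h.norm_curvM_self_le hU hc hz (ξ + t • η) a b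
    refine (norm_sub_le _ _).trans ?_
    refine (add_le_add_left ((norm_sub_le _ _).trans (add_le_add_left (norm_add_le _ _) _)) _).trans
      ?_
    rw [norm_mul, norm_mul, Complex.norm_I, one_mul, one_mul]
    linarith [b1 1, b1 Complex.I, b1 (-1), b1 (-Complex.I)]
  linarith [norm_nonneg (curvM H ξ η z a b)]

end GoodMetric

/-- Smooth cutoff functions. -/
lemma exists_cutoff (hU : IsOpen U) {K : Set (Fin n → ℂ)} (hK : IsCompact K) (hKU : K ⊆ U) :
    ∃ χ : (Fin n → ℂ) → ℝ, IsTest U (fun z => (χ z : ℂ)) ∧ (∀ z, 0 ≤ χ z) ∧ (∀ z, χ z ≤ 1) ∧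
      ∀ z ∈ K, χ z = 1 := by
  obtain ⟨K', hK', hKK', hK'U⟩ := exists_compact_between hK hU hKU
  obtain ⟨χ, hχ, hr, hs, h1⟩ := exists_contMDiff_support_eq_eq_one_iff (n := (⊤ : ℕ∞))
    (modelWithCornersSelf ℝ (Fin n → ℂ)) (isOpen_interior (s := K')) hK.isClosed hKK'
  have hts : tsupport (fun z => (χ z : ℂ)) ⊆ K' := by
    refine closure_minimal (fun z hz => ?_) hK'.isClosed
    refine interior_subset (hs ▸ ?_ : z ∈ interior K')
    simpa using hz
  refine ⟨χ, ⟨Complex.ofRealCLM.contDiff.comp hχ.contDiff,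
    hK'.of_isClosed_subset (isClosed_tsupport _) hts, hts.trans hK'U⟩,
    fun z => (hr (mem_range_self z)).1, fun z => (hr (mem_range_self z)).2,
    fun z hz => (h1 z).1 hz⟩

lemma continuousOn_trace_hess (hU : IsOpen U) (hH : MSmoothOn U H) (ξ : Fin n → ℂ) :
    ContinuousOn (fun z => (hess ξ H z).trace) U := by
  simp only [Matrix.trace, Matrix.diag_apply]
  exact continuousOn_finsetSum _ fun a _ => ((hH.mwirt hU _ ξ).mwirt hU _ ξ a a).continuousOn

lemma integrableOn_of_continuousOn {F : Type*} [NormedAddCommGroup F] {f : (Fin n → ℂ) → F}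
    {K : Set (Fin n → ℂ)}
    (hf : ContinuousOn f U) (hK : IsCompact K) (hKU : K ⊆ U) : IntegrableOn f K :=
  (hf.mono hKU).integrableOn_compact hK

/-- The mass of the Hessian on a compact set is bounded in terms of the sup norm. -/
lemma exists_integral_trace_hess_le (hU : IsOpen U) {K : Set (Fin n → ℂ)} (hK : IsCompact K)
    (hKU : K ⊆ U) (c M : ℝ) (ξ : Fin n → ℂ) :
    ∃ C : ℝ, ∀ H : (Fin n → ℂ) → Matrix (Fin r) (Fin r) ℂ, GoodMetric U c M H →
      ∫ z in K, (hess ξ H z).trace.re ≤ C := by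
  obtain ⟨χ, hχ, hχ0, hχ1, hχK⟩ := exists_cutoff hU hK hKU
  set χc : (Fin n → ℂ) → ℂ := fun z => (χ z : ℂ) with hχc
  have hχ2 : IsTest U (delbar ξ (del ξ χc)) := hχ.wirt.wirt
  -- The bound is fixed before `H`: besides `r` and `M` it contains only the cutoff function, which
  -- depends on `U` and `K`, and the direction.
  refine ⟨r * M * ∫ z, ‖delbar ξ (del ξ χc) z‖, fun H h => ?_⟩
  have hcont := continuousOn_trace_hess hU h.smooth ξ
  have hcontre : ContinuousOn (fun z => (hess ξ H z).trace.re) U :=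
    Complex.continuous_re.comp_continuousOn hcont
  have hint : Integrable (fun z => (hess ξ H z).trace * χc z) :=
    integrable_mul_of_tsupport hU hcont hχ.contDiff.continuous hχ.hasCompactSupport
      hχ.tsupport_subset
  have hre (z : Fin n → ℂ) : ((hess ξ H z).trace * χc z).re = (hess ξ H z).trace.re * χ z := by
    simp [hχc]
  -- The trace is non-negative on `U`, the cutoff is one on `K`, and the product vanishes off `U`.
  have h1 : ∫ z in K, (hess ξ H z).trace.re ≤ ∫ z, ((hess ξ H z).trace * χc z).re := by
    rw [← integral_indicator hK.measurableSet]
    refine integral_mono ?_ hint.re fun z => ?_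
    · rw [integrable_indicator_iff hK.measurableSet]
      exact integrableOn_of_continuousOn hcontre hK hKU
    · show _ ≤ ((hess ξ H z).trace * χc z).re
      rw [hre]
      by_cases hz : z ∈ K
      · rw [indicator_of_mem hz, hχK z hz, mul_one]
      · rw [indicator_of_notMem hz]
        by_cases hzU : z ∈ U
        · exact mul_nonneg (h.trace_hess_nonneg hzU ξ) (hχ0 z)
        · have : χc z = 0 := by
            by_contra hne
            exact hzU (hχ.tsupport_subset (subset_tsupport _ hne))
          have : χ z = 0 := Complex.ofReal_eq_zero.1 this
          rw [this, mul_zero]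
  -- Both derivatives are moved onto the cutoff, so that afterwards only the size of the entries of
  -- `H` matters.
  have h2 : ∫ z, (hess ξ H z).trace * χc z =
      ∑ a, ∫ z, H z a a * delbar ξ (del ξ χc) z := by
    have : ∀ a : Fin r, ∫ z, H z a a * delbar ξ (del ξ χc) z = ∫ z, hess ξ H z a a * χc z := by
      intro a
      rw [integral_mul_wirt hU (h.smooth a a) hχ.wirt,
        integral_mul_wirt hU (ContDiffOn.wirt hU (h.smooth a a)) hχ, neg_neg]
      rfl
    simp_rw [this]
    rw [← integral_finsetSum]
    · simp only [Matrix.trace, Matrix.diag_apply, Finset.sum_mul]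
    · intro a _
      exact integrable_mul_of_tsupport hU ((h.smooth.mwirt hU _ ξ).mwirt hU _ ξ a a).continuousOn
        hχ.contDiff.continuous hχ.hasCompactSupport hχ.tsupport_subset
  have hre2 : ∫ z, ((hess ξ H z).trace * χc z).re = (∫ z, (hess ξ H z).trace * χc z).re :=
    integral_re hint
  rw [hre2, h2] at h1
  refine h1.trans ((Complex.re_le_norm _).trans ((norm_sum_le _ _).trans ?_))
  have hi : Integrable (fun z => ‖delbar ξ (del ξ χc) z‖) :=
    (hχ2.contDiff.continuous.integrable_of_hasCompactSupport hχ2.hasCompactSupport).norm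
  have h3 (a : Fin r) : ‖∫ z, H z a a * delbar ξ (del ξ χc) z‖ ≤
      M * ∫ z, ‖delbar ξ (del ξ χc) z‖ := by
    rw [← integral_const_mul]
    refine norm_integral_le_of_norm_le (hi.const_mul M) (ae_of_all _ fun z => ?_)
    rw [norm_mul]
    by_cases hz : z ∈ U
    · gcongr
      exact h.bound z hz a a
    · have : delbar ξ (del ξ χc) z = 0 := by
        by_contra hne
        exact hz (hχ2.tsupport_subset (subset_tsupport _ hne))
      rw [this]; simp
  calc ∑ a, ‖∫ z, H z a a * delbar ξ (del ξ χc) z‖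
      ≤ ∑ a : Fin r, M * ∫ z, ‖delbar ξ (del ξ χc) z‖ := Finset.sum_le_sum fun a _ => h3 a
    _ = r * M * ∫ z, ‖delbar ξ (del ξ χc) z‖ := by simp [mul_assoc]

/-- Uniform bound for the mass of the curvature. -/
lemma exists_integral_norm_curvM_le (hU : IsOpen U) {K : Set (Fin n → ℂ)} (hK : IsCompact K)
    (hKU : K ⊆ U) {c : ℝ} (hc : 0 < c) (M : ℝ) (ξ η : Fin n → ℂ) :
    ∃ C : ℝ, ∀ H : (Fin n → ℂ) → Matrix (Fin r) (Fin r) ℂ, GoodMetric U c M H →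
      ∀ a b, ∫ z in K, ‖curvM H ξ η z a b‖ ≤ C := by
  choose C hC using exists_integral_trace_hess_le (r := r) hU hK hKU c M
  refine ⟨r * c⁻¹ * (C (ξ + (1 : ℂ) • η) + C (ξ + Complex.I • η) + C (ξ + (-1 : ℂ) • η) +
    C (ξ + (-Complex.I) • η)), fun H h a b => ?_⟩
  have hi (ξ : Fin n → ℂ) : IntegrableOn (fun z => (hess ξ H z).trace.re) K :=
    integrableOn_of_continuousOn
      (Complex.continuous_re.comp_continuousOn (continuousOn_trace_hess hU h.smooth ξ)) hK hKU
  have h1 : ∫ z in K, ‖curvM H ξ η z a b‖ ≤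
      ∫ z in K, r * c⁻¹ * GoodMetric.polTrace H ξ η z := by
    refine setIntegral_mono_on (integrableOn_of_continuousOn
      (h.curvM_smooth hU hc ξ η a b).continuousOn hK hKU).norm ?_ hK.measurableSet
      fun z hz => h.norm_curvM_le hU hc (hKU hz) ξ η a b
    exact ((((hi _).add (hi _)).add (hi _)).add (hi _)).const_mul _
  refine h1.trans ?_
  rw [integral_const_mul]
  refine mul_le_mul_of_nonneg_left ?_ (by positivity)
  simp only [GoodMetric.polTrace]
  rw [integral_add (((hi _).fun_add (hi _)).fun_add (hi _)) (hi _),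
    integral_add ((hi _).fun_add (hi _)) (hi _), integral_add (hi _) (hi _)]
  linarith [hC (ξ + (1 : ℂ) • η) H h, hC (ξ + Complex.I • η) H h, hC (ξ + (-1 : ℂ) • η) H h,
    hC (ξ + (-Complex.I) • η) H h]

/-- Uniform `L²` bound for the first derivatives. -/
lemma exists_integral_sq_norm_mdel_le (hU : IsOpen U) {K : Set (Fin n → ℂ)} (hK : IsCompact K)
    (hKU : K ⊆ U) (c M : ℝ) (ξ : Fin n → ℂ) :
    ∃ C : ℝ, ∀ H : (Fin n → ℂ) → Matrix (Fin r) (Fin r) ℂ, GoodMetric U c M H →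
      ∀ a b, ∫ z in K, ‖mdel ξ H z a b‖ ^ 2 ≤ C := by
  obtain ⟨C, hC⟩ := exists_integral_trace_hess_le (r := r) hU hK hKU c M ξ
  -- Absolute values, because no sign of `M` or `C` is known before a metric is given.
  refine ⟨|(r * M + 1)| * |C|, fun H h a b => ?_⟩
  have hi : IntegrableOn (fun z => (hess ξ H z).trace.re) K :=
    integrableOn_of_continuousOn
      (Complex.continuous_re.comp_continuousOn (continuousOn_trace_hess hU h.smooth ξ)) hK hKU
  have h1 : ∫ z in K, ‖mdel ξ H z a b‖ ^ 2 ≤ ∫ z in K, |(r * M + 1)| * (hess ξ H z).trace.re := by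
    refine setIntegral_mono_on (integrableOn_of_continuousOn
      (((h.smooth.mwirt hU _ ξ a b).continuousOn.norm).pow 2) hK hKU) (hi.const_mul _)
      hK.measurableSet fun z hz => ?_
    refine (h.sq_norm_mdel_le (hKU hz) ξ a b).trans ?_
    exact mul_le_mul_of_nonneg_right (le_abs_self _) (h.trace_hess_nonneg (hKU hz) ξ)
  refine h1.trans ?_
  rw [integral_const_mul]
  exact mul_le_mul_of_nonneg_left ((hC H h).trans (le_abs_self C)) (abs_nonneg _)

end Bounds

/-! ### Weak compactness in `L²` -/

section WeakL2

variable {α : Type*} [MeasurableSpace α] {μ : Measure α}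

/-- Bounded sequences in a Hilbert space converge weakly along ultrafilters. -/
lemma exists_weak_limit {E : Type*} [NormedAddCommGroup E] [InnerProductSpace ℂ E]
    [CompleteSpace E] {x : ℕ → E} {C : ℝ} (hx : ∀ m, ‖x m‖ ≤ C) (𝒰 : Ultrafilter ℕ) :
    ∃ y : E, ∀ w : E, Tendsto (fun m => inner ℂ w (x m)) 𝒰 (𝓝 (inner ℂ w y)) := by
  let l : ℕ → WeakDual ℂ E := fun m => StrongDual.toWeakDual (InnerProductSpace.toDual ℂ E (x m))
  have hmem : ∀ m, l m ∈ WeakDual.toStrongDual ⁻¹'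
      Metric.closedBall (0 : StrongDual ℂ E) C := by
    intro m
    simpa [l] using hx m
  -- Banach–Alaoglu for the dual ball; the ultrafilter replaces the extraction of a subsequence.
  obtain ⟨φ, -, hφ⟩ := (WeakDual.isCompact_closedBall (0 : StrongDual ℂ E) C).ultrafilter_le_nhds
    (𝒰.map l) (by
      rw [le_principal_iff, Ultrafilter.mem_coe, Ultrafilter.mem_map]
      exact Filter.univ_mem' hmem)
  refine ⟨(InnerProductSpace.toDual ℂ E).symm (WeakDual.toStrongDual φ), fun w => ?_⟩
  have h1 : Tendsto l 𝒰 (𝓝 φ) := hφ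
  have h2 : Tendsto (fun m => l m w) 𝒰 (𝓝 (φ w)) :=
    ((WeakDual.eval_continuous w).tendsto φ).comp h1
  have h3 (m : ℕ) : inner ℂ w (x m) = conj (l m w) := by
    rw [← inner_conj_symm]
    simp [l]
  have h4 : inner ℂ w ((InnerProductSpace.toDual ℂ E).symm (WeakDual.toStrongDual φ)) =
      conj (φ w) := by
    rw [← inner_conj_symm, InnerProductSpace.toDual_symm_apply]
    rfl
  simp_rw [h3, h4]
  exact (Complex.continuous_conj.tendsto _).comp h2

/-- The conjugate turns the sesquilinear inner product into the bilinear pairing that integrates the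
product of two functions. -/
lemma inner_toLp_conj {f g : α → ℂ} (hf : MemLp (fun z => conj (f z)) 2 μ) (hg : MemLp g 2 μ) :
    inner ℂ (hf.toLp _) (hg.toLp _) = ∫ z, g z * f z ∂μ := by
  rw [L2.inner_def]
  refine integral_congr_ae ?_
  filter_upwards [hf.coeFn_toLp, hg.coeFn_toLp] with z h1 h2
  rw [h1, h2]
  simp

lemma norm_toLp_two {g : α → ℂ} (hg : MemLp g 2 μ) :
    ‖hg.toLp g‖ ^ 2 = ∫ z, ‖g z‖ ^ 2 ∂μ := by
  rw [← Complex.ofReal_inj, ← integral_complex_ofReal]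
  push_cast
  have := inner_self_eq_norm_sq_to_K (𝕜 := ℂ) (hg.toLp g)
  refine Eq.trans this.symm ?_
  rw [L2.inner_def]
  refine integral_congr_ae ?_
  filter_upwards [hg.coeFn_toLp] with z h1
  rw [h1, inner_self_eq_norm_sq_to_K]
  rfl

lemma memLp_conj {f : α → ℂ} {p : ENNReal} (hf : MemLp f p μ) :
    MemLp (fun z => conj (f z)) p μ :=
  hf.congr_norm (Complex.continuous_conj.comp_aestronglyMeasurable hf.aestronglyMeasurable)
    (ae_of_all _ fun z => by simp)

/-- Weak sequential compactness of `L²`-bounded sequences, along an ultrafilter. -/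
lemma exists_weak_limit_integral {g : ℕ → α → ℂ} (hg : ∀ m, MemLp (g m) 2 μ) {C : ℝ}
    (hC : ∀ m, ∫ z, ‖g m z‖ ^ 2 ∂μ ≤ C) (𝒰 : Ultrafilter ℕ) :
    ∃ G : α → ℂ, MemLp G 2 μ ∧ ∀ f : α → ℂ, MemLp f 2 μ →
      Tendsto (fun m => ∫ z, g m z * f z ∂μ) 𝒰 (𝓝 (∫ z, G z * f z ∂μ)) := by
  have hb (m : ℕ) : ‖(hg m).toLp (g m)‖ ≤ Real.sqrt C := by
    refine Real.le_sqrt_of_sq_le ?_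
    rw [norm_toLp_two]
    exact hC m
  obtain ⟨y, hy⟩ := exists_weak_limit hb 𝒰
  refine ⟨y, Lp.memLp y, fun f hf => ?_⟩
  have h := hy ((memLp_conj hf).toLp _)
  have hy' : (Lp.memLp y).toLp (y : α → ℂ) = y := Lp.toLp_coeFn y _
  rw [← hy'] at h
  simp only [inner_toLp_conj] at h
  exact h

/-- Products of weakly and boundedly a.e. convergent sequences. -/
lemma tendsto_integral_mul_of_weak [IsFiniteMeasure μ] {g : ℕ → α → ℂ}
    (hg : ∀ m, MemLp (g m) 2 μ) {C : ℝ} (hC : ∀ m, ∫ z, ‖g m z‖ ^ 2 ∂μ ≤ C)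
    {𝒰 : Ultrafilter ℕ} (h𝒰 : (𝒰 : Filter ℕ) ≤ atTop) {G : α → ℂ}
    (hG : ∀ f : α → ℂ, MemLp f 2 μ →
      Tendsto (fun m => ∫ z, g m z * f z ∂μ) 𝒰 (𝓝 (∫ z, G z * f z ∂μ)))
    {f : ℕ → α → ℂ} {F : α → ℂ} {B : ℝ} (hfm : ∀ m, AEStronglyMeasurable (f m) μ)
    (hfB : ∀ m, ∀ᵐ z ∂μ, ‖f m z‖ ≤ B)
    (hf : ∀ᵐ z ∂μ, Tendsto (fun m => f m z) atTop (𝓝 (F z))) :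
    Tendsto (fun m => ∫ z, g m z * f m z ∂μ) 𝒰 (𝓝 (∫ z, G z * F z ∂μ)) := by
  have hFm : AEStronglyMeasurable F μ := aestronglyMeasurable_of_tendsto_ae atTop hfm hf
  have hFB : ∀ᵐ z ∂μ, ‖F z‖ ≤ B := by
    filter_upwards [hf, ae_all_iff.2 hfB] with z h1 h2
    exact le_of_tendsto' h1.norm h2
  have hFL : MemLp F 2 μ := MemLp.of_bound hFm B hFB
  have hfL (m : ℕ) : MemLp (f m) 2 μ := MemLp.of_bound (hfm m) B (hfB m)
  have hd (m : ℕ) : MemLp (fun z => f m z - F z) 2 μ := (hfL m).sub hFL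
  have hdm (m : ℕ) : AEStronglyMeasurable (fun z => f m z - F z) μ := (hfm m).sub hFm
  have h0 : Tendsto (fun m => ∫ z, ‖f m z - F z‖ ^ 2 ∂μ) atTop (𝓝 0) := by
    have : Tendsto (fun m => ∫ z, ‖f m z - F z‖ ^ 2 ∂μ) atTop (𝓝 (∫ _, (0 : ℝ) ∂μ)) := by
      refine tendsto_integral_filter_of_dominated_convergence (fun _ => (B + B) ^ 2)
        (Eventually.of_forall fun m => (hdm m).norm.pow 2) (Eventually.of_forall fun m => ?_)
        (integrable_const _) ?_
      · filter_upwards [hfB m, hFB] with z h1 h2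
        rw [norm_pow, norm_norm]
        gcongr
        exact (norm_sub_le _ _).trans (add_le_add h1 h2)
      · filter_upwards [hf] with z hz
        have := ((hz.sub_const (F z)).norm).pow 2
        simpa using this
    simpa using this
  -- By Cauchy–Schwarz this integral is at most `√C` times the `L²` norm of `f m - F`, which tends
  -- to zero by dominated convergence.
  have hdiff : Tendsto (fun m => ∫ z, g m z * (f m z - F z) ∂μ) atTop (𝓝 0) := by
    rw [tendsto_zero_iff_norm_tendsto_zero]
    have hlim : Tendsto (fun m => Real.sqrt C * Real.sqrt (∫ z, ‖f m z - F z‖ ^ 2 ∂μ)) atTop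
        (𝓝 0) := by
      have := (Real.continuous_sqrt.tendsto 0).comp h0
      simpa using this.const_mul (Real.sqrt C)
    refine squeeze_zero (fun m => norm_nonneg _) (fun m => ?_) hlim
    rw [← inner_toLp_conj (memLp_conj (hd m)) (hg m)]
    refine (norm_inner_le_norm _ _).trans ?_
    rw [mul_comm]
    refine mul_le_mul (Real.le_sqrt_of_sq_le ?_) (Real.le_sqrt_of_sq_le ?_) (norm_nonneg _)
      (Real.sqrt_nonneg _)
    · rw [norm_toLp_two]
      exact hC m
    · rw [norm_toLp_two]
      exact le_of_eq (integral_congr_ae (ae_of_all _ fun z => by simp only [RCLike.norm_conj]))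
  have hsum := (hG F hFL).add (hdiff.mono_left h𝒰)
  rw [add_zero] at hsum
  refine hsum.congr fun m => ?_
  rw [← integral_add (f := fun z => g m z * F z) (g := fun z => g m z * (f m z - F z))
    ((hg m).integrable_mul hFL) ((hg m).integrable_mul (hd m))]
  refine integral_congr_ae (ae_of_all _ fun z => ?_)
  simp only
  ring

end WeakL2

/-! ### Weak derivatives -/

section WeakDeriv

variable {n : ℕ} {Ω : Set (Fin n → ℂ)} {j : Fin n} {f g g' : (Fin n → ℂ) → ℂ}

/-- Distributional derivatives are unique almost everywhere. -/
lemma HasWeakDz.ae_unique (hΩ : IsOpen Ω) (h : HasWeakDz Ω j f g) (h' : HasWeakDz Ω j f g') :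
    ∀ᵐ z ∂(volume.restrict Ω), g z = g' z := by
  rw [ae_restrict_iff' hΩ.measurableSet]
  have hl : LocallyIntegrableOn (fun z => g z - g' z) Ω volume :=
    h.locallyIntegrable_deriv.sub h'.locallyIntegrable_deriv
  have hz := hΩ.ae_eq_zero_of_integral_contDiff_smul_eq_zero hl fun φ hφ hc hs => ?_
  · filter_upwards [hz] with z hz hzΩ using sub_eq_zero.1 (hz hzΩ)
  have hts : tsupport (fun z => (φ z : ℂ)) ⊆ tsupport φ := by
    refine closure_mono fun z hz => ?_
    simpa using hz
  have hT : IsTest Ω (fun z => (φ z : ℂ)) :=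
    ⟨Complex.ofRealCLM.contDiff.comp hφ, hc.of_isClosed_subset (isClosed_tsupport _) hts,
      hts.trans hs⟩
  have e := (h.integral_eq _ hT).symm.trans (h'.integral_eq _ hT)
  rw [neg_inj] at e
  have hi (G : (Fin n → ℂ) → ℂ) (hG : LocallyIntegrableOn G Ω volume) :
      Integrable (fun z => G z * (φ z : ℂ)) := by
    have h1 : IntegrableOn (fun z => φ z • G z) (tsupport φ) :=
      (hG.integrableOn_compact_subset hs hc).continuousOn_smul hφ.continuous.continuousOn hc
    have h2 := (integrableOn_iff_integrable_of_support_subset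
      (f := fun z => φ z • G z) (s := tsupport φ) (μ := volume) ?_).1 h1
    · refine h2.congr (ae_of_all _ fun z => ?_)
      simp only [Complex.real_smul]
      ring
    · intro z hz
      refine subset_tsupport _ ?_
      simp only [Function.mem_support] at hz ⊢
      exact fun h0 => hz (by rw [h0, zero_smul])
  have : ∀ z, φ z • (g z - g' z) = g z * (φ z : ℂ) - g' z * (φ z : ℂ) := by
    intro z
    rw [Complex.real_smul]
    ring
  simp_rw [this]
  rw [integral_sub (hi g h.locallyIntegrable_deriv) (hi g' h'.locallyIntegrable_deriv), e, sub_self]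

end WeakDeriv

/-! ### Limits of smooth Griffiths negative metrics -/

section GoodSeq

open Matrix

variable {n r : ℕ} {U K : Set (Fin n → ℂ)} {c M : ℝ}
  {Hν : ℕ → (Fin n → ℂ) → Matrix (Fin r) (Fin r) ℂ} {H : (Fin n → ℂ) → Matrix (Fin r) (Fin r) ℂ}

/-- A uniformly bounded sequence of smooth Griffiths negative metrics on a neighbourhood `U` of the
compact set `K` that converges to `H` almost everywhere on `K`. -/
structure GoodSeq (U K : Set (Fin n → ℂ)) (c M : ℝ)
    (Hν : ℕ → (Fin n → ℂ) → Matrix (Fin r) (Fin r) ℂ)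
    (H : (Fin n → ℂ) → Matrix (Fin r) (Fin r) ℂ) : Prop where
  isOpen : IsOpen U
  isCompact : IsCompact K
  subset : K ⊆ U
  pos : 0 < c
  good : ∀ m, GoodMetric U c M (Hν m)
  tendsto : ∀ᵐ z ∂(volume.restrict K), ∀ a b, Tendsto (fun m => Hν m z a b) atTop (𝓝 (H z a b))

lemma continuous_sesq (v : Fin r → ℂ) :
    Continuous (fun A : Matrix (Fin r) (Fin r) ℂ => sesq A v v) := by
  unfold sesq
  refine continuous_finsetSum _ fun a _ => continuous_finsetSum _ fun b _ => ?_
  exact (continuous_const.mul (continuous_id.matrix_elem a b)).mul continuous_const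

lemma tendsto_matrix {A : ℕ → Matrix (Fin r) (Fin r) ℂ} {B : Matrix (Fin r) (Fin r) ℂ}
    (h : ∀ a b, Tendsto (fun m => A m a b) atTop (𝓝 (B a b))) : Tendsto A atTop (𝓝 B) :=
  tendsto_pi_nhds.2 fun a => tendsto_pi_nhds.2 fun b => h a b

lemma Coercive.of_tendsto {A : ℕ → Matrix (Fin r) (Fin r) ℂ} {B : Matrix (Fin r) (Fin r) ℂ}
    (h : Tendsto A atTop (𝓝 B)) (hA : ∀ m, Coercive c (A m)) : Coercive c B := fun v =>
  ge_of_tendsto' ((Complex.continuous_re.tendsto _).comp (((continuous_sesq v).tendsto B).comp h))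
    fun m => hA m v

lemma tendsto_inv {A : ℕ → Matrix (Fin r) (Fin r) ℂ} {B : Matrix (Fin r) (Fin r) ℂ}
    (h : Tendsto A atTop (𝓝 B)) (hB : IsUnit B.det) : Tendsto (fun m => (A m)⁻¹) atTop (𝓝 B⁻¹) := by
  simp only [Matrix.inv_def, Ring.inverse_eq_inv']
  have h1 : Tendsto (fun m => (A m).det) atTop (𝓝 B.det) :=
    ((continuous_id.matrix_det).tendsto B).comp h
  have h2 : Tendsto (fun m => (A m).adjugate) atTop (𝓝 B.adjugate) :=
    ((continuous_id.matrix_adjugate).tendsto B).comp h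
  exact (h1.inv₀ hB.ne_zero).smul h2

namespace GoodSeq

lemma isFiniteMeasure (h : GoodSeq U K c M Hν H) :
    IsFiniteMeasure ((volume : Measure (Fin n → ℂ)).restrict K) :=
  isFiniteMeasure_restrict.2 h.isCompact.measure_lt_top.ne

lemma aestronglyMeasurable_of_continuousOn (h : GoodSeq U K c M Hν H) {f : (Fin n → ℂ) → ℂ}
    (hf : ContinuousOn f U) : AEStronglyMeasurable f (volume.restrict K) :=
  (hf.mono h.subset).aestronglyMeasurable h.isCompact.measurableSet

lemma coercive_ae (h : GoodSeq U K c M Hν H) :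
    ∀ᵐ z ∂(volume.restrict K), Coercive c (H z) := by
  filter_upwards [h.tendsto, ae_restrict_mem h.isCompact.measurableSet] with z hz hzK
  exact Coercive.of_tendsto (tendsto_matrix hz) fun m => (h.good m).coercive z (h.subset hzK)

lemma tendsto_inv_ae (h : GoodSeq U K c M Hν H) :
    ∀ᵐ z ∂(volume.restrict K), ∀ a b,
      Tendsto (fun m => (Hν m z)⁻¹ a b) atTop (𝓝 ((H z)⁻¹ a b)) := by
  filter_upwards [h.tendsto, h.coercive_ae] with z hz hc a b
  exact ((continuous_id.matrix_elem a b).tendsto _).comp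
    (tendsto_inv (tendsto_matrix hz) (hc.isUnit_det h.pos))

lemma aestronglyMeasurable_inv (h : GoodSeq U K c M Hν H) (a b : Fin r) :
    AEStronglyMeasurable (fun z => (H z)⁻¹ a b) (volume.restrict K) := by
  refine aestronglyMeasurable_of_tendsto_ae atTop (f := fun m z => (Hν m z)⁻¹ a b)
    (fun m => h.aestronglyMeasurable_of_continuousOn
      ((h.good m).inv_smooth h.pos a b).continuousOn) ?_
  filter_upwards [h.tendsto_inv_ae] with z hz using hz a b

lemma norm_inv_ae (h : GoodSeq U K c M Hν H) :
    ∀ᵐ z ∂(volume.restrict K), ∀ a b, ‖(H z)⁻¹ a b‖ ≤ c⁻¹ := by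
  filter_upwards [h.coercive_ae] with z hc a b using hc.norm_inv_apply_le h.pos a b

lemma norm_ae (h : GoodSeq U K c M Hν H) :
    ∀ᵐ z ∂(volume.restrict K), ∀ a b, ‖H z a b‖ ≤ M := by
  filter_upwards [h.tendsto, ae_restrict_mem h.isCompact.measurableSet] with z hz hzK a b
  exact le_of_tendsto' (hz a b).norm fun m => (h.good m).bound z (h.subset hzK) a b

lemma memLp_of_continuousOn (h : GoodSeq U K c M Hν H) {f : (Fin n → ℂ) → ℂ}
    (hf : ContinuousOn f U) : MemLp f 2 (volume.restrict K) := by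
  have := h.isFiniteMeasure
  obtain ⟨B, hB⟩ := h.isCompact.exists_bound_of_continuousOn (hf.mono h.subset)
  refine MemLp.of_bound (h.aestronglyMeasurable_of_continuousOn hf) B ?_
  filter_upwards [ae_restrict_mem h.isCompact.measurableSet] with z hz using hB z hz

lemma integrableOn (h : GoodSeq U K c M Hν H) (a b : Fin r) :
    IntegrableOn (fun z => H z a b) K := by
  have := h.isFiniteMeasure
  have hm : AEStronglyMeasurable (fun z => H z a b) (volume.restrict K) := by
    refine aestronglyMeasurable_of_tendsto_ae atTop (f := fun m z => Hν m z a b)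
      (fun m => h.aestronglyMeasurable_of_continuousOn ((h.good m).smooth a b).continuousOn) ?_
    filter_upwards [h.tendsto] with z hz using hz a b
  refine Integrable.of_bound hm M ?_
  filter_upwards [h.norm_ae] with z hz using hz a b

lemma setIntegral_test {φ f : (Fin n → ℂ) → ℂ} (hφ : tsupport φ ⊆ K) :
    ∫ z, f z * φ z = ∫ z in K, f z * φ z := by
  refine (setIntegral_eq_integral_of_forall_compl_eq_zero fun z hz => ?_).symm
  have : φ z = 0 := by
    by_contra hne
    exact hz (hφ (subset_tsupport _ hne))
  rw [this, mul_zero]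

/-- Weak limits, along an ultrafilter, of the derivatives of the sequence are weak derivatives of
the limit. -/
lemma exists_weak_deriv (h : GoodSeq U K c M Hν H) {𝒰 : Ultrafilter ℕ}
    (h𝒰 : (𝒰 : Filter ℕ) ≤ atTop) (j : Fin n) (a b : Fin r) :
    ∃ P : (Fin n → ℂ) → ℂ, MemLp P 2 (volume.restrict K) ∧
      HasWeakDz (interior K) j (fun z => H z a b) P ∧
      ∀ f : (Fin n → ℂ) → ℂ, MemLp f 2 (volume.restrict K) →
        Tendsto (fun m => ∫ z in K, mdel (Pi.single j 1) (Hν m) z a b * f z) 𝒰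
          (𝓝 (∫ z in K, P z * f z)) := by
  have := h.isFiniteMeasure
  obtain ⟨C, hC⟩ := exists_integral_sq_norm_mdel_le (r := r) h.isOpen h.isCompact h.subset c M
    (Pi.single j 1)
  have hsm (m : ℕ) := (h.good m).smooth.mwirt h.isOpen (-Complex.I) (Pi.single j 1) a b
  obtain ⟨P, hP, hPlim⟩ := exists_weak_limit_integral
    (fun m => h.memLp_of_continuousOn (hsm m).continuousOn) (fun m => hC _ (h.good m) a b) 𝒰
  refine ⟨P, hP, ⟨?_, ?_, fun φ hφ => ?_⟩, hPlim⟩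
  · exact ((h.integrableOn a b).mono_set interior_subset).locallyIntegrableOn
  · have : IntegrableOn P K := hP.integrable (by norm_num)
    exact (this.mono_set interior_subset).locallyIntegrableOn
  · have hφK : tsupport φ ⊆ K := hφ.tsupport_subset.trans interior_subset
    have hφU : IsTest U φ := ⟨hφ.contDiff, hφ.hasCompactSupport, hφK.trans h.subset⟩
    have hdφ : IsTest U (del (Pi.single j 1) φ) := hφU.wirt
    have h1 : Tendsto (fun m => ∫ z in K, Hν m z a b * del (Pi.single j 1) φ z) atTop
        (𝓝 (∫ z in K, H z a b * del (Pi.single j 1) φ z)) := by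
      obtain ⟨B, hB⟩ := hdφ.contDiff.continuous.bounded_above_of_compact_support
        hdφ.hasCompactSupport
      refine tendsto_integral_filter_of_dominated_convergence (fun _ => M * B)
        (Eventually.of_forall fun m => h.aestronglyMeasurable_of_continuousOn
          (((h.good m).smooth a b).continuousOn.mul hdφ.contDiff.continuous.continuousOn))
        (Eventually.of_forall fun m => ?_) (integrable_const _) ?_
      · filter_upwards [ae_restrict_mem h.isCompact.measurableSet] with z hz
        rw [norm_mul]
        have hb := (h.good m).bound z (h.subset hz) a b
        exact mul_le_mul hb (hB z) (norm_nonneg _) ((norm_nonneg _).trans hb)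
      · filter_upwards [h.tendsto] with z hz using (hz a b).mul_const _
    have h2 (m : ℕ) : ∫ z in K, Hν m z a b * del (Pi.single j 1) φ z =
        -∫ z in K, mdel (Pi.single j 1) (Hν m) z a b * φ z := by
      rw [← setIntegral_test (tsupport_wirt_subset.trans hφK), ← setIntegral_test hφK]
      exact integral_mul_wirt h.isOpen ((h.good m).smooth a b) hφU
    have h3 := hPlim φ (h.memLp_of_continuousOn hφ.contDiff.continuous.continuousOn)
    simp_rw [h2] at h1
    -- The left sides of the integration by parts converge by dominated convergence, the right sides
    -- weakly along the ultrafilter; equating the limits identifies `P` as the weak derivative.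
    have h4 := tendsto_nhds_unique (h1.mono_left h𝒰) h3.neg
    rw [dz_eq_del, setIntegral_test (tsupport_wirt_subset.trans hφK), h4, setIntegral_test hφK]

lemma exists_weak_deriv_interior (h : GoodSeq U K c M Hν H) (j : Fin n) :
    ∃ P : (Fin n → ℂ) → Matrix (Fin r) (Fin r) ℂ, ∀ a b,
      MemLp (fun z => P z a b) 2 (volume.restrict K) ∧
      HasWeakDz (interior K) j (fun z => H z a b) (fun z => P z a b) := by
  choose P hP using fun a b => h.exists_weak_deriv
    (𝒰 := Ultrafilter.of atTop) (Ultrafilter.of_le atTop) j a b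
  exact ⟨fun z => Matrix.of fun a b => P a b z, fun a b => ⟨(hP a b).1, (hP a b).2.1⟩⟩

/-- Weak convergence of the connection forms. -/
lemma tendsto_connM (h : GoodSeq U K c M Hν H) {j : Fin n}
    {P : (Fin n → ℂ) → Matrix (Fin r) (Fin r) ℂ}
    (hP : ∀ a b, HasWeakDz (interior K) j (fun z => H z a b) (fun z => P z a b))
    {φ : (Fin n → ℂ) → ℂ} (hφ : IsTest (interior K) φ) (a b : Fin r) :
    Tendsto (fun m => ∫ z, connM (Hν m) (Pi.single j 1) z a b * φ z) atTop
      (𝓝 (∫ z, ((H z)⁻¹ * P z) a b * φ z)) := by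
  have hφK : tsupport φ ⊆ K := hφ.tsupport_subset.trans interior_subset
  have := h.isFiniteMeasure
  -- The claimed limit contains the given `P` and not a weak limit depending on the ultrafilter, so
  -- convergence along every ultrafilter gives convergence of the whole sequence.
  rw [tendsto_iff_ultrafilter]
  intro 𝒰 h𝒰
  choose Q hQL hQ hQlim using fun k => h.exists_weak_deriv h𝒰 j k b
  obtain ⟨C, hC⟩ := exists_integral_sq_norm_mdel_le (r := r) h.isOpen h.isCompact h.subset c M
    (Pi.single j 1)
  have hsm (m : ℕ) (k : Fin r) :=
    (h.good m).smooth.mwirt h.isOpen (-Complex.I) (Pi.single j 1) k b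
  obtain ⟨B, hB⟩ := hφ.contDiff.continuous.bounded_above_of_compact_support hφ.hasCompactSupport
  have hB0 : 0 ≤ B := (norm_nonneg _).trans (hB 0)
  have hfm (m : ℕ) (k : Fin r) : ContinuousOn (fun z => (Hν m z)⁻¹ a k * φ z) U :=
    ((h.good m).inv_smooth h.pos a k).continuousOn.mul hφ.contDiff.continuous.continuousOn
  have key (k : Fin r) : Tendsto
      (fun m => ∫ z in K, mdel (Pi.single j 1) (Hν m) z k b * ((Hν m z)⁻¹ a k * φ z)) 𝒰
      (𝓝 (∫ z in K, Q k z * ((H z)⁻¹ a k * φ z))) := by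
    refine tendsto_integral_mul_of_weak (C := C) (B := c⁻¹ * B)
      (fun m => h.memLp_of_continuousOn (hsm m k).continuousOn) (fun m => hC _ (h.good m) k b) h𝒰
      (hQlim k) (fun m => h.aestronglyMeasurable_of_continuousOn (hfm m k)) (fun m => ?_) ?_
    · filter_upwards [ae_restrict_mem h.isCompact.measurableSet] with z hz
      rw [norm_mul]
      exact mul_le_mul (((h.good m).coercive z (h.subset hz)).norm_inv_apply_le h.pos a k) (hB z)
        (norm_nonneg _) (inv_nonneg.2 h.pos.le)
    · filter_upwards [h.tendsto_inv_ae] with z hz using (hz a k).mul_const _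
  have hsum := tendsto_finsetSum Finset.univ fun k _ => key k
  have e1 (m : ℕ) : ∫ z, connM (Hν m) (Pi.single j 1) z a b * φ z =
      ∑ k, ∫ z in K, mdel (Pi.single j 1) (Hν m) z k b * ((Hν m z)⁻¹ a k * φ z) := by
    rw [setIntegral_test hφK, ← integral_finsetSum]
    · refine integral_congr_ae (ae_of_all _ fun z => ?_)
      simp only [connM, Matrix.mul_apply, Finset.sum_mul]
      exact Finset.sum_congr rfl fun k _ => by ring
    · intro k _
      exact integrableOn_of_continuousOn ((hsm m k).continuousOn.mul (hfm m k)) h.isCompact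
        h.subset
  have e2 : ∫ z, ((H z)⁻¹ * P z) a b * φ z =
      ∑ k, ∫ z in K, Q k z * ((H z)⁻¹ a k * φ z) := by
    have hFL (k : Fin r) : MemLp (fun z => (H z)⁻¹ a k * φ z) 2 (volume.restrict K) := by
      refine MemLp.of_bound ((h.aestronglyMeasurable_inv a k).mul
        hφ.contDiff.continuous.aestronglyMeasurable) (c⁻¹ * B) ?_
      filter_upwards [h.norm_inv_ae] with z hz
      rw [norm_mul]
      exact mul_le_mul (hz a k) (hB z) (norm_nonneg _) (inv_nonneg.2 h.pos.le)
    have hQI (k : Fin r) : IntegrableOn (fun z => Q k z * ((H z)⁻¹ a k * φ z)) K :=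
      (hQL k).integrable_mul (hFL k)
    rw [setIntegral_test hφK, ← integral_finsetSum _ fun k _ => hQI k]
    -- Weak limits along any ultrafilter are weak derivatives of `H`; uniqueness identifies them
    -- with `P` on the interior of `K`, which contains the support of `φ`.
    have hQP : ∀ᵐ z ∂(volume.restrict K), ∀ k, z ∈ interior K → Q k z = P z k b := by
      have h1 := fun k => (hQ k).ae_unique isOpen_interior (hP k b)
      simp only [ae_restrict_iff' isOpen_interior.measurableSet] at h1
      rw [ae_restrict_iff' h.isCompact.measurableSet]
      filter_upwards [ae_all_iff.2 h1] with z hz _ k hzk using hz k hzk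
    refine integral_congr_ae ?_
    filter_upwards [hQP] with z hz
    simp only [Matrix.mul_apply, Finset.sum_mul]
    refine Finset.sum_congr rfl fun k _ => ?_
    by_cases hzi : z ∈ interior K
    · rw [hz k hzi]; ring
    · have : φ z = 0 := by
        by_contra hne
        exact hzi (hφ.tsupport_subset (subset_tsupport _ hne))
      rw [this]; ring
  simp_rw [e1, e2]
  exact hsum

/-- Distributional convergence of the curvatures. -/
lemma tendsto_curvM (h : GoodSeq U K c M Hν H) {j k : Fin n}
    {P : (Fin n → ℂ) → Matrix (Fin r) (Fin r) ℂ}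
    (hP : ∀ a b, HasWeakDz (interior K) j (fun z => H z a b) (fun z => P z a b))
    {φ : (Fin n → ℂ) → ℂ} (hφ : IsTest (interior K) φ) (a b : Fin r) :
    Tendsto (fun m => ∫ z, curvM (Hν m) (Pi.single j 1) (Pi.single k 1) z a b * φ z) atTop
      (𝓝 (∫ z, ((H z)⁻¹ * P z) a b * dzbar k φ z)) := by
  have hφU : IsTest U φ :=
    ⟨hφ.contDiff, hφ.hasCompactSupport, hφ.tsupport_subset.trans
      (interior_subset.trans h.subset)⟩
  have h1 := h.tendsto_connM hP (hφ.wirt (c := Complex.I) (ξ := Pi.single k 1)) a b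
  rw [dzbar_eq_delbar]
  refine h1.congr fun m => ?_
  rw [integral_mul_wirt h.isOpen ((h.good m).connM_smooth h.isOpen h.pos (Pi.single j 1) a b) hφU,
    ← integral_neg]
  refine integral_congr_ae (ae_of_all _ fun z => ?_)
  simp only [curvM, mdelbar, mwirt, Matrix.neg_apply, Matrix.of_apply, neg_mul]

lemma norm_integral_curvM_le (h : GoodSeq U K c M Hν H) (m : ℕ) (ξ η : Fin n → ℂ)
    {φ : (Fin n → ℂ) → ℂ} {s : ℝ} (hφK : tsupport φ ⊆ K)
    (hs : ∀ z, ‖φ z‖ ≤ s) (a b : Fin r) :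
    ‖∫ z, curvM (Hν m) ξ η z a b * φ z‖ ≤ (∫ z in K, ‖curvM (Hν m) ξ η z a b‖) * s := by
  rw [setIntegral_test hφK, ← integral_mul_const]
  refine norm_integral_le_of_norm_le ((integrableOn_of_continuousOn
    ((h.good m).curvM_smooth h.isOpen h.pos ξ η a b).continuousOn h.isCompact
      h.subset).norm.mul_const s) (ae_of_all _ fun z => ?_)
  rw [norm_mul]
  exact mul_le_mul_of_nonneg_left (hs z) (norm_nonneg _)

/-- The distribution `∂̄θ` is of order zero. -/
lemma exists_bound (h : GoodSeq U K c M Hν H) (j k : Fin n) :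
    ∃ C : ℝ, ∀ (P : (Fin n → ℂ) → Matrix (Fin r) (Fin r) ℂ),
      (∀ a b, HasWeakDz (interior K) j (fun z => H z a b) (fun z => P z a b)) →
      ∀ φ : (Fin n → ℂ) → ℂ, IsTest (interior K) φ → ∀ s : ℝ, (∀ z, ‖φ z‖ ≤ s) → ∀ a b,
        ‖∫ z, ((H z)⁻¹ * P z) a b * dzbar k φ z‖ ≤ C * s := by
  obtain ⟨C, hC⟩ := exists_integral_norm_curvM_le (r := r) h.isOpen h.isCompact h.subset h.pos M
    (Pi.single j 1) (Pi.single k 1)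
  refine ⟨C, fun P hP φ hφ s hs a b => ?_⟩
  refine le_of_tendsto' (h.tendsto_curvM (k := k) hP hφ a b).norm fun m => ?_
  refine (h.norm_integral_curvM_le m _ _
    (hφ.tsupport_subset.trans interior_subset) hs a b).trans ?_
  exact mul_le_mul_of_nonneg_right (hC _ (h.good m) a b) ((norm_nonneg _).trans (hs 0))

end GoodSeq

end GoodSeq

/-! ### Regularization -/

section Regularization

open Matrix
open scoped Convolution
open Real (circleAverage)

variable {n r : ℕ}

/-- A hermitian metric on the trivial bundle over `Ω` that is locally bounded above and below, and
negatively curved in the sense of Griffiths (tested with affine sections). -/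
structure LocMetric (Ω : Set (Fin n → ℂ)) (H : (Fin n → ℂ) → Matrix (Fin r) (Fin r) ℂ) :
    Prop where
  isOpen : IsOpen Ω
  hermitian : ∀ z ∈ Ω, (H z).IsHermitian
  measurable : ∀ a b, Measurable (Ω.indicator fun z => H z a b)
  bound : ∀ K ⊆ Ω, IsCompact K → ∃ M : ℝ, ∀ z ∈ K, ∀ a b, ‖H z a b‖ ≤ M
  coercive : ∀ K ⊆ Ω, IsCompact K → ∃ c : ℝ, 0 < c ∧ ∀ z ∈ K, Coercive c (H z)
  affPsh : AffPsh Ω H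

/-- A mollifier with support in the ball of radius `δ`. -/
structure IsMollifier (δ : ℝ) (ρ : (Fin n → ℂ) → ℝ) : Prop where
  continuous : Continuous ρ
  integrable : Integrable ρ
  nonneg : ∀ t, 0 ≤ ρ t
  integral_eq_one : ∫ t, ρ t = 1
  norm_lt : ∀ t, ρ t ≠ 0 → ‖t‖ < δ

/-- The entrywise convolution of `H` with `ρ`. -/
def mollify (ρ : (Fin n → ℂ) → ℝ) (H : (Fin n → ℂ) → Matrix (Fin r) (Fin r) ℂ)
    (z : Fin n → ℂ) : Matrix (Fin r) (Fin r) ℂ :=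
  Matrix.of fun a b => ∫ t, ρ t • H (z - t) a b

/-! ### Properties of a metric that survive convolution. -/

section Mollify

variable {ρ : (Fin n → ℂ) → ℝ} {δ M : ℝ} {H : (Fin n → ℂ) → Matrix (Fin r) (Fin r) ℂ}

lemma integrable_mollify (hρ : IsMollifier δ ρ) {f : (Fin n → ℂ) → ℂ} (hf : Measurable f)
    (hM : ∀ z, ‖f z‖ ≤ M) (z : Fin n → ℂ) : Integrable (fun t => ρ t • f (z - t)) := by
  refine (hρ.integrable.mul_const M).mono'
    (hρ.continuous.aestronglyMeasurable.smul
      (hf.comp (measurable_const.sub measurable_id)).aestronglyMeasurable)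
    (ae_of_all _ fun t => ?_)
  rw [norm_smul, Real.norm_of_nonneg (hρ.nonneg t)]
  exact mul_le_mul_of_nonneg_left (hM _) (hρ.nonneg t)

lemma measurable_sesq {α : Type*} [MeasurableSpace α] {A : α → Matrix (Fin r) (Fin r) ℂ}
    (hA : ∀ a b, Measurable fun x => A x a b) {v w : α → Fin r → ℂ} (hv : Measurable v)
    (hw : Measurable w) : Measurable (fun x => sesq (A x) (v x) (w x)) := by
  unfold sesq
  refine Finset.measurable_fun_sum _ fun a _ => Finset.measurable_fun_sum _ fun b _ => ?_
  exact ((Complex.continuous_conj.measurable.comp ((measurable_pi_apply a).comp hv)).mul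
    (hA a b)).mul ((measurable_pi_apply b).comp hw)

lemma sesq_mollify (hρ : IsMollifier δ ρ) (hH : ∀ a b, Measurable fun z => H z a b)
    (hM : ∀ z a b, ‖H z a b‖ ≤ M) (z : Fin n → ℂ) (v w : Fin r → ℂ) :
    Integrable (fun t => ρ t • sesq (H (z - t)) v w) ∧
      sesq (mollify ρ H z) v w = ∫ t, ρ t • sesq (H (z - t)) v w := by
  have hi (a b : Fin r) := integrable_mollify hρ (hH a b) (fun z => hM z a b) z
  have e : (fun t => ρ t • sesq (H (z - t)) v w) =
      fun t => ∑ a, ∑ b, (conj (v a) * w b) * (ρ t • H (z - t) a b) := by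
    funext t
    simp only [sesq, Finset.smul_sum, Complex.real_smul]
    exact Finset.sum_congr rfl fun a _ => Finset.sum_congr rfl fun b _ => by ring
  have hi2 (a b : Fin r) := (hi a b).const_mul (conj (v a) * w b)
  rw [e]
  refine ⟨integrable_finsetSum _ fun a _ => integrable_finsetSum _ fun b _ => hi2 a b, ?_⟩
  rw [integral_finsetSum _ fun a _ => integrable_finsetSum _ fun b _ => hi2 a b]
  simp only [sesq]
  refine Finset.sum_congr rfl fun a _ => ?_
  rw [integral_finsetSum _ fun b _ => hi2 a b]
  refine Finset.sum_congr rfl fun b _ => ?_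
  rw [integral_const_mul]
  simp only [mollify, Matrix.of_apply]
  ring

lemma re_sesq_mollify (hρ : IsMollifier δ ρ) (hH : ∀ a b, Measurable fun z => H z a b)
    (hM : ∀ z a b, ‖H z a b‖ ≤ M) (z : Fin n → ℂ) (v : Fin r → ℂ) :
    Integrable (fun t => ρ t * (sesq (H (z - t)) v v).re) ∧
      (sesq (mollify ρ H z) v v).re = ∫ t, ρ t * (sesq (H (z - t)) v v).re := by
  obtain ⟨h1, h2⟩ := sesq_mollify hρ hH hM z v v
  have e (t : Fin n → ℂ) : (ρ t • sesq (H (z - t)) v v).re = ρ t * (sesq (H (z - t)) v v).re := by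
    rw [Complex.real_smul, Complex.re_ofReal_mul]
  have h3 := h1.re
  have h4 : ∫ t, (ρ t • sesq (H (z - t)) v v).re = (∫ t, ρ t • sesq (H (z - t)) v v).re :=
    integral_re h1
  simp only [e] at h4
  refine ⟨?_, by rw [h2, h4]⟩
  refine h3.congr (ae_of_all _ fun t => ?_)
  exact e t

lemma norm_mollify_le (hρ : IsMollifier δ ρ) (hM : ∀ z a b, ‖H z a b‖ ≤ M) (z : Fin n → ℂ)
    (a b : Fin r) : ‖mollify ρ H z a b‖ ≤ M := by
  have : ‖∫ t, ρ t • H (z - t) a b‖ ≤ ∫ t, ρ t * M := by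
    refine norm_integral_le_of_norm_le (hρ.integrable.mul_const M) (ae_of_all _ fun t => ?_)
    rw [norm_smul, Real.norm_of_nonneg (hρ.nonneg t)]
    exact mul_le_mul_of_nonneg_left (hM _ _ _) (hρ.nonneg t)
  rwa [integral_mul_const, hρ.integral_eq_one, one_mul] at this

lemma mollify_isHermitian (hρ : IsMollifier δ ρ) {z : Fin n → ℂ}
    (hH : ∀ t, ‖t‖ < δ → (H (z - t)).IsHermitian) : (mollify ρ H z).IsHermitian := by
  ext a b
  simp only [mollify, Matrix.conjTranspose_apply, Matrix.of_apply, RCLike.star_def]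
  rw [← integral_conj]
  refine integral_congr_ae (ae_of_all _ fun t => ?_)
  by_cases ht : ρ t = 0
  · simp [ht]
  · simp only [Complex.real_smul, map_mul, Complex.conj_ofReal]
    rw [← (hH t (hρ.norm_lt t ht)).apply a b]
    rfl

/-- The mollification is an average of matrices `≥ c`, and this condition is convex. -/
lemma mollify_coercive (hρ : IsMollifier δ ρ) (hH : ∀ a b, Measurable fun z => H z a b)
    (hM : ∀ z a b, ‖H z a b‖ ≤ M) {z : Fin n → ℂ} {c : ℝ}
    (hc : ∀ t, ‖t‖ < δ → Coercive c (H (z - t))) : Coercive c (mollify ρ H z) := by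
  intro v
  obtain ⟨h1, h2⟩ := re_sesq_mollify hρ hH hM z v
  have e : c * normSqVec v = ∫ t, ρ t * (c * normSqVec v) := by
    rw [integral_mul_const, hρ.integral_eq_one, one_mul]
  rw [h2, e]
  refine integral_mono (hρ.integrable.mul_const _) h1 fun t => ?_
  by_cases ht : ρ t = 0
  · simp [ht]
  · exact mul_le_mul_of_nonneg_left (hc t (hρ.norm_lt t ht) v) (hρ.nonneg t)

lemma continuous_affSec (v w : Fin r → ℂ) (L : (Fin n → ℂ) →L[ℂ] ℂ) :
    Continuous (affSec v w L) :=
  continuous_pi fun _ => continuous_const.add (L.continuous.mul continuous_const)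

/-- Convolution preserves the sub-mean value property. -/
lemma mollify_affPsh (hρ : IsMollifier δ ρ) (hH : ∀ a b, Measurable fun z => H z a b)
    (hM : ∀ z a b, ‖H z a b‖ ≤ M) {U Ω : Set (Fin n → ℂ)} (hpsh : AffPsh Ω H)
    (hUΩ : ∀ z ∈ U, ∀ t, ‖t‖ < δ → z - t ∈ Ω) : AffPsh U (mollify ρ H) := by
  intro v w L a b hab
  set u := affSec v w L with hu
  -- Seen from the translated point `z - t`, the section is again affine, with constant term `v +
  -- L(t) w`. So each translate of `H` satisfies the inequality for the same `u`.
  have hu' (t z : Fin n → ℂ) : u z = affSec (fun i => v i + L t * w i) w L (z - t) := by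
    funext i
    simp only [hu, affSec, map_sub]
    ring
  obtain ⟨i1, e1⟩ := re_sesq_mollify hρ hH hM a (u a)
  set p : ℝ → Fin n → ℂ := fun θ => a + circleMap 0 1 θ • b with hp
  have hpc : Continuous p := continuous_const.add
    ((continuous_circleMap 0 1).smul continuous_const)
  have huc : Continuous u := continuous_affSec v w L
  obtain ⟨B, hB⟩ : ∃ B : ℝ, ∀ θ, normSqVec (u (p θ)) ≤ B := by
    have hcont : ContinuousOn (fun ζ : ℂ => normSqVec (u (a + ζ • b))) (Metric.sphere 0 1) := by
      unfold normSqVec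
      have (i : Fin r) : Continuous (fun ζ : ℂ => u (a + ζ • b) i) :=
        (continuous_apply i).comp (huc.comp (by fun_prop))
      fun_prop
    obtain ⟨B, hB⟩ := (isCompact_sphere (0 : ℂ) 1).exists_bound_of_continuousOn hcont
    refine ⟨B, fun θ => (le_abs_self _).trans ?_⟩
    exact hB (circleMap 0 1 θ) (circleMap_mem_sphere 0 zero_le_one θ)
  set G : (Fin n → ℂ) → ℝ → ℝ := fun t θ => ρ t * (sesq (H (p θ - t)) (u (p θ)) (u (p θ))).re
    with hG
  have hM0 : 0 ≤ r * M := by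
    rcases Nat.eq_zero_or_pos r with hr | hr
    · simp [hr]
    · exact mul_nonneg (by positivity) ((norm_nonneg _).trans (hM 0 ⟨0, hr⟩ ⟨0, hr⟩))
  have hGm : Measurable (Function.uncurry G) := by
    have hm2 : Measurable fun q : (Fin n → ℂ) × ℝ => p q.2 := hpc.measurable.comp measurable_snd
    refine (hρ.continuous.measurable.comp measurable_fst).mul
      (Complex.continuous_re.measurable.comp ?_)
    exact measurable_sesq (A := fun q : (Fin n → ℂ) × ℝ => H (p q.2 - q.1))
      (fun i j => (hH i j).comp (hm2.sub measurable_fst)) (huc.measurable.comp hm2)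
      (huc.measurable.comp hm2)
  -- Global boundedness of `H` and boundedness of `u` on the circle justify exchanging the average
  -- over the circle with the convolution integral.
  have hGi : Integrable (Function.uncurry G)
      (volume.prod (volume.restrict (Ioc 0 (2 * Real.pi)))) := by
    have hb : Integrable (fun q : (Fin n → ℂ) × ℝ => (ρ q.1 * (r * M * B)) * 1)
        (volume.prod (volume.restrict (Ioc 0 (2 * Real.pi)))) :=
      (hρ.integrable.mul_const (r * M * B)).mul_prod (integrable_const (1 : ℝ))
    refine hb.mono' hGm.aestronglyMeasurable (ae_of_all _ fun q => ?_)
    simp only [Function.uncurry, hG, mul_one, norm_mul, Real.norm_of_nonneg (hρ.nonneg _)]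
    refine mul_le_mul_of_nonneg_left ?_ (hρ.nonneg _)
    refine (Complex.abs_re_le_norm _).trans ((norm_sesq_le (hM _) _).trans ?_)
    exact mul_le_mul_of_nonneg_left (hB _) hM0
  have hpi : (0 : ℝ) ≤ 2 * Real.pi := by positivity
  have hstep : ∀ t, ρ t * (sesq (H (a - t)) (u a) (u a)).re ≤
      (2 * Real.pi)⁻¹ * ∫ θ in Ioc 0 (2 * Real.pi), G t θ := by
    intro t
    by_cases ht : ρ t = 0
    · simp [hG, ht]
    have htδ := hρ.norm_lt t ht
    have h1 := hpsh (fun i => v i + L t * w i) w L (a - t) b (fun ζ hζ => by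
      have := hUΩ _ (hab ζ hζ) t htδ
      rwa [add_sub_right_comm] at this)
    have e2 (ζ : ℂ) : a - t + ζ • b = a + ζ • b - t := by abel
    simp only [e2, ← hu'] at h1
    rw [Real.circleAverage_def, intervalIntegral.integral_of_le hpi, smul_eq_mul] at h1
    have h2 := mul_le_mul_of_nonneg_left h1 (hρ.nonneg t)
    refine h2.trans (le_of_eq ?_)
    simp only [hG, hp]
    rw [integral_const_mul]
    ring
  have hfin : (sesq (mollify ρ H a) (u a) (u a)).re ≤
      (2 * Real.pi)⁻¹ * ∫ θ in Ioc 0 (2 * Real.pi), ∫ t, G t θ := by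
    rw [e1, ← integral_integral_swap hGi, ← integral_const_mul]
    exact integral_mono i1 (hGi.integral_prod_left.const_mul _) hstep
  rw [Real.circleAverage_def, intervalIntegral.integral_of_le hpi, smul_eq_mul]
  refine hfin.trans (le_of_eq ?_)
  congr 1
  refine integral_congr_ae (ae_of_all _ fun θ => ?_)
  exact (re_sesq_mollify hρ hH hM (p θ) (u (p θ))).2.symm

end Mollify

lemma ContDiffBump.isMollifier {δ : ℝ} (φ : ContDiffBump (0 : Fin n → ℂ)) (hφ : φ.rOut ≤ δ) :
    IsMollifier δ (φ.normed volume) where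
  continuous := φ.continuous_normed
  integrable := φ.continuous_normed.integrable_of_hasCompactSupport φ.hasCompactSupport_normed
  nonneg := φ.nonneg_normed
  integral_eq_one := φ.integral_normed
  norm_lt t ht := by
    have : t ∈ Function.support (φ.normed volume) := ht
    rw [φ.support_normed_eq, mem_ball_zero_iff] at this
    exact this.trans_le hφ

/-- Bump functions with radii tending to zero. -/
def shrinkingBump {δ : ℝ} (hδ : 0 < δ) (m : ℕ) : ContDiffBump (0 : Fin n → ℂ) where
  rIn := δ / (2 * (m + 1))
  rOut := δ / (m + 1)
  rIn_pos := by positivity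
  rIn_lt_rOut := by
    apply div_lt_div_of_pos_left hδ (by positivity)
    have : (0 : ℝ) < m + 1 := by positivity
    linarith

lemma shrinkingBump_rOut_le {δ : ℝ} (hδ : 0 < δ) (m : ℕ) :
    (shrinkingBump (n := n) hδ m).rOut ≤ δ := by
  refine div_le_self hδ.le ?_
  have : (0 : ℝ) ≤ m := by positivity
  linarith

lemma tendsto_shrinkingBump_rOut {δ : ℝ} (hδ : 0 < δ) :
    Tendsto (fun m => (shrinkingBump (n := n) hδ m).rOut) atTop (𝓝 0) := by
  have := (tendsto_one_div_add_atTop_nhds_zero_nat (𝕜 := ℝ)).const_mul δ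
  simpa [shrinkingBump, div_eq_mul_inv] using this

/-- Regularization of a singular metric near a compact set. -/
lemma LocMetric.exists_goodSeq {Ω : Set (Fin n → ℂ)}
    {H : (Fin n → ℂ) → Matrix (Fin r) (Fin r) ℂ} (h : LocMetric Ω H) {K : Set (Fin n → ℂ)}
    (hK : IsCompact K) (hKΩ : K ⊆ Ω) :
    ∃ (U : Set (Fin n → ℂ)) (c M : ℝ) (Hν : ℕ → (Fin n → ℂ) → Matrix (Fin r) (Fin r) ℂ),
      GoodSeq U K c M Hν H := by
  obtain ⟨δ, hδ, hδΩ⟩ := hK.exists_cthickening_subset_open h.isOpen hKΩ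
  set K₁ := Metric.cthickening δ K with hK₁
  have hK₁c : IsCompact K₁ := hK.cthickening
  have hδ2 : 0 < δ / 2 := by positivity
  set U := Metric.thickening (δ / 2) K with hU
  have hUt : ∀ z ∈ U, ∀ t, ‖t‖ < δ / 2 → z - t ∈ K₁ := by
    intro z hz t ht
    obtain ⟨y, hy, hzy⟩ := Metric.mem_thickening_iff.1 hz
    refine Metric.mem_cthickening_of_dist_le (z - t) y δ K hy ?_
    calc dist (z - t) y ≤ dist (z - t) z + dist z y := dist_triangle _ _ _
      _ ≤ δ / 2 + δ / 2 := by
        refine add_le_add ?_ hzy.le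
        rw [dist_eq_norm]
        simpa using ht.le
      _ = δ := by ring
  obtain ⟨M, hM⟩ := h.bound K₁ hδΩ hK₁c
  obtain ⟨c, hc, hcoer⟩ := h.coercive K₁ hδΩ hK₁c
  -- Truncation makes the metric bounded and measurable on all of `ℂⁿ`. For points of `U` and
  -- mollifiers of radius `δ / 2` only values in `K₁` enter, where nothing has changed.
  set Ht : (Fin n → ℂ) → Matrix (Fin r) (Fin r) ℂ := K₁.indicator H with hHt
  have hHte (a b : Fin r) : (fun z => Ht z a b) =
      K₁.indicator (Ω.indicator fun z => H z a b) := by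
    funext z
    by_cases hz : z ∈ K₁
    · rw [hHt, indicator_of_mem hz, indicator_of_mem hz, indicator_of_mem (hδΩ hz)]
    · rw [hHt, indicator_of_notMem hz, indicator_of_notMem hz]
      rfl
  have hHtm (a b : Fin r) : Measurable fun z => Ht z a b := by
    rw [hHte]
    exact (h.measurable a b).indicator hK₁c.measurableSet
  have hHtM (z : Fin n → ℂ) (a b : Fin r) : ‖Ht z a b‖ ≤ max M 0 := by
    by_cases hz : z ∈ K₁
    · rw [hHt, indicator_of_mem hz]
      exact (hM z hz a b).trans (le_max_left _ _)
    · rw [hHt, indicator_of_notMem hz]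
      simp
  have hHtK (z : Fin n → ℂ) (hz : z ∈ K₁) : Ht z = H z := indicator_of_mem hz H
  have hHti (a b : Fin r) : LocallyIntegrable (fun z => Ht z a b) := by
    refine (locallyIntegrable_const (max M 0)).mono (hHtm a b).aestronglyMeasurable
      (ae_of_all _ fun z => (hHtM z a b).trans (le_abs_self _))
  have hpsh : AffPsh (interior K₁) Ht := by
    intro v w L a b hab
    have hmem (ζ : ℂ) (hζ : ‖ζ‖ ≤ 1) : a + ζ • b ∈ K₁ := interior_subset (hab ζ hζ)
    have ha : a ∈ K₁ := by simpa using hmem 0 (by simp)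
    rw [hHtK a ha]
    refine (h.affPsh v w L a b fun ζ hζ => hδΩ (hmem ζ hζ)).trans (le_of_eq ?_)
    refine Real.circleAverage_congr_sphere fun ζ hζ => ?_
    rw [hHtK _ (hmem ζ (by simpa using hζ.le))]
  let ρ : ℕ → (Fin n → ℂ) → ℝ := fun m => (shrinkingBump hδ2 m).normed volume
  have hρ (m : ℕ) : IsMollifier (δ / 2) (ρ m) :=
    ContDiffBump.isMollifier _ (shrinkingBump_rOut_le hδ2 m)
  have hUint : ∀ z ∈ U, ∀ t, ‖t‖ < δ / 2 → z - t ∈ interior K₁ := by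
    intro z hz t ht
    have : z - t ∈ Metric.thickening δ K := by
      obtain ⟨y, hy, hzy⟩ := Metric.mem_thickening_iff.1 hz
      refine Metric.mem_thickening_iff.2 ⟨y, hy, ?_⟩
      calc dist (z - t) y ≤ dist (z - t) z + dist z y := dist_triangle _ _ _
        _ < δ / 2 + δ / 2 := by
          refine add_lt_add ?_ hzy
          rw [dist_eq_norm]
          simpa using ht
        _ = δ := by ring
    exact interior_maximal (Metric.thickening_subset_cthickening δ K) Metric.isOpen_thickening this
  have hherm (m : ℕ) (z : Fin n → ℂ) (hz : z ∈ U) : (mollify (ρ m) Ht z).IsHermitian :=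
    mollify_isHermitian (hρ m) fun t ht => by
      rw [hHtK _ (hUt z hz t ht)]
      exact h.hermitian _ (hδΩ (hUt z hz t ht))
  have hco (m : ℕ) (z : Fin n → ℂ) (hz : z ∈ U) : Coercive c (mollify (ρ m) Ht z) :=
    mollify_coercive (hρ m) hHtm hHtM fun t ht => by
      rw [hHtK _ (hUt z hz t ht)]
      exact hcoer _ (hUt z hz t ht)
  have hsm (m : ℕ) : MSmoothOn U (mollify (ρ m) Ht) := fun a b =>
    ((shrinkingBump hδ2 m).hasCompactSupport_normed.contDiff_convolution_left
      (n := (⊤ : ℕ∞)) (ContinuousLinearMap.lsmul ℝ ℝ) (shrinkingBump hδ2 m).contDiff_normed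
      (hHti a b)).contDiffOn
  refine ⟨U, c, max M 0, fun m => mollify (ρ m) Ht, Metric.isOpen_thickening, hK,
    Metric.self_subset_thickening hδ2 K, hc, fun m => ⟨hsm m, hherm m, hco m,
      fun z _ => norm_mollify_le (hρ m) hHtM z, fun z hz => ?_⟩, ?_⟩
  · refine AffPsh.griffithsAt Metric.isOpen_thickening (hsm m) (hherm m) (fun z hz v => ?_)
      (mollify_affPsh (hρ m) hHtm hHtM hpsh hUint) hz
    exact (mul_nonneg hc.le (normSqVec_nonneg v)).trans (hco m z hz v)
  -- Convergence at Lebesgue points; the constant `2` is the ratio of the outer to the inner radius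
  -- of the bumps, which must stay bounded as they shrink.
  · have hae (a b : Fin r) := ContDiffBump.ae_convolution_tendsto_right_of_locallyIntegrable
      (φ := fun m => shrinkingBump (n := n) hδ2 m) (l := atTop) (K := 2)
      (tendsto_shrinkingBump_rOut hδ2) (Eventually.of_forall fun m => by
        simp only [shrinkingBump]
        have : (0 : ℝ) < m + 1 := by positivity
        apply le_of_eq
        field_simp) (hHti a b)
    rw [ae_restrict_iff' hK.measurableSet]
    filter_upwards [ae_all_iff.2 fun a => ae_all_iff.2 fun b => hae a b] with z hz hzK a b
    have := hz a b
    rw [hHtK z (Metric.self_subset_cthickening K hzK)] at this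
    exact this

end Regularization

/-! ### Density of test functions and extension of functionals of order zero -/

section Density

open scoped Convolution

variable {n : ℕ} {Ω K : Set (Fin n → ℂ)} {φ ψ : (Fin n → ℂ) → ℂ}

lemma IsTest.isCc (h : IsTest Ω φ) : IsCc Ω φ :=
  ⟨h.contDiff.continuous, h.hasCompactSupport, h.tsupport_subset⟩

lemma tsupport_lin_comb_subset (c d : ℂ) :
    tsupport (fun z => c * φ z + d * ψ z) ⊆ tsupport φ ∪ tsupport ψ := by
  refine closure_minimal (fun z hz => ?_) ((isClosed_tsupport φ).union (isClosed_tsupport ψ))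
  by_contra h
  simp only [mem_union, not_or] at h
  refine hz ?_
  simp [image_eq_zero_of_notMem_tsupport h.1, image_eq_zero_of_notMem_tsupport h.2]

lemma IsTest.lin_comb (c d : ℂ) (h : IsTest Ω φ) (h' : IsTest Ω ψ) :
    IsTest Ω (fun z => c * φ z + d * ψ z) :=
  ⟨(contDiff_const.mul h.contDiff).add (contDiff_const.mul h'.contDiff),
    (h.hasCompactSupport.isCompact.union h'.hasCompactSupport).of_isClosed_subset
      (isClosed_tsupport _) (tsupport_lin_comb_subset c d),
    (tsupport_lin_comb_subset c d).trans (union_subset h.tsupport_subset h'.tsupport_subset)⟩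

lemma IsCc.lin_comb (c d : ℂ) (h : IsCc Ω φ) (h' : IsCc Ω ψ) :
    IsCc Ω (fun z => c * φ z + d * ψ z) :=
  ⟨(continuous_const.mul h.continuous).add (continuous_const.mul h'.continuous),
    (h.hasCompactSupport.isCompact.union h'.hasCompactSupport).of_isClosed_subset
      (isClosed_tsupport _) (tsupport_lin_comb_subset c d),
    (tsupport_lin_comb_subset c d).trans (union_subset h.tsupport_subset h'.tsupport_subset)⟩

/-- Test functions are dense in `C_c(Ω)`, with control of supports. -/
lemma exists_test_approx (hΩ : IsOpen Ω) (hK : IsCompact K) (hKΩ : K ⊆ Ω) :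
    ∃ K' ⊆ Ω, IsCompact K' ∧ K ⊆ K' ∧ ∀ φ, IsCc Ω φ → tsupport φ ⊆ K → ∀ ε : ℝ, 0 < ε →
      ∃ ψ, IsTest (interior K') ψ ∧ ∀ z, ‖ψ z - φ z‖ ≤ ε := by
  obtain ⟨δ, hδ, hδΩ⟩ := hK.exists_cthickening_subset_open hΩ hKΩ
  refine ⟨Metric.cthickening δ K, hδΩ, hK.cthickening, Metric.self_subset_cthickening K, ?_⟩
  intro φ hφ hφK ε hε
  obtain ⟨η, hη, hunif⟩ := Metric.uniformContinuous_iff.1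
    (hφ.hasCompactSupport.uniformContinuous_of_continuous hφ.continuous) ε hε
  -- Radius at most `δ / 2` controls the support, radius at most `η` the uniform distance through
  -- uniform continuity.
  have hs : 0 < min (δ / 2) η := by positivity
  set β : ContDiffBump (0 : Fin n → ℂ) := shrinkingBump hs 0 with hβ
  have hβr : β.rOut ≤ min (δ / 2) η := shrinkingBump_rOut_le hs 0
  set ψ : (Fin n → ℂ) → ℂ :=
    (β.normed volume ⋆[ContinuousLinearMap.lsmul ℝ ℝ, volume] φ) with hψ
  have hψs : ContDiff ℝ ∞ ψ := β.hasCompactSupport_normed.contDiff_convolution_left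
    (n := (⊤ : ℕ∞)) (ContinuousLinearMap.lsmul ℝ ℝ) β.contDiff_normed
    hφ.continuous.locallyIntegrable
  have hsupp : Function.support ψ ⊆ Metric.thickening (δ / 2) K := by
    intro z hz
    obtain ⟨s, hs, t, ht, rfl⟩ := Set.mem_add.1 (support_convolution_subset _ hz)
    rw [β.support_normed_eq, mem_ball_zero_iff] at hs
    refine Metric.mem_thickening_iff.2 ⟨t, hφK (subset_tsupport _ ht), ?_⟩
    rw [dist_eq_norm, add_sub_cancel_right]
    exact hs.trans_le (hβr.trans (min_le_left _ _))
  have hts : tsupport ψ ⊆ Metric.thickening δ K := by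
    refine (closure_mono hsupp).trans ((Metric.closure_thickening_subset_cthickening _ _).trans ?_)
    exact Metric.cthickening_subset_thickening' hδ (by linarith) K
  refine ⟨ψ, ⟨hψs, β.hasCompactSupport_normed.convolution _ hφ.hasCompactSupport,
    hts.trans (interior_maximal (Metric.thickening_subset_cthickening δ K)
      Metric.isOpen_thickening)⟩, fun z => ?_⟩
  rw [← dist_eq_norm]
  refine β.dist_normed_convolution_le hφ.continuous.aestronglyMeasurable fun x hx => ?_
  refine (hunif ?_).le
  exact (Metric.mem_ball.1 hx).trans_le (hβr.trans (min_le_right _ _))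

lemma IsTest.mono {Ω' : Set (Fin n → ℂ)} (h : IsTest Ω φ) (hs : Ω ⊆ Ω') : IsTest Ω' φ :=
  ⟨h.contDiff, h.hasCompactSupport, h.tsupport_subset.trans hs⟩

/-- `t` is the limit of `T` along test functions with support in `K'` that converge uniformly to
`φ`. -/
def IsTestLimit (Ω : Set (Fin n → ℂ)) (T : ((Fin n → ℂ) → ℂ) → ℂ) (K' : Set (Fin n → ℂ))
    (φ : (Fin n → ℂ) → ℂ) (t : ℂ) : Prop :=
  ∀ ε : ℝ, 0 < ε → ∃ ψ, IsTest Ω ψ ∧ tsupport ψ ⊆ K' ∧ (∀ z, ‖ψ z - φ z‖ ≤ ε) ∧ ‖T ψ - t‖ ≤ ε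

/-- A linear functional of order zero on test functions. -/
structure IsOrderZero (Ω : Set (Fin n → ℂ)) (T : ((Fin n → ℂ) → ℂ) → ℂ) : Prop where
  lin_comb : ∀ (c d : ℂ) (φ ψ), IsTest Ω φ → IsTest Ω ψ →
    T (fun z => c * φ z + d * ψ z) = c * T φ + d * T ψ
  bound : ∀ K ⊆ Ω, IsCompact K → ∃ C : ℝ, ∀ φ, IsTest Ω φ → tsupport φ ⊆ K →
    ∀ s : ℝ, (∀ z, ‖φ z‖ ≤ s) → ‖T φ‖ ≤ C * s

namespace IsOrderZero

variable {T : ((Fin n → ℂ) → ℂ) → ℂ}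

lemma exists_bound (hT : IsOrderZero Ω T) (hK : IsCompact K) (hKΩ : K ⊆ Ω) :
    ∃ C : ℝ, 0 ≤ C ∧ ∀ φ ψ, IsTest Ω φ → IsTest Ω ψ → tsupport φ ⊆ K → tsupport ψ ⊆ K →
      ∀ s : ℝ, (∀ z, ‖φ z - ψ z‖ ≤ s) → ‖T φ - T ψ‖ ≤ C * s := by
  obtain ⟨C, hC⟩ := hT.bound K hKΩ hK
  refine ⟨|C|, abs_nonneg C, fun φ ψ hφ hψ hφK hψK s hs => ?_⟩
  have h1 := hT.lin_comb 1 (-1) φ ψ hφ hψ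
  have h2 := hC _ (hφ.lin_comb 1 (-1) hψ)
    ((tsupport_lin_comb_subset 1 (-1)).trans (union_subset hφK hψK)) s (fun z => by
      simpa [sub_eq_add_neg] using hs z)
  rw [h1] at h2
  have h3 : 0 ≤ s := (norm_nonneg _).trans (hs 0)
  calc ‖T φ - T ψ‖ = ‖1 * T φ + -1 * T ψ‖ := by congr 1; ring
    _ ≤ C * s := h2
    _ ≤ |C| * s := mul_le_mul_of_nonneg_right (le_abs_self C) h3

/-- Two approximating test functions are uniformly close and supported in the compact union `K₁ ∪
K₂`, where `T` has a single bound. The value of the extension is therefore independent of the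
approximation and of the compact set, which also yields its linearity. -/
lemma testLimit_unique (hT : IsOrderZero Ω T) {K₁ K₂ : Set (Fin n → ℂ)} (h₁ : IsCompact K₁)
    (h₁Ω : K₁ ⊆ Ω) (h₂ : IsCompact K₂) (h₂Ω : K₂ ⊆ Ω) {t₁ t₂ : ℂ} (ht₁ : IsTestLimit Ω T K₁ φ t₁)
    (ht₂ : IsTestLimit Ω T K₂ φ t₂) : t₁ = t₂ := by
  obtain ⟨C, hC0, hC⟩ := hT.exists_bound (h₁.union h₂) (union_subset h₁Ω h₂Ω)
  rw [← sub_eq_zero, ← norm_le_zero_iff]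
  refine le_of_forall_pos_le_add fun ε hε => ?_
  set ε' := ε / (2 + C * 2) with hε'
  have hden : 0 < 2 + C * 2 := by positivity
  have hε'0 : 0 < ε' := by positivity
  obtain ⟨ψ₁, hψ₁, hs₁, ha₁, hb₁⟩ := ht₁ ε' hε'0
  obtain ⟨ψ₂, hψ₂, hs₂, ha₂, hb₂⟩ := ht₂ ε' hε'0
  have h := hC ψ₁ ψ₂ hψ₁ hψ₂ (hs₁.trans subset_union_left) (hs₂.trans subset_union_right)
    (2 * ε') (fun z => by
      have : ψ₁ z - ψ₂ z = (ψ₁ z - φ z) - (ψ₂ z - φ z) := by ring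
      rw [this]
      refine (norm_sub_le _ _).trans ?_
      linarith [ha₁ z, ha₂ z])
  have e : t₁ - t₂ = (T ψ₁ - T ψ₂) - (T ψ₁ - t₁) + (T ψ₂ - t₂) := by ring
  rw [e, zero_add]
  refine (norm_add_le _ _).trans ((add_le_add_left (norm_sub_le _ _) _).trans ?_)
  have : ε' * (2 + C * 2) = ε := div_mul_cancel₀ ε hden.ne'
  nlinarith

/-- By the bound on `K'`, the values of `T` along a uniformly convergent sequence of test functions
form a Cauchy sequence. -/
lemma exists_testLimit (hT : IsOrderZero Ω T) {K' : Set (Fin n → ℂ)} (hK' : IsCompact K')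
    (hK'Ω : K' ⊆ Ω)
    (happ : ∀ ε : ℝ, 0 < ε → ∃ ψ, IsTest Ω ψ ∧ tsupport ψ ⊆ K' ∧ ∀ z, ‖ψ z - φ z‖ ≤ ε) :
    ∃ t, IsTestLimit Ω T K' φ t := by
  obtain ⟨C, hC0, hC⟩ := hT.exists_bound hK' hK'Ω
  choose ψ hψ hψK hψφ using fun m : ℕ => happ (1 / ((m : ℝ) + 1)) (by positivity)
  have hlim := tendsto_one_div_add_atTop_nhds_zero_nat (𝕜 := ℝ)
  have hcau : CauchySeq fun m => T (ψ m) := by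
    refine cauchySeq_of_le_tendsto_0 (fun m : ℕ => C * (2 * (1 / ((m : ℝ) + 1)))) ?_ ?_
    · intro m l N hm hl
      rw [dist_eq_norm]
      refine hC _ _ (hψ m) (hψ l) (hψK m) (hψK l) _ fun z => ?_
      have : ψ m z - ψ l z = (ψ m z - φ z) - (ψ l z - φ z) := by ring
      rw [this]
      refine (norm_sub_le _ _).trans ?_
      have h1 := (hψφ m z).trans (Nat.one_div_le_one_div (α := ℝ) hm)
      have h2 := (hψφ l z).trans (Nat.one_div_le_one_div (α := ℝ) hl)
      linarith
    · simpa using (hlim.const_mul 2).const_mul C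
  obtain ⟨t, ht⟩ := cauchySeq_tendsto_of_complete hcau
  refine ⟨t, fun ε hε => ?_⟩
  have h1 : ∀ᶠ m : ℕ in atTop, 1 / ((m : ℝ) + 1) ≤ ε := hlim.eventually_le_const hε
  have h2 : ∀ᶠ m in atTop, ‖T (ψ m) - t‖ ≤ ε := by
    filter_upwards [Metric.tendsto_nhds.1 ht ε hε] with m hm
    rw [← dist_eq_norm]
    exact hm.le
  obtain ⟨m, hm1, hm2⟩ := (h1.and h2).exists
  exact ⟨ψ m, hψ m, hψK m, fun z => (hψφ m z).trans hm1, hm2⟩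

/-- Functionals of order zero extend to Radon measures. -/
lemma exists_radon (hΩ : IsOpen Ω) (hT : IsOrderZero Ω T) :
    ∃ S, IsRadonMeasure Ω S ∧ ∀ φ, IsTest Ω φ → S φ = T φ := by
  classical
  -- The compact set `K'` depends on `K` and not on `φ`; this makes the bound for the extension
  -- uniform over functions supported in `K`.
  have hex (K : Set (Fin n → ℂ)) (hK : IsCompact K) (hKΩ : K ⊆ Ω) :
      ∃ K' ⊆ Ω, IsCompact K' ∧ K ⊆ K' ∧ ∀ φ, IsCc Ω φ → tsupport φ ⊆ K →
        ∃ t, IsTestLimit Ω T K' φ t := by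
    obtain ⟨K', hK'Ω, hK', hKK', happ⟩ := exists_test_approx hΩ hK hKΩ
    refine ⟨K', hK'Ω, hK', hKK', fun φ hφ hφK => hT.exists_testLimit hK' hK'Ω fun ε hε => ?_⟩
    obtain ⟨ψ, hψ, hψφ⟩ := happ φ hφ hφK ε hε
    exact ⟨ψ, hψ.mono (interior_subset.trans hK'Ω), hψ.tsupport_subset.trans interior_subset, hψφ⟩
  have hex' (φ : (Fin n → ℂ) → ℂ) (hφ : IsCc Ω φ) :
      ∃ t, ∃ K' ⊆ Ω, IsCompact K' ∧ IsTestLimit Ω T K' φ t := by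
    obtain ⟨K', h1, h2, -, h3⟩ := hex _ hφ.hasCompactSupport hφ.tsupport_subset
    obtain ⟨t, ht⟩ := h3 φ hφ subset_rfl
    exact ⟨t, K', h1, h2, ht⟩
  let S : ((Fin n → ℂ) → ℂ) → ℂ := fun φ => if h : IsCc Ω φ then (hex' φ h).choose else 0
  have hS (φ) (hφ : IsCc Ω φ) : ∃ K' ⊆ Ω, IsCompact K' ∧ IsTestLimit Ω T K' φ (S φ) := by
    have : S φ = (hex' φ hφ).choose := dif_pos hφ
    rw [this]
    exact (hex' φ hφ).choose_spec
  have hSu (φ) (hφ : IsCc Ω φ) {K'} (h1 : K' ⊆ Ω) (h2 : IsCompact K') {t}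
      (ht : IsTestLimit Ω T K' φ t) : S φ = t := by
    obtain ⟨K₁, h3, h4, h5⟩ := hS φ hφ
    exact hT.testLimit_unique h4 h3 h2 h1 h5 ht
  have hlin (c d : ℂ) (φ ψ) (hφ : IsCc Ω φ) (hψ : IsCc Ω ψ) :
      S (fun z => c * φ z + d * ψ z) = c * S φ + d * S ψ := by
    obtain ⟨K₁, h1, h2, h3⟩ := hS φ hφ
    obtain ⟨K₂, h4, h5, h6⟩ := hS ψ hψ
    refine hSu _ (hφ.lin_comb c d hψ) (union_subset h1 h4) (h2.union h5) fun ε hε => ?_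
    have hden : 0 < ‖c‖ + ‖d‖ + 1 := by positivity
    set ε' := ε / (‖c‖ + ‖d‖ + 1) with hε'
    have hε'0 : 0 < ε' := by positivity
    have hle : ‖c‖ * ε' + ‖d‖ * ε' ≤ ε := by
      have : ε' * (‖c‖ + ‖d‖ + 1) = ε := div_mul_cancel₀ ε hden.ne'
      nlinarith
    obtain ⟨φ', hφ', hs₁, ha₁, hb₁⟩ := h3 ε' hε'0
    obtain ⟨ψ', hψ', hs₂, ha₂, hb₂⟩ := h6 ε' hε'0
    have key (x y x' y' : ℂ) (hx : ‖x - x'‖ ≤ ε') (hy : ‖y - y'‖ ≤ ε') :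
        ‖c * x + d * y - (c * x' + d * y')‖ ≤ ε := by
      have : c * x + d * y - (c * x' + d * y') = c * (x - x') + d * (y - y') := by ring
      rw [this]
      refine (norm_add_le _ _).trans (le_trans ?_ hle)
      rw [norm_mul, norm_mul]
      gcongr
    refine ⟨fun z => c * φ' z + d * ψ' z, hφ'.lin_comb c d hψ',
      (tsupport_lin_comb_subset c d).trans (union_subset_union hs₁ hs₂),
      fun z => key _ _ _ _ (ha₁ z) (ha₂ z), ?_⟩
    rw [hT.lin_comb c d _ _ hφ' hψ']
    exact key _ _ _ _ hb₁ hb₂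
  refine ⟨S, ⟨fun φ ψ hφ hψ => ?_, fun c φ hφ => ?_, fun K hKΩ hK => ?_⟩, fun φ hφ => ?_⟩
  · simpa using hlin 1 1 φ ψ hφ hψ
  · simpa using hlin c 0 φ φ hφ hφ
  · obtain ⟨K', h1, h2, -, h3⟩ := hex K hK hKΩ
    obtain ⟨C, hC⟩ := hT.bound K' h1 h2
    refine ⟨|C|, fun φ hφ hφK s hs => ?_⟩
    obtain ⟨t, ht⟩ := h3 φ hφ hφK
    rw [hSu φ hφ h1 h2 ht]
    refine le_of_forall_pos_le_add fun ε hε => ?_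
    set ε' := ε / (|C| + 1) with hε'
    have hden : 0 < |C| + 1 := by positivity
    have hε'0 : 0 < ε' := by positivity
    obtain ⟨ψ, hψ, hψK, ha, hb⟩ := ht ε' hε'0
    have h4 := hC ψ hψ hψK (s + ε') fun z => by
      have : ψ z = φ z + (ψ z - φ z) := by ring
      rw [this]
      exact (norm_add_le _ _).trans (add_le_add (hs z) (ha z))
    have hs0 : 0 ≤ s := (norm_nonneg _).trans (hs 0)
    have h5 : ‖t‖ ≤ ‖T ψ‖ + ε' := by
      have : t = T ψ - (T ψ - t) := by ring
      rw [this]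
      refine (norm_sub_le _ _).trans ?_
      linarith
    have h6 : C * (s + ε') ≤ |C| * (s + ε') :=
      mul_le_mul_of_nonneg_right (le_abs_self C) (by positivity)
    have h7 : ε' * (|C| + 1) = ε := div_mul_cancel₀ ε hden.ne'
    nlinarith
  · refine hSu φ hφ.isCc hφ.tsupport_subset hφ.hasCompactSupport fun ε hε =>
      ⟨φ, hφ, subset_rfl, fun z => by simpa using hε.le, by simpa using hε.le⟩

end IsOrderZero

lemma IsRadonMeasure.sub {S : ((Fin n → ℂ) → ℂ) → ℂ} (hS : IsRadonMeasure Ω S) (hφ : IsCc Ω φ)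
    (hψ : IsCc Ω ψ) : S (fun z => φ z - ψ z) = S φ - S ψ := by
  have h1 := hS.map_smul (-1) ψ hψ
  have hψ' : IsCc Ω (fun z => -1 * ψ z) := by simpa using hψ.lin_comb (-1) 0 hψ
  have h2 := hS.map_add φ _ hφ hψ'
  rw [h1] at h2
  have e : (fun z => φ z + -1 * ψ z) = fun z => φ z - ψ z := by funext z; ring
  rw [e] at h2
  rw [h2]; ring

/-- Distributional convergence together with local mass bounds implies weak convergence of
measures. -/
lemma tendsto_radon (hΩ : IsOpen Ω) {S : ((Fin n → ℂ) → ℂ) → ℂ} (hS : IsRadonMeasure Ω S)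
    {G : ℕ → (Fin n → ℂ) → ℂ} (hG : ∀ m, ContinuousOn (G m) Ω)
    (hbd : ∀ K ⊆ Ω, IsCompact K → ∃ C : ℝ, ∀ m, ∫ z in K, ‖G m z‖ ≤ C)
    (hlim : ∀ φ, IsTest Ω φ → Tendsto (fun m => ∫ z, G m z * φ z) atTop (𝓝 (S φ)))
    (hφ : IsCc Ω φ) : Tendsto (fun m => ∫ z, G m z * φ z) atTop (𝓝 (S φ)) := by
  obtain ⟨K, hKΩ, hK, hφK, happ⟩ :=
    exists_test_approx hΩ hφ.hasCompactSupport hφ.tsupport_subset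
  obtain ⟨C, hC⟩ := hbd K hKΩ hK
  obtain ⟨D, hD⟩ := hS.bound K hKΩ hK
  rw [Metric.tendsto_nhds]
  intro ε hε
  -- Replacing `φ` by `ψ` costs `|C| ε'` in the integrals and `|D| ε'` in the limit, together at
  -- most `ε / 2`; the other half is left for convergence on `ψ`.
  set ε' := ε / (2 * (|C| + |D| + 1)) with hε'
  have hden : 0 < 2 * (|C| + |D| + 1) := by positivity
  have hε'0 : 0 < ε' := by positivity
  obtain ⟨ψ, hψ, hψφ⟩ := happ φ hφ subset_rfl ε' hε'0
  have hψΩ := hψ.mono (interior_subset.trans hKΩ)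
  have hψK : tsupport ψ ⊆ K := hψ.tsupport_subset.trans interior_subset
  have hdc : IsCc Ω fun z => ψ z - φ z := by
    simpa [sub_eq_add_neg] using hψΩ.isCc.lin_comb 1 (-1) hφ
  have hdK : tsupport (fun z => ψ z - φ z) ⊆ K := by
    have := (tsupport_lin_comb_subset (φ := ψ) (ψ := φ) 1 (-1)).trans (union_subset hψK hφK)
    simpa [sub_eq_add_neg] using this
  have h1 : ‖S ψ - S φ‖ ≤ |D| * ε' := by
    rw [← hS.sub hψΩ.isCc hφ]
    exact (hD _ hdc hdK ε' hψφ).trans (mul_le_mul_of_nonneg_right (le_abs_self D) hε'0.le)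
  have h2 (m : ℕ) : ‖(∫ z, G m z * ψ z) - ∫ z, G m z * φ z‖ ≤ |C| * ε' := by
    have hi (χ) (hχ : IsCc Ω χ) : Integrable fun z => G m z * χ z :=
      integrable_mul_of_tsupport hΩ (hG m) hχ.continuous hχ.hasCompactSupport hχ.tsupport_subset
    rw [← integral_sub (hi ψ hψΩ.isCc) (hi φ hφ)]
    have e : ∫ z, (G m z * ψ z - G m z * φ z) = ∫ z in K, G m z * (ψ z - φ z) := by
      rw [← GoodSeq.setIntegral_test (φ := fun z => ψ z - φ z) hdK]
      refine integral_congr_ae (ae_of_all _ fun z => ?_)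
      simp only
      ring
    rw [e]
    have : ‖∫ z in K, G m z * (ψ z - φ z)‖ ≤ ∫ z in K, ‖G m z‖ * ε' := by
      refine norm_integral_le_of_norm_le
        ((integrableOn_of_continuousOn (hG m) hK hKΩ).norm.mul_const _) (ae_of_all _ fun z => ?_)
      rw [norm_mul]
      exact mul_le_mul_of_nonneg_left (hψφ z) (norm_nonneg _)
    rw [integral_mul_const] at this
    refine this.trans (mul_le_mul_of_nonneg_right ((hC m).trans (le_abs_self C)) hε'0.le)
  filter_upwards [Metric.tendsto_nhds.1 (hlim ψ hψΩ) (ε / 2) (by positivity)] with m hm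
  rw [dist_eq_norm] at hm ⊢
  have e : (∫ z, G m z * φ z) - S φ = ((∫ z, G m z * ψ z) - S ψ) + (S ψ - S φ) -
      ((∫ z, G m z * ψ z) - ∫ z, G m z * φ z) := by ring
  rw [e]
  have h7 : ε' * (2 * (|C| + |D| + 1)) = ε := div_mul_cancel₀ ε hden.ne'
  have h8 := (norm_sub_le (((∫ z, G m z * ψ z) - S ψ) + (S ψ - S φ))
      ((∫ z, G m z * ψ z) - ∫ z, G m z * φ z)).trans
    (add_le_add_left (norm_add_le _ _) _)
  have h9 := h2 m
  nlinarith

end Density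

/-! ### Singular metrics on open subsets of `ℂⁿ` -/

section Local

open Matrix

variable {n r : ℕ} {Ω K : Set (Fin n → ℂ)} {j k : Fin n} {f g φ : (Fin n → ℂ) → ℂ}
  {H : (Fin n → ℂ) → Matrix (Fin r) (Fin r) ℂ}

/-- Exhaustion of an open set by compact sets. -/
lemma exists_compact_exhaustion (hΩ : IsOpen Ω) :
    ∃ L : ℕ → Set (Fin n → ℂ), (∀ m, IsCompact (L m)) ∧ (∀ m, L m ⊆ Ω) ∧
      ∀ K ⊆ Ω, IsCompact K → ∃ m, K ⊆ interior (L m) := by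
  have : LocallyCompactSpace Ω := hΩ.locallyCompactSpace
  let E : CompactExhaustion Ω := CompactExhaustion.choice Ω
  refine ⟨fun m => (↑) '' E m, fun m => (E.isCompact m).image continuous_subtype_val,
    fun m => Subtype.coe_image_subset Ω (E m), fun K hKΩ hK => ?_⟩
  have hK' : IsCompact ((↑) ⁻¹' K : Set Ω) := by
    rw [Subtype.isCompact_iff, Subtype.image_preimage_coe, inter_eq_right.2 hKΩ]
    exact hK
  obtain ⟨m, hm⟩ := E.exists_superset_of_isCompact hK'
  refine ⟨m + 1, fun z hz => ?_⟩
  have h1 : (⟨z, hKΩ hz⟩ : Ω) ∈ interior (E (m + 1)) := E.subset_interior_succ m (hm hz)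
  have h2 : IsOpen ((↑) '' interior (E (m + 1)) : Set (Fin n → ℂ)) :=
    hΩ.isOpenMap_subtype_val _ isOpen_interior
  exact interior_maximal (image_mono interior_subset) h2 ⟨_, h1, rfl⟩

lemma HasWeakDz.mono {Ω' : Set (Fin n → ℂ)} (h : HasWeakDz Ω j f g) (hs : Ω' ⊆ Ω) :
    HasWeakDz Ω' j f g :=
  ⟨h.locallyIntegrable_fun.mono_set hs, h.locallyIntegrable_deriv.mono_set hs,
    fun φ hφ => h.integral_eq φ (hφ.mono hs)⟩

/-- Weak derivatives on relatively compact subsets glue. -/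
lemma exists_hasWeakDz_of_interior (hΩ : IsOpen Ω)
    (h : ∀ K ⊆ Ω, IsCompact K → ∃ P, MemLp P 2 (volume.restrict K) ∧
      HasWeakDz (interior K) j f P) :
    ∃ P, HasWeakDz Ω j f P ∧ MemL2Loc Ω P := by
  classical
  obtain ⟨L, hL, hLΩ, hLK⟩ := exists_compact_exhaustion hΩ
  choose Q hQ hQw using fun m => h (L m) (hLΩ m) (hL m)
  -- Each point uses the first compact set of the exhaustion whose interior contains it. By
  -- uniqueness the pieces agree off a countable union of null sets.
  let P : (Fin n → ℂ) → ℂ := fun z =>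
    if hz : ∃ m, z ∈ interior (L m) then Q (Nat.find hz) z else 0
  have hPQ (m : ℕ) : ∀ᵐ z, z ∈ interior (L m) → P z = Q m z := by
    have h1 (l : ℕ) : ∀ᵐ z, z ∈ interior (L l) ∩ interior (L m) → Q l z = Q m z := by
      have h2 := ((hQw l).mono inter_subset_left).ae_unique
        (isOpen_interior.inter isOpen_interior)
        ((hQw m).mono (inter_subset_right (s := interior (L l))))
      rwa [ae_restrict_iff' (isOpen_interior.inter isOpen_interior).measurableSet] at h2
    filter_upwards [ae_all_iff.2 h1] with z hz hzm
    have hex : ∃ m, z ∈ interior (L m) := ⟨m, hzm⟩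
    have : P z = Q (Nat.find hex) z := dif_pos hex
    rw [this]
    exact hz _ ⟨Nat.find_spec hex, hzm⟩
  have hPK {K : Set (Fin n → ℂ)} (hK : IsCompact K) {m : ℕ} (hm : K ⊆ interior (L m)) :
      P =ᵐ[volume.restrict K] Q m := by
    rw [EventuallyEq, ae_restrict_iff' hK.measurableSet]
    filter_upwards [hPQ m] with z hz hzK using hz (hm hzK)
  have hL2 : MemL2Loc Ω P := by
    intro K hKΩ hK
    obtain ⟨m, hm⟩ := hLK K hKΩ hK
    exact ((hQ m).mono_measure (Measure.restrict_mono (hm.trans interior_subset) le_rfl)).ae_eq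
      (hPK hK hm).symm
  refine ⟨P, ⟨?_, ?_, fun φ hφ => ?_⟩, hL2⟩
  · rw [locallyIntegrableOn_iff hΩ.isLocallyClosed]
    intro K hKΩ hK
    obtain ⟨m, hm⟩ := hLK K hKΩ hK
    exact (hQw m).locallyIntegrable_fun.integrableOn_compact_subset hm hK
  · rw [locallyIntegrableOn_iff hΩ.isLocallyClosed]
    intro K hKΩ hK
    obtain ⟨m, hm⟩ := hLK K hKΩ hK
    exact ((hQw m).locallyIntegrable_deriv.integrableOn_compact_subset hm hK).congr_fun_ae
      (hPK hK hm).symm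
  · obtain ⟨m, hm⟩ := hLK _ hφ.tsupport_subset hφ.hasCompactSupport
    rw [(hQw m).integral_eq φ ⟨hφ.contDiff, hφ.hasCompactSupport, hm⟩]
    congr 1
    refine integral_congr_ae ?_
    filter_upwards [hPQ m] with z hz
    by_cases h0 : φ z = 0
    · simp [h0]
    · rw [hz (hm (subset_tsupport _ h0))]

lemma MemL2Loc.integrable_mul (hf : MemL2Loc Ω f) (hφ : IsCc Ω φ) :
    Integrable fun z => f z * φ z := by
  have hK := hφ.hasCompactSupport.isCompact
  have h1 : IsFiniteMeasure ((volume : Measure (Fin n → ℂ)).restrict (tsupport φ)) :=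
    isFiniteMeasure_restrict.2 hK.measure_lt_top.ne
  have h2 : IntegrableOn f (tsupport φ) := (hf _ hφ.tsupport_subset hK).integrable (by norm_num)
  have h3 : IntegrableOn (fun z => f z * φ z) (tsupport φ) :=
    h2.mul_continuousOn hφ.continuous.continuousOn hK
  refine (integrableOn_iff_integrable_of_support_subset fun z hz => ?_).1 h3
  exact subset_tsupport _ (right_ne_zero_of_mul hz)

namespace LocMetric

/-- The weak derivatives of a singular metric are square integrable. -/
lemma exists_weak_deriv (h : LocMetric Ω H) (j : Fin n) :
    ∃ P : (Fin n → ℂ) → Matrix (Fin r) (Fin r) ℂ, ∀ a b,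
      HasWeakDz Ω j (fun z => H z a b) (fun z => P z a b) ∧ MemL2Loc Ω (fun z => P z a b) := by
  have key (a b : Fin r) : ∃ P, HasWeakDz Ω j (fun z => H z a b) P ∧ MemL2Loc Ω P := by
    refine exists_hasWeakDz_of_interior h.isOpen fun K hKΩ hK => ?_
    obtain ⟨U, c, M, Hν, hG⟩ := h.exists_goodSeq hK hKΩ
    obtain ⟨P, hP⟩ := hG.exists_weak_deriv_interior j
    exact ⟨_, hP a b⟩
  choose P hP using key
  exact ⟨fun z => Matrix.of fun a b => P a b z, hP⟩

lemma isUnit (h : LocMetric Ω H) {z : Fin n → ℂ} (hz : z ∈ Ω) : IsUnit (H z) := by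
  obtain ⟨c, hc, hcz⟩ := h.coercive {z} (singleton_subset_iff.2 hz) isCompact_singleton
  exact (hcz z rfl).isUnit hc

/-- On a compact set `H⁻¹` is bounded by coercivity, and its measurability comes from a regularizing
sequence; a bounded function times an `L²` function is in `L²`. -/
lemma memL2Loc_inv_mul (h : LocMetric Ω H) {P : (Fin n → ℂ) → Matrix (Fin r) (Fin r) ℂ}
    (hP : ∀ a b, MemL2Loc Ω fun z => P z a b) (a b : Fin r) :
    MemL2Loc Ω fun z => ((H z)⁻¹ * P z) a b := by
  intro K hKΩ hK
  obtain ⟨U, c, M, Hν, hG⟩ := h.exists_goodSeq hK hKΩ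
  simp only [Matrix.mul_apply]
  refine memLp_finsetSum _ fun k _ => ?_
  have h1 : MemLp (fun z => (H z)⁻¹ a k) ⊤ (volume.restrict K) := by
    refine memLp_top_of_bound (hG.aestronglyMeasurable_inv a k) c⁻¹ ?_
    filter_upwards [hG.norm_inv_ae] with z hz using hz a k
  exact (hP k b K hKΩ hK).mul h1

/-- Order zero is inherited from regularizations, whose curvatures have uniformly bounded mass. They
are taken on a larger compact set `K₁`, so that supports inside `K` lie in its interior. -/
lemma isOrderZero (h : LocMetric Ω H) {P : (Fin n → ℂ) → Matrix (Fin r) (Fin r) ℂ}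
    (hP : ∀ a b, HasWeakDz Ω j (fun z => H z a b) (fun z => P z a b))
    (hP2 : ∀ a b, MemL2Loc Ω fun z => P z a b) (k : Fin n) (a b : Fin r) :
    IsOrderZero Ω fun φ => ∫ z, ((H z)⁻¹ * P z) a b * dzbar k φ z where
  lin_comb c d φ ψ hφ hψ := by
    have hi (χ) (hχ : IsTest Ω χ) :
        Integrable fun z => ((H z)⁻¹ * P z) a b * wirt Complex.I (Pi.single k 1) χ z :=
      (h.memL2Loc_inv_mul hP2 a b).integrable_mul hχ.wirt.isCc
    have hd (χ) (hχ : IsTest Ω χ) (z) : DifferentiableAt ℝ χ z :=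
      hχ.contDiff.contDiffAt.differentiableAt (by simp)
    rw [dzbar_eq_delbar]
    rw [← integral_const_mul, ← integral_const_mul,
      ← integral_add ((hi φ hφ).const_mul c) ((hi ψ hψ).const_mul d)]
    refine integral_congr_ae (ae_of_all _ fun z => ?_)
    simp only [delbar]
    rw [wirt_add ((hd φ hφ z).const_mul c) ((hd ψ hψ z).const_mul d), wirt_const_mul c (hd φ hφ z),
      wirt_const_mul d (hd ψ hψ z)]
    ring
  bound K hKΩ hK := by
    obtain ⟨K₁, hK₁, hKK₁, hK₁Ω⟩ := exists_compact_between hK h.isOpen hKΩ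
    obtain ⟨U, c, M, Hν, hG⟩ := h.exists_goodSeq hK₁ hK₁Ω
    obtain ⟨C, hC⟩ := hG.exists_bound j k
    exact ⟨C, fun φ hφ hφK s hs => hC P (fun a b => (hP a b).mono (interior_subset.trans hK₁Ω)) φ
      ⟨hφ.contDiff, hφ.hasCompactSupport, hφK.trans hKK₁⟩ s hs a b⟩

/-- Connection and curvature of a singular Griffiths negative metric with determinant bounded
below. -/
theorem exists_curvature (h : LocMetric Ω H) :
    ∃ θ : Fin n → (Fin n → ℂ) → Matrix (Fin r) (Fin r) ℂ,
      IsConnForm Ω H θ ∧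
      (∀ θ', IsConnForm Ω H θ' → ∀ j, ∀ᵐ z ∂(volume.restrict Ω), θ' j z = θ j z) ∧
      (∀ j a b, MemL2Loc Ω (fun z => θ j z a b)) ∧
      ∃ Θ : Fin n → Fin n → Fin r → Fin r → ((Fin n → ℂ) → ℂ) → ℂ,
        (∀ j k a b, IsRadonMeasure Ω (Θ j k a b)) ∧ IsDbarOf Ω θ Θ ∧
        ∀ Hν : ℕ → (Fin n → ℂ) → Matrix (Fin r) (Fin r) ℂ,
          (∀ K ⊆ Ω, IsCompact K → ∃ U c M, GoodSeq U K c M Hν H) →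
          ∀ ξ : (Fin n → ℂ) → (Fin n → ℂ), ContinuousOn ξ Ω →
          ∀ a b, ∀ φ : (Fin n → ℂ) → ℂ, IsCc Ω φ →
            Tendsto (fun m => ∫ z, φ z * curvAt (Hν m) ξ z a b) atTop
              (𝓝 (currentAt Θ ξ a b φ)) := by
  choose P hPw hP2 using fun j => (h.exists_weak_deriv j).imp fun P hP =>
    (⟨fun a b => (hP a b).1, fun a b => (hP a b).2⟩ : (∀ a b, _) ∧ ∀ a b, _)
  choose Θ hΘ hΘT using fun j k a b =>
    (h.isOrderZero (hPw j) (hP2 j) k a b).exists_radon h.isOpen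
  refine ⟨fun j z => (H z)⁻¹ * P j z, ⟨?_, P, hPw, fun j => ae_of_all _ fun z => rfl⟩, ?_,
    fun j => h.memL2Loc_inv_mul (hP2 j), Θ, hΘ, fun j k a b φ hφ => hΘT j k a b φ hφ, ?_⟩
  · filter_upwards [ae_restrict_mem h.isOpen.measurableSet] with z hz using h.isUnit hz
  · rintro θ' ⟨-, P', hP', hθ'⟩ j
    have h1 := ae_all_iff.2 fun a => ae_all_iff.2 fun b =>
      (hP' j a b).ae_unique h.isOpen (hPw j a b)
    filter_upwards [hθ' j, h1] with z hz h1
    rw [hz]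
    congr 1
    ext a b
    exact h1 a b
  · intro Hν hν ξ hξ a b φ hφ
    -- Continuity is a local matter, so the approximation hypothesis on one-point sets suffices.
    have hcont (m : ℕ) (j k : Fin n) : ContinuousOn
        (fun z => curvM (Hν m) (Pi.single j 1) (Pi.single k 1) z a b) Ω := by
      intro z hz
      obtain ⟨U, c, M, hG⟩ := hν {z} (singleton_subset_iff.2 hz) isCompact_singleton
      exact (((hG.good m).curvM_smooth hG.isOpen hG.pos _ _ a b).continuousOn.continuousAt
        (hG.isOpen.mem_nhds (hG.subset rfl))).continuousWithinAt
    have hψ (j k : Fin n) : IsCc Ω fun z => φ z * (ξ z j * conj (ξ z k)) := by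
      have hc : ContinuousOn (fun z => ξ z j * conj (ξ z k)) Ω :=
        ((continuous_apply j).comp_continuousOn hξ).mul
          (Complex.continuous_conj.comp_continuousOn ((continuous_apply k).comp_continuousOn hξ))
      have hs : tsupport (fun z => φ z * (ξ z j * conj (ξ z k))) ⊆ tsupport φ :=
        closure_mono fun z hz => left_ne_zero_of_mul hz
      refine ⟨?_, hφ.hasCompactSupport.of_isClosed_subset (isClosed_tsupport _) hs,
        hs.trans hφ.tsupport_subset⟩
      simpa only [mul_comm] using continuous_mul_of_tsupport h.isOpen hc hφ.continuous
        hφ.tsupport_subset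
    -- The factor `ξ_j ξ̄_k` is absorbed into `φ`: for continuous `ξ` the product is again in `C_c`,
    -- so convergence of each curvature coefficient is all that is needed.
    have key (j k : Fin n) : Tendsto (fun m => ∫ z,
        curvM (Hν m) (Pi.single j 1) (Pi.single k 1) z a b * (φ z * (ξ z j * conj (ξ z k)))) atTop
        (𝓝 (Θ j k a b fun z => φ z * (ξ z j * conj (ξ z k)))) := by
      refine tendsto_radon h.isOpen (hΘ j k a b) (fun m => hcont m j k) ?_ ?_ (hψ j k)
      · intro K hKΩ hK
        obtain ⟨U, c, M, hG⟩ := hν K hKΩ hK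
        obtain ⟨C, hC⟩ := exists_integral_norm_curvM_le (r := r) hG.isOpen hK hG.subset hG.pos M
          (Pi.single j 1) (Pi.single k 1)
        exact ⟨C, fun m => hC _ (hG.good m) a b⟩
      · intro ψ hψ
        obtain ⟨K, hK, hψK, hKΩ⟩ := exists_compact_between hψ.hasCompactSupport h.isOpen
          hψ.tsupport_subset
        obtain ⟨U, c, M, hG⟩ := hν K hKΩ hK
        rw [hΘT j k a b ψ hψ]
        exact hG.tendsto_curvM (fun a b => (hPw j a b).mono (interior_subset.trans hKΩ))
          ⟨hψ.contDiff, hψ.hasCompactSupport, hψK⟩ a b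
    have hsum := tendsto_finsetSum Finset.univ fun j _ =>
      tendsto_finsetSum Finset.univ fun k _ => key j k
    refine hsum.congr fun m => ?_
    have hi (j k : Fin n) := integrable_mul_of_tsupport h.isOpen (hcont m j k) (hψ j k).continuous
      (hψ j k).hasCompactSupport (hψ j k).tsupport_subset
    simp_rw [← integral_finsetSum Finset.univ fun k _ => hi _ k]
    rw [← integral_finsetSum Finset.univ fun j _ => integrable_finsetSum _ fun k _ => hi j k]
    refine integral_congr_ae (ae_of_all _ fun z => ?_)
    simp only [curvAt, curvCoeff_eq, Matrix.sum_apply, Matrix.smul_apply, smul_eq_mul,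
      Finset.mul_sum]
    exact Finset.sum_congr rfl fun j _ => Finset.sum_congr rfl fun k _ => by ring

end LocMetric

end Local

/-! ### Determinant bounds and polarization -/

section Bounds

open Matrix
open scoped ComplexOrder

variable {n r : ℕ}

/-- A vector on which a non-negative hermitian form vanishes lies in its kernel, and the kernel is
zero when the determinant is not. -/
lemma re_sesq_pos {A : Matrix (Fin r) (Fin r) ℂ} (hA : A.IsHermitian)
    (hpos : ∀ v, 0 ≤ (sesq A v v).re) (hdet : A.det ≠ 0) {v : Fin r → ℂ} (hv : v ≠ 0) :
    0 < (sesq A v v).re := by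
  have e (v : Fin r → ℂ) : star v ⬝ᵥ (A *ᵥ v) = sesq A v v := by
    rw [sesq_eq_sum_mulVec]; rfl
  have him (v : Fin r → ℂ) : (sesq A v v).im = 0 := by
    have := sesq_conjTranspose A v v
    rw [hA.eq] at this
    exact Complex.conj_eq_iff_im.1 this.symm
  have hpsd : A.PosSemidef := .of_dotProduct_mulVec_nonneg hA fun v => by
    rw [e, Complex.nonneg_iff]
    exact ⟨hpos v, (him v).symm⟩
  refine (hpos v).lt_of_ne fun h0 => hv ?_
  have h1 : sesq A v v = 0 := Complex.ext h0.symm (him v)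
  rw [← e, hpsd.dotProduct_mulVec_zero_iff] at h1
  exact Matrix.eq_zero_of_mulVec_eq_zero hdet h1

/-- Bounded nonnegative matrices with determinant bounded below are uniformly coercive. -/
lemma exists_coercive_of_det (r : ℕ) (M : ℝ) {ε : ℝ} (hε : 0 < ε) :
    ∃ c : ℝ, 0 < c ∧ ∀ A : Matrix (Fin r) (Fin r) ℂ, A.IsHermitian →
      (∀ v, 0 ≤ (sesq A v v).re) → (∀ a b, ‖A a b‖ ≤ M) → ε ≤ A.det.re → Coercive c A := by
  -- Closed conditions on bounded matrices and unit vectors cut out a compact set; the continuous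
  -- function `v* A v` is positive on it, and its minimum is the constant sought.
  let S : Set (Matrix (Fin r) (Fin r) ℂ × (Fin r → ℂ)) :=
    {p | (p.1.IsHermitian ∧ (∀ v, 0 ≤ (sesq p.1 v v).re) ∧ ε ≤ p.1.det.re) ∧ normSqVec p.2 = 1} ∩
      (Set.univ.pi fun _ => Set.univ.pi fun _ => Metric.closedBall (0 : ℂ) M) ×ˢ
        (Set.univ.pi fun _ => Metric.closedBall (0 : ℂ) 1)
  have hcont : Continuous fun p : Matrix (Fin r) (Fin r) ℂ × (Fin r → ℂ) =>
      (sesq p.1 p.2 p.2).re := by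
    refine Complex.continuous_re.comp ?_
    unfold sesq
    refine continuous_finsetSum _ fun a _ => continuous_finsetSum _ fun b _ => ?_
    exact ((Complex.continuous_conj.comp ((continuous_apply a).comp continuous_snd)).mul
      (continuous_fst.matrix_elem a b)).mul ((continuous_apply b).comp continuous_snd)
  have hS : IsCompact S := by
    refine IsCompact.inter_left (IsCompact.prod (isCompact_univ_pi fun _ =>
      isCompact_univ_pi fun _ => isCompact_closedBall _ _)
      (isCompact_univ_pi fun _ => isCompact_closedBall _ _)) ?_
    refine IsClosed.inter (IsClosed.inter ?_ (IsClosed.inter ?_ ?_)) ?_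
    · exact isClosed_eq continuous_fst.matrix_conjTranspose continuous_fst
    · have e : {p : Matrix (Fin r) (Fin r) ℂ × (Fin r → ℂ) | ∀ v, 0 ≤ (sesq p.1 v v).re} =
          ⋂ v, {p | 0 ≤ (sesq p.1 v v).re} := by ext; simp
      have h1 : IsClosed {p : Matrix (Fin r) (Fin r) ℂ × (Fin r → ℂ) |
          ∀ v, 0 ≤ (sesq p.1 v v).re} := by
        rw [e]
        exact isClosed_iInter fun v => isClosed_le continuous_const
          (Complex.continuous_re.comp ((continuous_sesq v).comp continuous_fst))
      exact h1
    · exact isClosed_le continuous_const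
        (Complex.continuous_re.comp continuous_fst.matrix_det)
    · refine isClosed_eq ?_ continuous_const
      unfold normSqVec
      exact continuous_finsetSum _ fun a _ =>
        (((continuous_apply a).comp continuous_snd).norm).pow 2
  have hne {A : Matrix (Fin r) (Fin r) ℂ} (h : ε ≤ A.det.re) : A.det ≠ 0 := by
    intro h0
    rw [h0] at h
    exact absurd h (not_le.2 hε)
  have hc : ∃ c : ℝ, 0 < c ∧ ∀ p ∈ S, c ≤ (sesq p.1 p.2 p.2).re := by
    -- The set may be empty, for instance when `r = 0`; then any constant works.
    rcases S.eq_empty_or_nonempty with h0 | h0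
    · exact ⟨1, one_pos, fun p hp => by simp [h0] at hp⟩
    · obtain ⟨p, hp, hmin⟩ := hS.exists_isMinOn h0 hcont.continuousOn
      refine ⟨_, ?_, fun q hq => hmin hq⟩
      refine re_sesq_pos hp.1.1.1 hp.1.1.2.1 (hne hp.1.1.2.2) fun hv => ?_
      have := hp.1.2
      simp [hv, normSqVec] at this
  obtain ⟨c, hc0, hc⟩ := hc
  refine ⟨c, hc0, fun A hA hpos hM hdet v => ?_⟩
  by_cases hv : v = 0
  · simp [hv, normSqVec, sesq]
  have hN : 0 < normSqVec v :=
    (normSqVec_nonneg v).lt_of_ne fun h => hv (normSqVec_eq_zero h.symm.le)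
  set t : ℝ := (Real.sqrt (normSqVec v))⁻¹ with ht
  have ht2 : t ^ 2 * normSqVec v = 1 := by
    rw [ht, inv_pow, Real.sq_sqrt hN.le, inv_mul_cancel₀ hN.ne']
  have hn : normSqVec ((t : ℂ) • v) = 1 := by
    rw [← ht2, normSqVec, normSqVec, Finset.mul_sum]
    refine Finset.sum_congr rfl fun a _ => ?_
    rw [Pi.smul_apply, norm_smul, mul_pow, Complex.norm_real, Real.norm_eq_abs, sq_abs]
  have h1 := hc (A, (t : ℂ) • v) ⟨⟨⟨hA, hpos, hdet⟩, hn⟩, fun a _ b _ => by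
    simpa using hM a b, fun a _ => by
      have := sq_norm_le_normSqVec ((t : ℂ) • v) a
      rw [hn] at this
      rw [mem_closedBall_zero_iff]
      exact (sq_le_one_iff₀ (norm_nonneg _)).1 this⟩
  simp only [sesq_smul_left, sesq_smul_right, Complex.conj_ofReal] at h1
  rw [Complex.re_ofReal_mul, Complex.re_ofReal_mul] at h1
  have h2 : c * normSqVec v ≤ t * (t * (sesq A v v).re) * normSqVec v :=
    mul_le_mul_of_nonneg_right h1 hN.le
  have h3 : t * (t * (sesq A v v).re) * normSqVec v = (t ^ 2 * normSqVec v) * (sesq A v v).re := by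
    ring
  rwa [h3, ht2, one_mul] at h2

/-- The entries of a hermitian matrix in terms of its quadratic form. -/
lemma hermitian_polarization {A : Matrix (Fin r) (Fin r) ℂ} (hA : A.IsHermitian) (a b : Fin r)
    {q : ℂ → ℝ} (hq : ∀ t, q t = (sesq A (Pi.single a 1 + t • Pi.single b 1)
      (Pi.single a 1 + t • Pi.single b 1)).re) :
    A a b = (1 / 4) * ((q 1 : ℂ) - Complex.I * q Complex.I - q (-1) +
      Complex.I * q (-Complex.I)) := by
  have hq' (t : ℂ) : (q t : ℂ) = A a a + t * A a b + conj t * A b a + conj t * t * A b b := by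
    have him : (sesq A (Pi.single a 1 + t • Pi.single b 1)
        (Pi.single a 1 + t • Pi.single b 1)).im = 0 := by
      have := sesq_conjTranspose A (Pi.single a 1 + t • Pi.single b 1)
        (Pi.single a 1 + t • Pi.single b 1)
      rw [hA.eq] at this
      exact Complex.conj_eq_iff_im.1 this.symm
    have h1 : (q t : ℂ) = sesq A (Pi.single a 1 + t • Pi.single b 1)
        (Pi.single a 1 + t • Pi.single b 1) := by
      rw [hq t]
      exact Complex.ext (by simp) (by rw [him]; simp)
    rw [h1]
    simp only [sesq_add_left, sesq_add_right, sesq_smul_left, sesq_smul_right, sesq_single]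
    ring
  simp only [hq', map_neg, map_one, Complex.conj_I]
  ring_nf
  simp only [Complex.I_sq]
  ring

/-- Change of basis for the matrix of a sesquilinear form. -/
lemma form_matrix_eq {V : Type*} [AddCommGroup V] [Module ℂ V] (B : V →ₗ⋆[ℂ] V →ₗ[ℂ] ℂ)
    {v f : Fin r → V} {S : Matrix (Fin r) (Fin r) ℂ} (hS : ∀ a, v a = ∑ c, S c a • f c) :
    (Matrix.of fun a b => B (v a) (v b)) = Sᴴ * (Matrix.of fun a b => B (f a) (f b)) * S := by
  ext a b
  simp only [Matrix.of_apply, Matrix.mul_apply, Matrix.conjTranspose_apply, hS, map_sum,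
    LinearMap.sum_apply, map_smulₛₗ, LinearMap.smul_apply, smul_eq_mul, Finset.mul_sum,
    Finset.sum_mul, RCLike.star_def, RingHom.id_apply]
  exact Finset.sum_congr rfl fun c _ => Finset.sum_congr rfl fun d _ => by ring

lemma UpperSemicontinuousOn.measurable_indicator {Ω : Set (Fin n → ℂ)} (hΩ : IsOpen Ω)
    {f : (Fin n → ℂ) → ℝ} (hf : UpperSemicontinuousOn f Ω) : Measurable (Ω.indicator f) := by
  refine measurable_of_restrict_of_restrict_compl hΩ.measurableSet ?_ ?_
  · have e : Ω.domRestrict (Ω.indicator f) = Ω.domRestrict f := by ext z; simp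
    rw [e]
    exact (upperSemicontinuousOn_iff_restrict.2 hf).measurable
  · have e : Ωᶜ.domRestrict (Ω.indicator f) = fun _ => 0 := by
      ext z
      exact indicator_of_notMem z.2 f
    rw [e]
    exact measurable_const

end Bounds

/-! ### Griffiths negative metrics in charts and frames -/

section Frame

open Matrix

variable {n r : ℕ} {X : Type*} [TopologicalSpace X] [ChartedSpace (Fin n → ℂ) X]
  {E : X → Type*} [∀ x, AddCommGroup (E x)] [∀ x, Module ℂ (E x)]
  {Ω : Set (Fin n → ℂ)}

lemma IsPshOn.congr {f g : (Fin n → ℂ) → ℝ} (hf : IsPshOn Ω f) (h : EqOn f g Ω) : IsPshOn Ω g where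
  upperSemicontinuousOn z hz y hy := by
    have hy' : f z < y := by rw [h hz]; exact hy
    filter_upwards [hf.upperSemicontinuousOn z hz y hy', self_mem_nhdsWithin] with w hw hwΩ
    exact (h hwΩ).symm.trans_lt hw
  submean a b hab := by
    obtain ⟨h1, h2⟩ := hf.submean a b hab
    have e : EqOn (fun ζ : ℂ => f (a + ζ • b)) (fun ζ => g (a + ζ • b)) (Metric.sphere 0 |1|) :=
      fun ζ hζ => h (hab ζ (by simpa using (mem_sphere_zero_iff_norm.1 hζ).le))
    refine ⟨h1.congr fun θ _ => e (circleMap_mem_sphere' 0 1 θ), ?_⟩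
    · have ha : a ∈ Ω := by simpa using hab 0 (by simp)
      rwa [← h ha, ← Real.circleAverage_congr_sphere e]

namespace SingularMetric

variable [∀ x, TopologicalSpace (E x)] [TopologicalSpace (TotalSpace (Fin r → ℂ) E)]
  [FiberBundle (Fin r → ℂ) E]
  {h : SingularMetric n r E} {e : OpenPartialHomeomorph X (Fin n → ℂ)} {s : Fin r → ∀ x, E x}
  {z : Fin n → ℂ} {K : Set (Fin n → ℂ)}

lemma mat_isHermitian : (h.mat e s z).IsHermitian := by
  ext a b
  exact (h.hermitian _ _ _).symm

lemma sesq_mat (v : Fin r → ℂ) :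
    (sesq (h.mat e s z) v v).re = h.normSq (e.symm z) (∑ a, v a • s a (e.symm z)) := by
  simp only [sesq, mat, gram, Matrix.of_apply, normSq, map_sum, LinearMap.sum_apply, map_smulₛₗ,
    LinearMap.smul_apply, smul_eq_mul, Finset.mul_sum, RingHom.id_apply]
  rw [Finset.sum_comm]
  congr 1
  exact Finset.sum_congr rfl fun a _ => Finset.sum_congr rfl fun b _ => by ring

lemma re_sesq_mat_nonneg (v : Fin r → ℂ) : 0 ≤ (sesq (h.mat e s z) v v).re := by
  rw [sesq_mat]
  exact h.nonneg _ _

lemma norm_mat_le {M : ℝ} (hM : ∀ a, (h.mat e s z a a).re ≤ M) (a b : Fin r) :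
    ‖h.mat e s z a b‖ ≤ M := by
  have := norm_apply_le_diag (A := h.mat e s z) mat_isHermitian re_sesq_mat_nonneg a b
  linarith [hM a, hM b]

/-! ### Consequences of plurisubharmonicity: the sub-mean value property, measurability and upper
bounds. -/

section Psh

variable [VectorBundle ℂ (Fin r → ℂ) E]

/-- Affine coefficients in the chart coordinates are holomorphic, so combining the frame with them
gives an admissible section over the domain of the chart. -/
lemma isPshOn_affSec (hneg : h.IsGriffithsNegative)
    (he : e ∈ IsManifold.maximalAtlas 𝓘(ℂ, Fin n → ℂ) ω X)
    (hs : IsHolFrame (n := n) e.source s) (v w : Fin r → ℂ) (L : (Fin n → ℂ) →L[ℂ] ℂ) :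
    IsPshOn e.target fun z => (sesq (h.mat e s z) (affSec v w L z) (affSec v w L z)).re := by
  have hu : IsHolSection (n := n) r e.source fun x => ∑ a, affSec v w L (e x) a • s a x := by
    refine ContMDiffOn.sum_section fun a _ => ?_
    refine ContMDiffOn.smul_section (f := fun x => affSec v w L (e x) a) ?_ (hs.contMDiffOn a)
    have h1 : ContMDiff 𝓘(ℂ, Fin n → ℂ) 𝓘(ℂ, ℂ) ω fun z => affSec v w L z a :=
      (contDiff_const.add (L.contDiff.mul contDiff_const)).contMDiff
    exact h1.comp_contMDiffOn (contMDiffOn_of_mem_maximalAtlas he)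
  have h2 := hneg e.source e.open_source _ hu e he
  have hi : e.target ∩ e.symm ⁻¹' e.source = e.target :=
    inter_eq_left.2 fun z hz => e.map_target hz
  rw [hi] at h2
  refine h2.congr fun z hz => ?_
  simp only [e.right_inv hz, sesq_mat]

lemma affPsh_mat (hneg : h.IsGriffithsNegative)
    (he : e ∈ IsManifold.maximalAtlas 𝓘(ℂ, Fin n → ℂ) ω X)
    (hs : IsHolFrame (n := n) e.source s) : AffPsh e.target (h.mat e s) := fun v w L a b hab =>
  ((isPshOn_affSec hneg he hs v w L).submean a b hab).2

lemma upperSemicontinuousOn_sesq_mat (hneg : h.IsGriffithsNegative)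
    (he : e ∈ IsManifold.maximalAtlas 𝓘(ℂ, Fin n → ℂ) ω X)
    (hs : IsHolFrame (n := n) e.source s) (v : Fin r → ℂ) :
    UpperSemicontinuousOn (fun z => (sesq (h.mat e s z) v v).re) e.target := by
  have e1 (z : Fin n → ℂ) : affSec v 0 0 z = v := by funext a; simp [affSec]
  simpa only [e1] using (isPshOn_affSec hneg he hs v 0 0).upperSemicontinuousOn

/-- The quadratic forms are upper semicontinuous, hence Borel, and polarization recovers the entries
from them. -/
lemma measurable_mat (hneg : h.IsGriffithsNegative)
    (he : e ∈ IsManifold.maximalAtlas 𝓘(ℂ, Fin n → ℂ) ω X)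
    (hs : IsHolFrame (n := n) e.source s) (a b : Fin r) :
    Measurable (e.target.indicator fun z => h.mat e s z a b) := by
  set q : ℂ → (Fin n → ℂ) → ℝ := fun t z => (sesq (h.mat e s z) (Pi.single a 1 + t • Pi.single b 1)
      (Pi.single a 1 + t • Pi.single b 1)).re with hq
  have hqm (t : ℂ) : Measurable fun z => ((e.target.indicator (q t) z : ℝ) : ℂ) :=
    Complex.measurable_ofReal.comp
      (UpperSemicontinuousOn.measurable_indicator e.open_target
        (upperSemicontinuousOn_sesq_mat hneg he hs _))
  have e1 : (e.target.indicator fun z => h.mat e s z a b) = fun z =>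
      (1 / 4) * (((e.target.indicator (q 1) z : ℝ) : ℂ) -
        Complex.I * (e.target.indicator (q Complex.I) z : ℝ) -
        (e.target.indicator (q (-1)) z : ℝ) +
        Complex.I * (e.target.indicator (q (-Complex.I)) z : ℝ)) := by
    funext z
    by_cases hz : z ∈ e.target
    · simp only [indicator_of_mem hz]
      exact hermitian_polarization (q := fun t => q t z) mat_isHermitian a b fun t => rfl
    · simp [indicator_of_notMem hz]
  rw [e1]
  exact ((((hqm 1).sub ((hqm _).const_mul _)).sub (hqm _)).add ((hqm _).const_mul _)).const_mul _

/-- Upper semicontinuous functions are bounded above on compact sets. For a non-negative matrix the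
diagonal controls all entries. -/
lemma exists_diag_bound (hneg : h.IsGriffithsNegative)
    (he : e ∈ IsManifold.maximalAtlas 𝓘(ℂ, Fin n → ℂ) ω X)
    (hs : IsHolFrame (n := n) e.source s) (hK : IsCompact K) (hKΩ : K ⊆ e.target) :
    ∃ M : ℝ, ∀ z ∈ K, ∀ a, (h.mat e s z a a).re ≤ M := by
  have h1 (a : Fin r) : ∃ M : ℝ, ∀ z ∈ K, (h.mat e s z a a).re ≤ M := by
    obtain ⟨M, hM⟩ := UpperSemicontinuousOn.bddAbove_of_isCompact hK
      ((upperSemicontinuousOn_sesq_mat hneg he hs (Pi.single a 1)).mono hKΩ)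
    refine ⟨M, fun z hz => ?_⟩
    have := hM (mem_image_of_mem _ hz)
    simpa only [sesq_single] using this
  choose M hM using h1
  refine ⟨∑ a, |M a|, fun z hz a => (hM a z hz).trans ((le_abs_self _).trans ?_)⟩
  exact Finset.single_le_sum (f := fun a => |M a|) (fun _ _ => abs_nonneg _) (Finset.mem_univ a)

end Psh

/-! ### Lower bounds for the determinant in an arbitrary frame, and the passage to matrix functions.
-/

section Det

/-- The coordinates of the sections `s a` in the trivialization at `x₀`. -/
def coordMatrix (x₀ : X) (s : Fin r → ∀ x, E x) (x : X) : Matrix (Fin r) (Fin r) ℂ :=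
  Matrix.of fun c a => (trivializationAt (Fin r → ℂ) E x₀ ⟨x, s a x⟩).2 c

lemma continuousAt_coordMatrix {U : Set X} (hU : IsOpen U) (hs : IsHolFrame (n := n) U s) {x₀ : X}
    (hx₀ : x₀ ∈ U) : ContinuousAt (coordMatrix x₀ s) x₀ := by
  refine continuousAt_pi.2 fun c => continuousAt_pi.2 fun a => ?_
  have h1 := (contMDiffAt_section _).1 (hs.contMDiffAt hU hx₀ a)
  exact (continuous_apply c).continuousAt.comp h1.continuousAt

variable [VectorBundle ℂ (Fin r → ℂ) E]

/-- The middle factor is the matrix of the form in the trivialization and does not depend on `s`, so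
this formula compares two frames. -/
lemma gram_eq_coordMatrix (form : ∀ x, E x →ₗ⋆[ℂ] E x →ₗ[ℂ] ℂ) {x₀ x : X}
    (hx : x ∈ (trivializationAt (Fin r → ℂ) E x₀).baseSet) (s : Fin r → ∀ x, E x) :
    gram form s x = (coordMatrix x₀ s x)ᴴ * (Matrix.of fun a b => form x
      (((trivializationAt (Fin r → ℂ) E x₀).linearEquivAt ℂ x hx).symm (Pi.single a 1))
      (((trivializationAt (Fin r → ℂ) E x₀).linearEquivAt ℂ x hx).symm (Pi.single b 1))) *
      coordMatrix x₀ s x := by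
  refine form_matrix_eq (form x) fun a => ?_
  set T := (trivializationAt (Fin r → ℂ) E x₀).linearEquivAt ℂ x hx with hT
  apply T.injective
  rw [map_sum]
  simp only [map_smul, LinearEquiv.apply_symm_apply]
  ext c
  rw [Finset.sum_apply, Finset.sum_eq_single c]
  · simp [coordMatrix, hT]
  · intro d _ hd
    simp [Pi.single_eq_of_ne hd.symm]
  · simp

lemma det_coordMatrix_ne_zero {U : Set X} (hs : IsHolFrame (n := n) U s) {x₀ : X} (hx₀ : x₀ ∈ U) :
    (coordMatrix x₀ s x₀).det ≠ 0 := by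
  have hb : x₀ ∈ (trivializationAt (Fin r → ℂ) E x₀).baseSet :=
    FiberBundle.mem_baseSet_trivializationAt' x₀
  set T := (trivializationAt (Fin r → ℂ) E x₀).linearEquivAt ℂ x₀ hb with hT
  have h1 : LinearIndependent ℂ (coordMatrix x₀ s x₀).col := by
    have h2 := (hs.linearIndependent hx₀).map' T.toLinearMap T.ker
    have h3 : (coordMatrix x₀ s x₀).col = T.toLinearMap ∘ (s · x₀) := by
      funext a c
      simp [coordMatrix, hT]
    rw [h3]
    exact h2
  exact ((Matrix.isUnit_iff_isUnit_det _).1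
    (Matrix.linearIndependent_cols_iff_isUnit.1 h1)).ne_zero

/-- Each Gram determinant is the squared modulus of its coordinate determinant times one common
determinant in the trivialization. The cross-multiplied form avoids dividing by coordinate
determinants. -/
lemma re_det_gram (form : ∀ x, E x →ₗ⋆[ℂ] E x →ₗ[ℂ] ℂ) {x₀ x : X}
    (hx : x ∈ (trivializationAt (Fin r → ℂ) E x₀).baseSet) (s t : Fin r → ∀ x, E x) :
    ‖(coordMatrix x₀ s x).det‖ ^ 2 * (gram form t x).det.re =
      ‖(coordMatrix x₀ t x).det‖ ^ 2 * (gram form s x).det.re := by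
  have key (u : Fin r → ∀ x, E x) (D : ℂ) : (conj (coordMatrix x₀ u x).det * D *
      (coordMatrix x₀ u x).det).re = ‖(coordMatrix x₀ u x).det‖ ^ 2 * D.re := by
    have : conj (coordMatrix x₀ u x).det * D * (coordMatrix x₀ u x).det =
        ((‖(coordMatrix x₀ u x).det‖ ^ 2 : ℝ) : ℂ) * D := by
      push_cast
      rw [← Complex.conj_mul']
      ring
    rw [this, Complex.re_ofReal_mul]
  rw [gram_eq_coordMatrix form hx s, gram_eq_coordMatrix form hx t]
  simp only [Matrix.det_mul, Matrix.det_conjTranspose, RCLike.star_def, key]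
  ring

/-- A lower bound for the determinant holds locally in every frame. -/
lemma IsDetBoundedBelow.eventually (hdet : h.IsDetBoundedBelow) {U : Set X} (hU : IsOpen U)
    (hs : IsHolFrame (n := n) U s) {x₀ : X} (hx₀ : x₀ ∈ U) :
    ∃ ε : ℝ, 0 < ε ∧ ∀ᶠ x in 𝓝 x₀, ε ≤ (gram h.form s x).det.re := by
  obtain ⟨V, hV, hxV, t, ht, ε, hε, hdet⟩ := hdet x₀
  set σ : X → ℝ := fun x => ‖(coordMatrix x₀ s x).det‖ ^ 2 with hσ
  set τ : X → ℝ := fun x => ‖(coordMatrix x₀ t x).det‖ ^ 2 with hτ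
  have hcont {u : Fin r → ∀ x, E x} {W : Set X} (hW : IsOpen W) (hu : IsHolFrame (n := n) W u)
      (hx : x₀ ∈ W) : ContinuousAt (fun x => ‖(coordMatrix x₀ u x).det‖ ^ 2) x₀ :=
    ((continuous_id.matrix_det.continuousAt.comp
      (continuousAt_coordMatrix hW hu hx)).norm).pow 2
  have hσ0 : 0 < σ x₀ := by
    have := det_coordMatrix_ne_zero hs hx₀
    positivity
  have hτ0 : 0 ≤ τ x₀ := by positivity
  -- By continuity `σ > σ(x₀) / 2` and `τ < τ(x₀) + 1` near `x₀`, and the comparison of the two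
  -- frames reads `σ det_t = τ det_s` with `det_t > ε`.
  refine ⟨σ x₀ / 2 * ε / (τ x₀ + 1), by positivity, ?_⟩
  filter_upwards [(hcont hU hs hx₀).eventually (lt_mem_nhds (half_lt_self hσ0)),
    (hcont hV ht hxV).eventually (gt_mem_nhds (lt_add_one (τ x₀))), hV.mem_nhds hxV,
    (trivializationAt (Fin r → ℂ) E x₀).open_baseSet.mem_nhds
      (FiberBundle.mem_baseSet_trivializationAt' x₀)] with x h1 h2 h3 h4
  have h5 := re_det_gram h.form h4 s t
  have h6 := hdet x h3
  have h1' : σ x₀ / 2 < σ x := h1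
  have h2' : τ x < τ x₀ + 1 := h2
  have h5' : σ x * (gram h.form t x).det.re = τ x * (gram h.form s x).det.re := h5
  have hτx : 0 ≤ τ x := by positivity
  have h7 : σ x₀ / 2 * ε ≤ τ x * (gram h.form s x).det.re := by
    rw [← h5']
    exact mul_le_mul h1'.le h6.le hε.le (by positivity)
  have h8 : 0 < τ x * (gram h.form s x).det.re := (by positivity : 0 < σ x₀ / 2 * ε).trans_le h7
  have h9 : 0 < (gram h.form s x).det.re := pos_of_mul_pos_right h8 hτx
  rw [div_le_iff₀ (by positivity)]
  refine h7.trans ?_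
  rw [mul_comm]
  exact mul_le_mul_of_nonneg_left h2'.le h9.le

/-- Local positive lower bounds combine over a compact set, since finitely many have a positive
minimum. -/
lemma exists_det_mat_ge (hdet : h.IsDetBoundedBelow) (hs : IsHolFrame (n := n) e.source s)
    (hK : IsCompact K) (hKΩ : K ⊆ e.target) :
    ∃ ε : ℝ, 0 < ε ∧ ∀ z ∈ K, ε ≤ (h.mat e s z).det.re := by
  refine hK.induction_on (p := fun K => ∃ ε : ℝ, 0 < ε ∧ ∀ z ∈ K, ε ≤ (h.mat e s z).det.re)
    ⟨1, one_pos, by simp⟩ ?_ ?_ fun z hz => ?_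
  · rintro K₁ K₂ h12 ⟨ε, hε, h2⟩
    exact ⟨ε, hε, fun z hz => h2 z (h12 hz)⟩
  · rintro K₁ K₂ ⟨ε₁, hε₁, h1⟩ ⟨ε₂, hε₂, h2⟩
    refine ⟨min ε₁ ε₂, lt_min hε₁ hε₂, fun z hz => ?_⟩
    rcases hz with hz | hz
    · exact (min_le_left _ _).trans (h1 z hz)
    · exact (min_le_right _ _).trans (h2 z hz)
  · obtain ⟨ε, hε, hev⟩ := hdet.eventually e.open_source hs (e.map_target (hKΩ hz))
    have h1 : ∀ᶠ w in 𝓝 z, ε ≤ (h.mat e s w).det.re :=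
      (e.continuousAt_symm (hKΩ hz)).eventually hev
    exact ⟨_, mem_nhdsWithin_of_mem_nhds h1, ε, hε, fun w hw => hw⟩

/-- The matrix of a Griffiths negative metric with determinant bounded below. -/
theorem locMetric_mat (hneg : h.IsGriffithsNegative) (hdet : h.IsDetBoundedBelow)
    (he : e ∈ IsManifold.maximalAtlas 𝓘(ℂ, Fin n → ℂ) ω X)
    (hs : IsHolFrame (n := n) e.source s) : LocMetric e.target (h.mat e s) where
  isOpen := e.open_target
  hermitian _ _ := mat_isHermitian
  measurable := measurable_mat hneg he hs
  bound K hKΩ hK := by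
    obtain ⟨M, hM⟩ := exists_diag_bound hneg he hs hK hKΩ
    exact ⟨M, fun z hz => norm_mat_le (hM z hz)⟩
  coercive K hKΩ hK := by
    obtain ⟨M, hM⟩ := exists_diag_bound hneg he hs hK hKΩ
    obtain ⟨ε, hε, hd⟩ := exists_det_mat_ge hdet hs hK hKΩ
    obtain ⟨c, hc, hA⟩ := exists_coercive_of_det r M hε
    exact ⟨c, hc, fun z hz => hA _ mat_isHermitian re_sesq_mat_nonneg (norm_mat_le (hM z hz))
      (hd z hz)⟩
  affPsh := affPsh_mat hneg he hs

/-- Decreasing sequences of smooth Griffiths negative metrics, in charts and frames. -/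
theorem exists_goodSeq_mat (hneg : h.IsGriffithsNegative) (hdet : h.IsDetBoundedBelow)
    (he : e ∈ IsManifold.maximalAtlas 𝓘(ℂ, Fin n → ℂ) ω X)
    (hs : IsHolFrame (n := n) e.source s) {hν : ℕ → SingularMetric n r E}
    (hsm : ∀ m, (hν m).IsSmooth) (hνneg : ∀ m, (hν m).IsGriffithsNegative)
    (hdec : DecreasesTo hν h) (hKΩ : K ⊆ e.target) (hK : IsCompact K) :
    ∃ U c M, GoodSeq U K c M (fun m => (hν m).mat e s) (h.mat e s) := by
  obtain ⟨K₁, hK₁, hKK₁, hK₁Ω⟩ := exists_compact_between hK e.open_target hKΩ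
  -- Monotonicity gives uniform bounds: `h ≤ h_ν` transfers the lower bound of `h`, and `h_ν ≤ h_0`
  -- transfers the upper bound of `h_0`.
  obtain ⟨c, hc, hcoer⟩ := (locMetric_mat hneg hdet he hs).coercive K₁ hK₁Ω hK₁
  obtain ⟨M, hM⟩ := exists_diag_bound (hνneg 0) he hs hK₁ hK₁Ω
  have hsmooth (m : ℕ) : MSmoothOn e.target ((hν m).mat e s) := (hsm m).2 e he s hs
  refine ⟨interior K₁, c, M, isOpen_interior, hK, hKK₁, hc, fun m => ?_, ?_⟩
  · refine ⟨(hsmooth m).mono (interior_subset.trans hK₁Ω), fun _ _ => mat_isHermitian, ?_, ?_, ?_⟩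
    · refine fun z hz => (hcoer z (interior_subset hz)).mono fun v => ?_
      rw [sesq_mat, sesq_mat]
      obtain ⟨h1, h2⟩ := hdec (e.symm z) (∑ a, v a • s a (e.symm z))
      exact h1.le_of_tendsto h2 m
    · refine fun z hz => norm_mat_le fun a => (le_trans ?_ (hM z (interior_subset hz) a))
      have h1 := (hdec (e.symm z) (∑ b, (Pi.single a 1 : Fin r → ℂ) b • s b (e.symm z))).1
        (Nat.zero_le m)
      simpa only [← sesq_mat, sesq_single] using h1
    · exact fun z hz => (affPsh_mat (hνneg m) he hs).griffithsAt e.open_target (hsmooth m)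
        (fun _ _ => mat_isHermitian) (fun _ _ => re_sesq_mat_nonneg)
        (hK₁Ω (interior_subset hz))
  -- Only the quadratic forms are known to converge; polarization gives convergence of the
  -- off-diagonal entries too, here at every point.
  · refine ae_of_all _ fun z a b => ?_
    have hq (t : ℂ) := (hdec (e.symm z) (∑ c, (Pi.single a 1 + t • Pi.single b 1 : Fin r → ℂ) c •
      s c (e.symm z))).2
    simp only [← sesq_mat] at hq
    have hq' (t : ℂ) := (Complex.continuous_ofReal.tendsto _).comp (hq t)
    rw [hermitian_polarization (A := h.mat e s z) mat_isHermitian a b fun t => rfl]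
    simp_rw [fun m => hermitian_polarization (A := (hν m).mat e s z) mat_isHermitian a b
      fun t => rfl]
    exact (((((hq' 1).sub ((hq' _).const_mul _)).sub (hq' _)).add
      ((hq' _).const_mul _)).const_mul _)

end Det

end SingularMetric

end Frame

end SingHerm

end

theorem theorem1p5 {n r : ℕ} {X : Type*} [TopologicalSpace X] [T2Space X]
    [SecondCountableTopology X] [ChartedSpace (Fin n → ℂ) X]
    [IsManifold 𝓘(ℂ, Fin n → ℂ) ω X]
    {E : X → Type*} [∀ x, AddCommGroup (E x)] [∀ x, Module ℂ (E x)] [∀ x, TopologicalSpace (E x)]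
    [TopologicalSpace (Bundle.TotalSpace (Fin r → ℂ) E)]
    [FiberBundle (Fin r → ℂ) E] [VectorBundle ℂ (Fin r → ℂ) E]
    [ContMDiffVectorBundle ω (Fin r → ℂ) E 𝓘(ℂ, Fin n → ℂ)]
    (h : SingHerm.SingularMetric n r E)
    (hneg : h.IsGriffithsNegative)
    (hdet : h.IsDetBoundedBelow)
    -- an arbitrary holomorphic chart together with an arbitrary holomorphic frame on its domain
    (e : OpenPartialHomeomorph X (Fin n → ℂ))
    (he : e ∈ IsManifold.maximalAtlas 𝓘(ℂ, Fin n → ℂ) ω X)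
    (s : Fin r → ∀ x, E x)
    (hs : SingHerm.IsHolFrame (n := n) e.source s) :
    -- the connection form `θ = h⁻¹ ∂h` exists, is unique almost everywhere and lies in `L²_loc`
    ∃ θ : Fin n → (Fin n → ℂ) → Matrix (Fin r) (Fin r) ℂ,
      SingHerm.IsConnForm e.target (h.mat e s) θ ∧
      (∀ θ', SingHerm.IsConnForm e.target (h.mat e s) θ' →
        ∀ j, ∀ᵐ z ∂(volume.restrict e.target), θ' j z = θ j z) ∧
      (∀ j a b, SingHerm.MemL2Loc e.target (fun z => θ j z a b)) ∧
      -- the current `Θ = ∂̄θ` has measure coefficients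
      ∃ Θ : Fin n → Fin n → Fin r → Fin r → ((Fin n → ℂ) → ℂ) → ℂ,
        (∀ j k a b, SingHerm.IsRadonMeasure e.target (Θ j k a b)) ∧
        SingHerm.IsDbarOf e.target θ Θ ∧
        -- weak convergence of the curvatures of every approximating sequence
        ∀ hν : ℕ → SingHerm.SingularMetric n r E,
          (∀ m, (hν m).IsSmooth) → (∀ m, (hν m).IsGriffithsNegative) →
          SingHerm.SingularMetric.DecreasesTo hν h →
          ∀ ξ : (Fin n → ℂ) → (Fin n → ℂ), ContDiffOn ℝ ∞ ξ e.target →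
          ∀ a b, ∀ φ : (Fin n → ℂ) → ℂ, SingHerm.IsCc e.target φ →
            Tendsto (fun m => ∫ z, φ z * SingHerm.curvAt ((hν m).mat e s) ξ z a b) atTop
              (𝓝 (SingHerm.currentAt Θ ξ a b φ)) := by
  obtain ⟨θ, hθ, hθu, hθ2, Θ, hΘ, hΘθ, hlim⟩ :=
    (SingHerm.SingularMetric.locMetric_mat hneg hdet he hs).exists_curvature
  exact ⟨θ, hθ, hθu, hθ2, Θ, hΘ, hΘθ, fun hν hsm hνneg hdec ξ hξ => hlim _
    (fun K hKΩ hK => SingHerm.SingularMetric.exists_goodSeq_mat hneg hdet he hs hsm hνneg hdec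
      hKΩ hK) ξ hξ.continuousOn⟩
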